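/- Let $s\in\{\tfrac12,1,\tfrac32,\dots\}$ and consider on Minkowski space $M=(\mathbb R^4,\eta)$ the massless spin $s$ field equation $\partial^{A_1}_{A'}\phi_{A_1\cdots A_{2s}}(x)=0$ for a symmetric spinor field $\phi_{A_1\cdots A_{2s}}$. Spinor indices are raised and lowered with the spin metric $\epsilon$, and a multi-index $\mathbf B_k=(B_1\cdots B_k)$ stands for $k$ completely symmetric indices. The solution jet space $J^\infty_\Delta$ has as coordinates $x\in M$ and the arbitrary symmetric spinors $\phi^{\mathbf A'_p}_{\mathbf A_{2s+p}}$, $p\ge 0$ (the symmetrized $p$-th derivatives of $\phi$), together with their complex conjugates $\bar\phi^{\mathbf A_p}_{\mathbf A'_{2s+p}}$; the total derivative $\mathcal D^{C'}_{C}$ on it acts by $\partial^{C'}_C$ on functions of $x$, and by $\mathcal D^{C'}_{C}\phi^{\mathbf A'_p}_{\mathbf A_{2s+p}}=\phi^{\mathbf A'_pC'}_{\mathbf A_{2s+p}C}$ and the conjugate relation. A spinor function is a smooth complex spinor-valued function of $x$ and of finitely many jet coordinates; it is Poincaré covariant if it is equivariant under $\mathrm{ISL}(2,\mathbb C)$,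 the double cover of the Poincaré group. A covariant symmetry operator is a Poincaré covariant spinor function $X_{\mathbf A_{2s}}{}^{\mathbf B'_q}_{\mathbf B_p}$ with $\mathcal D^{A_{2s}}_{A'}X_{\mathbf A_{2s}}{}^{\mathbf B'_q}_{\mathbf B_p}=0$. A covariant conserved tensor is a Poincaré covariant spinor function $T^{A'\mathbf B'_q}_{A\mathbf B_p}$ with $\mathcal D^{A}_{A'}T^{A'\mathbf B'_q}_{A\mathbf B_p}=0$. Two such tensors are equivalent if their difference is a curl, i.e. (with lowered indices and the indices $\mathbf B_p,\mathbf B'_q$ suppressed) of the form $\mathcal D_A^{C'}\Theta_{A'C'}+\mathcal D_{A'}^{C}\Psi_{AC}$ for some spinor functions $\Theta_{A'C'}$, $\Psi_{AC}$ of $x$ and the jet coordinates that are symmetric in the two displayed indices. Then, for all $p,q\ge 0$: (i) Every covariant symmetry operator with indices $\mathbf B_p,\mathbf B'_q$ is a complex linear combination of those of the following operators that have the same index type: the elementary operator $X_{\mathbf A_{2s}}{}^{\mathbf B_{2s}}=\delta_{\mathbf A_{2s}}^{\mathbf B_{2s}}$, and, for $k\ge 0$, the spacetime and chiral symmetry operators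 $$X_{\mathbf A_{2s}}{}^{\mathbf B'_k}_{\mathbf B_k}=\phi^{\mathbf B'_k}_{\mathbf B_k\mathbf A_{2s}},\qquad X_{\mathbf A_{2s}}{}^{\mathbf B'_{4s+k}}_{\mathbf B_k}=\bar\phi^{\mathbf B'_{4s+k}}_{\mathbf B_k\mathbf A_{2s}}.$$ (ii) Every covariant conserved tensor with indices $\mathbf B_p,\mathbf B'_q$ is equivalent to a complex linear combination of those of the following tensors, and of their complex conjugates, that have the same index type: the elementary tensor $T^{A'B'}_{A\mathbf B_{2s-1}}=\epsilon^{A'B'}\phi_{A\mathbf B_{2s-1}}$ and, for $k\ge 0$, the spacetime, zilch and chiral tensors $$T^{A'\mathbf B'_{2s+2k-1}}_{A\mathbf B_{2s+2k-1}}=\bar\phi^{A'(\mathbf B'_{2s+k-1}}_{(\mathbf B_{k}}\,\phi^{\mathbf B'_{k})}_{\mathbf B_{2s+k-1})A},\qquad T^{A'\mathbf B'_{2s+2k}}_{A\mathbf B_{2s+2k}}=\mathrm i\,\bar\phi^{A'(\mathbf B'_{2s+k}}_{(\mathbf B_{k+1}}\,\phi^{\mathbf B'_{k})}_{\mathbf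 B_{2s+k-1})A},$$ $$T^{A'\mathbf B'_{4s+2k+1}}_{A\mathbf B_{2k+1}}=\bar\phi^{(\mathbf B'_{2s+k+1}}_{A(\mathbf B_{k}}\,\bar\phi^{\mathbf B'_{2s+k})A'}_{\mathbf B_{k+1})},$$ where in each product the two factors carry complementary groups of the indices $\mathbf B$ and of the indices $\mathbf B'$, and round brackets denote symmetrization over all the $\mathbf B$'s and over all the $\mathbf B'$'s (not over $A$, $A'$). -/

import Mathlib

open scoped ContDiff ComplexConjugate Nat

noncomputable section

namespace MasslessSpin

/-! ### Spinor algebra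

All spinor indices are written as lower indices: an upper index is lowered with the spin metric.
Blocks of unprimed and of primed indices are index strings with values in `Fin 2`. -/

/-- Minkowski space, in standard coordinates. -/
abbrev Minkowski : Type := Fin 4 → ℝ

/-- Strings `A₁ ⋯ A_k` of spinor indices. -/
abbrev Idx (k : ℕ) : Type := Fin k → Fin 2

/-- Components of the spin metric `ε_{AB}`; `ε^{AB}`, `ε_{A'B'}`, `ε^{A'B'}` are the same array. -/
def eps (A B : Fin 2) : ℂ := !![0, 1; -1, 0] A B

/-- The identity matrix and the Pauli spin matrices. -/
def pauli : Fin 4 → Matrix (Fin 2) (Fin 2) ℂ :=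
  ![!![1, 0; 0, 1], !![0, 1; 1, 0], !![0, -Complex.I; Complex.I, 0], !![1, 0; 0, -1]]

/-- `σ_a^{AA'}`, normalised by `η_{ab} = σ_a^{AA'} σ_b^{BB'} ε_{AB} ε_{A'B'}`,
`η = diag(1,-1,-1,-1)`. -/
def soldering (a : Fin 4) (A A' : Fin 2) : ℂ := pauli a A A' / (Real.sqrt 2 : ℂ)

/-- The inverse `σ^a_{AA'}` of `σ_a^{AA'}`. -/
def invSoldering (a : Fin 4) (A A' : Fin 2) : ℂ := conj (soldering a A A')

/-- Symmetric spinors `ψ_{A₁⋯A_m A'₁⋯A'_k}`. -/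
def SymSpinor (m k : ℕ) : Submodule ℂ (Idx m → Idx k → ℂ) where
  carrier := {ψ | ∀ (σ : Equiv.Perm (Fin m)) (τ : Equiv.Perm (Fin k)) (A : Idx m) (A' : Idx k),
    ψ (A ∘ σ) (A' ∘ τ) = ψ A A'}
  add_mem' := fun ha hb σ τ A A' => by
    simp only [Pi.add_apply, ha σ τ A A', hb σ τ A A']
  zero_mem' := fun _ _ _ _ => rfl
  smul_mem' := fun c ψ h σ τ A A' => by
    simp only [Pi.smul_apply, h σ τ A A']

/-- Values of spinor functions: arrays with four blocks of lower indices, namely `a` unprimed and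
`a'` primed indices, followed by `p` unprimed indices `B_p` and `q` primed indices `B'_q`. -/
abbrev Arr (a a' p q : ℕ) : Type := Idx a → Idx a' → Idx p → Idx q → ℂ

/-! ### The solution jet space -/

/-- The solution jet space `J^∞_Δ(φ)` (over a point) of the massless field equation for
`φ_{A₁⋯A_n}`, `n = 2s`: its coordinates are the symmetric spinors
`φ_{A₁⋯A_{n+p} A'₁⋯A'_p}`, `p ≥ 0`, that is, the symmetrised `p`-th derivatives. -/
abbrev Jet (n : ℕ) : Type := ∀ p : ℕ, SymSpinor (n + p) p

/-- Truncated jets, of order at most `r`. -/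
abbrev JetUpTo (n r : ℕ) : Type := ∀ p : Fin (r + 1), SymSpinor (n + (p : ℕ)) (p : ℕ)

/-- The coordinate `φ_{L L'}` of order `p`, where `L`, `L'` list the `n + p` unprimed and the `p`
primed indices. -/
def Jet.fld {n : ℕ} (j : Jet n) (p : ℕ) (L L' : List (Fin 2)) : ℂ :=
  (j p : Idx (n + p) → Idx p → ℂ) (fun i => L.getD i 0) (fun i => L'.getD i 0)

/-- The complex conjugate coordinate `φ̄_{L L'}` of order `p`, where `L`, `L'` list the `p`
unprimed and the `n + p` primed indices. -/
def Jet.cfld {n : ℕ} (j : Jet n) (p : ℕ) (L L' : List (Fin 2)) : ℂ :=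
  conj (j.fld p L' L)

theorem cons_comp_perm {k : ℕ} (C : Fin 2) (A : Idx k) (σ : Equiv.Perm (Fin k)) :
    (Fin.cons C (A ∘ σ) : Idx (k + 1)) =
      (Fin.cons C A : Idx (k + 1)) ∘ (Equiv.Perm.decomposeFin.symm (0, σ)) := by
  funext i
  refine Fin.cases ?_ (fun i => ?_) i
  · simp
  · simp

/-- The jet `p ↦ φ_{A_{n+p} C A'_p C'}` of the derivative of `φ` with respect to `x^{CC'}`. -/
def Jet.shift {n : ℕ} (j : Jet n) (C C' : Fin 2) : Jet n := fun p =>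
  ⟨fun A A' => (j (p + 1) : Idx (n + p + 1) → Idx (p + 1) → ℂ)
      (Fin.cons C A) (Fin.cons C' A'), fun σ τ A A' => by
    beta_reduce
    rw [cons_comp_perm, cons_comp_perm]
    exact (j (p + 1)).2 _ _ _ _⟩

/-- The jet of the derivative of `φ` with respect to `x^a`. -/
def Jet.shiftVec {n : ℕ} (j : Jet n) (a : Fin 4) : Jet n :=
  ∑ C : Fin 2, ∑ C' : Fin 2, soldering a C C' • j.shift C C'

/-- The total derivative `D_a` on the solution jet space: the derivative of `f (x, φ, φ̄, …)` along
`x^a` and along the induced change of all the jet coordinates and their conjugates. -/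
def totalDerivVec {n : ℕ} (a : Fin 4) (f : Minkowski → Jet n → ℂ) : Minkowski → Jet n → ℂ :=
  fun x j => lineDeriv ℝ (fun y : Minkowski × Jet n => f y.1 y.2) (x, j)
    ((Pi.single a 1 : Minkowski), j.shiftVec a)

/-- The total derivative `D_{CC'}` on the solution jet space. -/
def totalDeriv {n : ℕ} (C C' : Fin 2) (f : Minkowski → Jet n → ℂ) : Minkowski → Jet n → ℂ :=
  fun x j => ∑ a : Fin 4, invSoldering a C C' * totalDerivVec a f x j

/-! ### Spinor functions and Poincaré covariance -/

/-- Functions of `x` and of the jet with values in spinor arrays. -/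
abbrev SpinorFn (n a a' p q : ℕ) : Type := Minkowski → Jet n → Arr a a' p q

/-- `F` is a smooth function of `x` and of finitely many of the jet coordinates and their
conjugates. -/
def IsLocal {n a a' p q : ℕ} (F : SpinorFn n a a' p q) : Prop :=
  ∃ (r : ℕ) (f : Minkowski × JetUpTo n r → Arr a a' p q), ContDiff ℝ ∞ f ∧
    ∀ x j, F x j = f (x, fun p => j p)

/-- `F` is completely symmetric in each of its four blocks of indices. -/
def IsSymm {n a a' p q : ℕ} (F : SpinorFn n a a' p q) : Prop :=
  ∀ (σ : Equiv.Perm (Fin a)) (σ' : Equiv.Perm (Fin a')) (τ : Equiv.Perm (Fin p))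
    (τ' : Equiv.Perm (Fin q)) x j A A' B B',
    F x j (A ∘ σ) (A' ∘ σ') (B ∘ τ) (B' ∘ τ') = F x j A A' B B'

/-- The group `SL(2,ℂ)`. -/
abbrev SL2C : Type := Matrix.SpecialLinearGroup (Fin 2) ℂ

/-- The coefficient `g_{A₁}^{B₁} ⋯ g_{A_k}^{B_k}`. -/
def coeff (g : SL2C) {k : ℕ} (A B : Idx k) : ℂ := ∏ i, (g : Matrix (Fin 2) (Fin 2) ℂ) (A i) (B i)

theorem coeff_comp (g : SL2C) {k : ℕ} (A B : Idx k) (σ : Equiv.Perm (Fin k)) :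
    coeff g (A ∘ σ) (B ∘ σ) = coeff g A B :=
  Equiv.prod_comp σ fun i => (g : Matrix (Fin 2) (Fin 2) ℂ) (A i) (B i)

theorem sum_coeff_comp {k : ℕ} (σ : Equiv.Perm (Fin k)) (f : Idx k → ℂ) :
    ∑ B : Idx k, f (B ∘ σ) = ∑ B : Idx k, f B :=
  Equiv.sum_comp (Equiv.arrowCongr σ.symm (Equiv.refl (Fin 2))) f

/-- The action of `SL(2,ℂ)` on jets. -/
def Jet.act {n : ℕ} (g : SL2C) (j : Jet n) : Jet n := fun p =>
  ⟨fun A A' => ∑ B : Idx (n + p), ∑ B' : Idx p,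
      coeff g A B * conj (coeff g A' B') * (j p : Idx (n + p) → Idx p → ℂ) B B',
    fun σ τ A A' => by
      beta_reduce
      rw [← sum_coeff_comp σ]
      refine Finset.sum_congr rfl fun B _ => ?_
      rw [← sum_coeff_comp τ]
      refine Finset.sum_congr rfl fun B' _ => ?_
      rw [coeff_comp, coeff_comp, (j p).2 σ τ B B']⟩

/-- The action of `SL(2,ℂ)` on arrays of lower spinor indices. -/
def Arr.act {a a' p q : ℕ} (g : SL2C) (F : Arr a a' p q) : Arr a a' p q := fun A A' B B' =>
  ∑ C : Idx a, ∑ C' : Idx a', ∑ E : Idx p, ∑ E' : Idx q,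
    coeff g A C * conj (coeff g A' C') * coeff g B E * conj (coeff g B' E') * F C C' E E'

/-- The spinorial coordinates `x^{AA'} = x^a σ_a^{AA'}`. -/
def spinCoord (x : Minkowski) (A A' : Fin 2) : ℂ := ∑ a, (x a : ℂ) * soldering a A A'

/-- The Lorentz transformation of `M` covered by `g`, under which `x^{AA'}` transforms as a spinor
with upper indices (contragrediently to lower indices). -/
def lorentz (g : SL2C) (x : Minkowski) : Minkowski := fun a =>
  (∑ A : Fin 2, ∑ A' : Fin 2, invSoldering a A A' *
    ∑ B : Fin 2, ∑ B' : Fin 2, ((g⁻¹ : SL2C) : Matrix (Fin 2) (Fin 2) ℂ) B A *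
      conj (((g⁻¹ : SL2C) : Matrix (Fin 2) (Fin 2) ℂ) B' A') * spinCoord x B B').re

/-- Poincaré covariance: equivariance under the elements `(g, v)`, `g ∈ SL(2,ℂ)`, `v` a translation,
of the double cover `ISL(2,ℂ)` of the Poincaré group. -/
def IsCovariant {n a a' p q : ℕ} (F : SpinorFn n a a' p q) : Prop :=
  ∀ (g : SL2C) (v x : Minkowski) (j : Jet n),
    F (lorentz g x + v) (j.act g) = (F x j).act g

/-! ### Symmetry operators -/

/-- `X_{A_n B_p B'_q}` is a covariant symmetry operator: a covariant spinor function with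
`D^{A_n}_{A'} X_{A_n B_p B'_q} = 0`. -/
structure IsCovariantSymmetryOperator {n p q : ℕ} (X : SpinorFn n n 0 p q) : Prop where
  isLocal : IsLocal X
  isSymm : IsSymm X
  isCovariant : IsCovariant X
  symmetry_eq : ∀ (i : Fin n) (A : Idx n) (A' : Fin 2) (B : Idx p) (B' : Idx q) x j,
    ∑ C : Fin 2, ∑ E : Fin 2,
      eps C E * totalDeriv E A' (fun x j => X x j (Function.update A i C) ![] B B') x j = 0

/-- `δ_{A_n}^{B_n}` with `B_n` lowered: `ε_{A₁B₁} ⋯ ε_{A_nB_n}` symmetrised (for `p = n`). -/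
def elementaryOperator (n p q : ℕ) : SpinorFn n n 0 p q := fun _ _ A _ B _ =>
  (∑ e : Fin n ≃ Fin p, ∏ i, eps (A i) (B (e i))) / (n ! : ℂ)

/-- `φ_{B_p A_n B'_p}` (for `q = p`). -/
def spacetimeOperator (n p q : ℕ) : SpinorFn n n 0 p q := fun _ j A _ B B' =>
  j.fld p (List.ofFn B ++ List.ofFn A) (List.ofFn B')

/-- `φ̄_{B_p A_n B'_{2n+p}}` (for `q = 2n + p`). -/
def chiralOperator (n p q : ℕ) : SpinorFn n n 0 p q := fun _ j A _ B B' =>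
  j.cfld (n + p) (List.ofFn B ++ List.ofFn A) (List.ofFn B')

/-- The basic symmetry operators with `p` unprimed and `q` primed indices. -/
inductive IsBasicOperator (n p q : ℕ) : SpinorFn n n 0 p q → Prop
  | elementary (hp : p = n) (hq : q = 0) : IsBasicOperator n p q (elementaryOperator n p q)
  | spacetime (hq : q = p) : IsBasicOperator n p q (spacetimeOperator n p q)
  | chiral (hq : q = 2 * n + p) : IsBasicOperator n p q (chiralOperator n p q)

/-! ### Conserved tensors -/

/-- `T_{A A' B_p B'_q}` is a covariant conserved tensor: a covariant spinor function with
`D^{AA'} T_{A A' B_p B'_q} = 0`. -/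
structure IsCovariantConservedTensor {n p q : ℕ} (T : SpinorFn n 1 1 p q) : Prop where
  isLocal : IsLocal T
  isSymm : IsSymm T
  isCovariant : IsCovariant T
  divergence_eq : ∀ (B : Idx p) (B' : Idx q) x j,
    ∑ A : Fin 2, ∑ A' : Fin 2, ∑ C : Fin 2, ∑ C' : Fin 2,
      eps A C * eps A' C' * totalDeriv C C' (fun x j => T x j ![A] ![A'] B B') x j = 0

/-- `T` is a curl, `T_{AA'} = D_A^{C'} Θ_{A'C'} + D_{A'}^C Ψ_{AC}` with symmetric spinor functions
`Θ_{A'C' B_p B'_q}` and `Ψ_{AC B_p B'_q}` of `x` and the jet; equivalently, the divergence of a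
skew tensor. -/
def IsCurl {n p q : ℕ} (T : SpinorFn n 1 1 p q) : Prop :=
  ∃ (Θ : SpinorFn n 0 2 p q) (Ψ : SpinorFn n 2 0 p q),
    IsLocal Θ ∧ IsSymm Θ ∧ IsLocal Ψ ∧ IsSymm Ψ ∧
    ∀ x j (A A' : Fin 2) (B : Idx p) (B' : Idx q),
      T x j ![A] ![A'] B B' =
        (∑ C' : Fin 2, ∑ E' : Fin 2,
          eps C' E' * totalDeriv A E' (fun x j => Θ x j ![] ![A', C'] B B') x j) +
        ∑ C : Fin 2, ∑ E : Fin 2,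
          eps C E * totalDeriv E A' (fun x j => Ψ x j ![A, C] ![] B B') x j

/-- Two tensors are equivalent if their difference is a curl. -/
def TensorEquiv {n p q : ℕ} (T G : SpinorFn n 1 1 p q) : Prop := IsCurl (T - G)

/-- Symmetrisation over the indices `B_p` and over the indices `B'_q`. -/
def symmetrize {p q : ℕ} (f : List (Fin 2) → List (Fin 2) → ℂ) (B : Idx p) (B' : Idx q) : ℂ :=
  (∑ τ : Equiv.Perm (Fin p), ∑ τ' : Equiv.Perm (Fin q),
    f (List.ofFn (B ∘ τ)) (List.ofFn (B' ∘ τ'))) / ((p ! : ℂ) * (q ! : ℂ))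

/-- `ε_{A'B'} φ_{A B_{n-1}}` (for `p = n - 1`, `q = 1`). -/
def elementaryTensor (n p q : ℕ) : SpinorFn n 1 1 p q := fun _ j A A' =>
  symmetrize fun b b' => eps (A' 0) (b'.getD 0 0) * j.fld 0 (A 0 :: b) []

/-- `φ̄_{B_k A' B'_{n+k-1}} φ_{A B_{n+k-1} B'_k}`, symmetrised (for `p = q = n + 2k - 1`). -/
def spacetimeTensor (n k p q : ℕ) : SpinorFn n 1 1 p q := fun _ j A A' =>
  symmetrize fun b b' =>
    j.cfld k (b.take k) (A' 0 :: b'.take (n + k - 1)) *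
      j.fld k (A 0 :: b.drop k) (b'.drop (n + k - 1))

/-- `i φ̄_{B_{k+1} A' B'_{n+k}} φ_{A B_{n+k-1} B'_k}`, symmetrised (for `p = q = n + 2k`). -/
def zilchTensor (n k p q : ℕ) : SpinorFn n 1 1 p q := fun _ j A A' =>
  symmetrize fun b b' =>
    Complex.I * j.cfld (k + 1) (b.take (k + 1)) (A' 0 :: b'.take (n + k)) *
      j.fld k (A 0 :: b.drop (k + 1)) (b'.drop (n + k))

/-- `φ̄_{A B_k B'_{n+k+1}} φ̄_{B_{k+1} A' B'_{n+k}}`, symmetrised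
(for `p = 2k + 1`, `q = 2n + 2k + 1`). -/
def chiralTensor (n k p q : ℕ) : SpinorFn n 1 1 p q := fun _ j A A' =>
  symmetrize fun b b' =>
    j.cfld (k + 1) (A 0 :: b.take k) (b'.take (n + k + 1)) *
      j.cfld (k + 1) (b.drop k) (A' 0 :: b'.drop (n + k + 1))

/-- The complex conjugate of a tensor. -/
def conjTensor {n p q : ℕ} (T : SpinorFn n 1 1 q p) : SpinorFn n 1 1 p q :=
  fun x j A A' B B' => conj (T x j A' A B' B)

/-- The basic conserved tensors with further indices `B_p`, `B'_q`. -/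
inductive IsBasicTensor (n p q : ℕ) : SpinorFn n 1 1 p q → Prop
  | elementary (hp : p + 1 = n) (hq : q = 1) : IsBasicTensor n p q (elementaryTensor n p q)
  | spacetime (k : ℕ) (hp : p + 1 = n + 2 * k) (hq : q + 1 = n + 2 * k) :
      IsBasicTensor n p q (spacetimeTensor n k p q)
  | zilch (k : ℕ) (hp : p = n + 2 * k) (hq : q = n + 2 * k) :
      IsBasicTensor n p q (zilchTensor n k p q)
  | chiral (k : ℕ) (hp : p = 2 * k + 1) (hq : q = 2 * n + 2 * k + 1) :
      IsBasicTensor n p q (chiralTensor n k p q)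

/-- The basic conserved tensors and the complex conjugates of basic conserved tensors. -/
def basicTensors (n p q : ℕ) : Set (SpinorFn n 1 1 p q) :=
  {G | IsBasicTensor n p q G} ∪ {G | ∃ T : SpinorFn n 1 1 q p, IsBasicTensor n q p T ∧
    G = conjTensor T}

end MasslessSpin

end

noncomputable section

namespace MasslessSpin

/-! ### Polynomials with prescribed coefficients -/

section Koszul

open MvPolynomial

variable {σ : Type*} {A : Type*} [CommRing A]

/-! The partial derivatives of order m of a local function with respect to the jet coordinates are
collected in a polynomial, its symbol, in spinors π_i, π̃_i: one null momentum π_i π̃_i for each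
factor of an m-linear expression. Since the commutator of ∂_ν with D_{CC'} is again a partial
derivative, D_{CC'} acts on symbols as D_{CC'} on the coefficients plus multiplication by the total
momentum K_{CC'} = ∑ π_{iC} π̃_{iC'} (`symb_totalD`). Differential questions thus become questions
about ideals generated by the K_{CC'}. Spinor functions are smooth rather than polynomial, so
Taylor's formula along rays is used; its integral remainder is realized by a symbol with averaged
coefficients, and averaging along rays commutes with D (`taylor_three`, `totalD_rayMean`).

Symmetry operators. On symbols with two momenta the wave operator is injective
(`eq_zero_of_field_equation`), so all second derivatives of a symmetry operator vanish and it is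
affine in the jet. Its constant part is an SL(2,ℂ)-invariant array, a multiple of the product of ε's
(`eq_smul_elementary`). Its linear symbol is covariant and annihilated by contraction with π; as
SL(2,ℂ) is transitive on nonzero spinors with unipotent stabiliser, it is a multiple of the product
of momenta (`eq_strMom_of_covariant`), and this is φ, φ̄ or zero according to the numbers of
indices.

Conserved tensors. The Taylor terms are treated separately. Constants are curls of potentials linear
in x. A linear current is determined, up to π_A π̃_{A'} R, by its contractions with π and π̃; these
are again single multiples of products of momenta, and only the elementary tensors survive modulo
curls (`reducesToBasic_linear`). A quadratic current is a curl if it vanishes at the configurations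
π₁ = a o, π₂ = b o, π̃₁ = -b ι, π̃₂ = a ι, where K = 0 (`exists_potential_bilinear`). There a
covariant current is a function κ(a, b) times a product of o's and ι's; the possible κ are spanned
by monomials fixed by the helicities of the factors, and these are realized by the spacetime, zilch
and chiral tensors (`hasModel_weight`, `reducesToBasic_quadratic`). For three momenta the four
K_{CC'} have pairwise coprime leading monomials for a suitable weight, so the Koszul complex is
exact and the whole cubic remainder is a curl (`exists_potential_trilinear`,
`isSpinorCurl_remainder`). -/

theorem exists_coeff_eq (g : (σ →₀ ℕ) → A) (hg : g.support.Finite) :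
    ∃ f : MvPolynomial σ A, ∀ κ, f.coeff κ = g κ := by
  classical
  refine ⟨∑ κ ∈ hg.toFinset, monomial κ (g κ), fun κ => ?_⟩
  simp only [coeff_sum, coeff_monomial, Finset.sum_ite_eq', Set.Finite.mem_toFinset,
    Function.mem_support]
  split_ifs with h
  · rfl
  · exact (not_not.mp h).symm

/-- `f` applied to each coefficient of a polynomial. -/
def coeffMap (f : A →+ A) : MvPolynomial σ A →+ MvPolynomial σ A where
  toFun P := ∑ κ ∈ P.support, monomial κ (f (P.coeff κ))
  map_zero' := by simp
  map_add' P Q := by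
    classical
    have key : ∀ (P : MvPolynomial σ A) κ,
        (∑ κ ∈ P.support, monomial κ (f (P.coeff κ))).coeff κ = f (P.coeff κ) := by
      intro P κ
      simp only [coeff_sum, coeff_monomial, Finset.sum_ite_eq', mem_support_iff]
      split_ifs with h
      · rfl
      · rw [not_not.mp h, map_zero]
    ext κ
    rw [coeff_add, key, key, key, coeff_add, map_add]

@[simp] theorem coeff_coeffMap (f : A →+ A) (P : MvPolynomial σ A) (κ : σ →₀ ℕ) :
    (coeffMap f P).coeff κ = f (P.coeff κ) := by
  classical
  change (∑ κ ∈ P.support, monomial κ (f (P.coeff κ))).coeff κ = f (P.coeff κ)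
  simp only [coeff_sum, coeff_monomial, Finset.sum_ite_eq', mem_support_iff]
  split_ifs with h
  · rfl
  · rw [not_not.mp h, map_zero]

/-- An additive operator that is multiplication by the monomial `m` up to terms of lower weight. -/
def HasLeadingMonomial (wt : (σ →₀ ℕ) →+ ℕ) (m : σ →₀ ℕ)
    (N : MvPolynomial σ A →+ MvPolynomial σ A) : Prop :=
  ∀ f κ, (N f - monomial m 1 * f).coeff κ ≠ 0 → ∃ κ', f.coeff κ' ≠ 0 ∧ wt κ < wt κ' + wt m

/-- A term of f of maximal weight, multiplied by the leading monomial, has weight too large to be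
cancelled by the lower terms of `N f`. -/
theorem HasLeadingMonomial.eq_zero {wt : (σ →₀ ℕ) →+ ℕ} {m : σ →₀ ℕ}
    {N : MvPolynomial σ A →+ MvPolynomial σ A} (h : HasLeadingMonomial wt m N)
    {f : MvPolynomial σ A} (hf : N f = 0) : f = 0 := by
  by_contra hne
  obtain ⟨κ, hκ, hmax⟩ := Finset.exists_max_image f.support wt
    (Finset.nonempty_iff_ne_empty.mpr (by simpa using hne))
  have h1 : (N f - monomial m 1 * f).coeff (m + κ) ≠ 0 := by
    rw [hf, zero_sub, coeff_neg, coeff_monomial_mul, one_mul]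
    exact neg_ne_zero.mpr (mem_support_iff.mp hκ)
  obtain ⟨κ', h2, h3⟩ := h f _ h1
  have := hmax κ' (mem_support_iff.mpr h2)
  rw [map_add] at h3
  omega

theorem le_of_le_add_of_disjoint {m m' κ : σ →₀ ℕ} (hd : Disjoint m.support m'.support)
    (h : m ≤ κ + m') : m ≤ κ := by
  intro s
  by_cases hs : m s = 0
  · simp [hs]
  · have : m' s = 0 := by
      by_contra h'
      exact Finset.disjoint_left.mp hd (Finsupp.mem_support_iff.mpr hs)
        (Finsupp.mem_support_iff.mpr h')
    have h2 := h s
    simpa [this] using h2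

/-- The graded form of Koszul exactness, for the monomials alone: it solves the relation in the
single weight d. Everything splits over the exponents ν, and for each ν divisible by some `m a` a
choice of one such a gives a contracting homotopy. -/
theorem exists_top_potential {I : Type*} [Fintype I] [DecidableEq I] {m : I → σ →₀ ℕ}
    (hm : ∀ a b, a ≠ b → Disjoint (m a).support (m b).support)
    (wt : (σ →₀ ℕ) →+ ℕ) (d : ℕ) (T : I → MvPolynomial σ A)
    (hT : ∀ ν, wt ν = d → ∑ a, (monomial (m a) 1 * T a).coeff ν = 0) :
    ∃ Θ : I → I → MvPolynomial σ A, (∀ a b, Θ b a = -Θ a b) ∧ (∀ a, Θ a a = 0) ∧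
      (∀ a b κ, (Θ a b).coeff κ ≠ 0 → wt κ + wt (m a) + wt (m b) = d) ∧
      ∀ a κ, wt κ + wt (m a) = d → (∑ b, monomial (m b) 1 * Θ a b).coeff κ = (T a).coeff κ := by
  classical
  have hpick : ∀ ν : σ →₀ ℕ, ∃ f : Option I, (∀ a, f = some a → m a ≤ ν) ∧
      ((∃ a, m a ≤ ν) → ∃ a, f = some a) := by
    intro ν
    by_cases h : ∃ a, m a ≤ ν
    · obtain ⟨a, ha⟩ := h
      exact ⟨some a, fun b hb => by cases hb; exact ha, fun _ => ⟨a, rfl⟩⟩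
    · exact ⟨none, fun _ h => by simp at h, fun h' => absurd h' h⟩
  choose pick hpick1 hpick2 using hpick
  -- The homotopy in multidegree κ + m a + m b. The weight condition keeps `Θ` homogeneous, and the
  -- formula is skew by construction.
  let θ : I → I → (σ →₀ ℕ) → A := fun a b κ =>
    if a ≠ b ∧ wt κ + wt (m a) + wt (m b) = d then
      (if pick (κ + m a + m b) = some b then (T a).coeff (κ + m b) else 0) -
        (if pick (κ + m b + m a) = some a then (T b).coeff (κ + m a) else 0)
    else 0
  have hinj : ∀ a, Function.Injective fun κ : σ →₀ ℕ => κ + m a := fun a => add_left_injective _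
  have hfin : ∀ a b, (θ a b).support.Finite := by
    intro a b
    refine ((((T a).support.finite_toSet.preimage (hinj b).injOn).union
      ((T b).support.finite_toSet.preimage (hinj a).injOn))).subset fun κ hκ => ?_
    by_contra hn
    simp only [Set.mem_union, Set.mem_preimage, Finset.mem_coe, mem_support_iff, not_or,
      not_not] at hn
    apply hκ
    simp only [θ, hn.1, hn.2, ite_self, sub_self]
  choose Θ hΘ using fun a b => exists_coeff_eq (θ a b) (hfin a b)
  refine ⟨Θ, ?_, ?_, ?_, ?_⟩
  · intro a b
    ext κ
    rw [coeff_neg, hΘ, hΘ]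
    simp only [θ]
    by_cases h : a ≠ b ∧ wt κ + wt (m a) + wt (m b) = d
    · rw [if_pos h, if_pos ⟨h.1.symm, by omega⟩]
      ring
    · rw [if_neg h, if_neg fun h' => h ⟨h'.1.symm, by omega⟩, neg_zero]
  · intro a
    ext κ
    rw [hΘ]
    simp [θ]
  · intro a b κ h
    rw [hΘ] at h
    by_contra h'
    exact h (if_neg fun h'' => h' h''.2)
  · intro a κ hκ
    have hmem : ∀ b, b ≠ a → (m b ≤ κ + m a ↔ m b ≤ κ) := fun b hb =>
      ⟨le_of_le_add_of_disjoint (hm b a hb), fun h => h.trans le_self_add⟩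
    have hsum := hT (κ + m a) (by rw [map_add, hκ])
    simp only [coeff_monomial_mul', one_mul] at hsum
    obtain ⟨a₀, ha₀⟩ := hpick2 (κ + m a) ⟨a, le_add_self⟩
    have hcase : ∀ b, (monomial (m b) (1 : A) * Θ a b).coeff κ =
        if b ≠ a ∧ m b ≤ κ then (if a₀ = b then (T a).coeff κ else 0) -
          (if a₀ = a then (T b).coeff (κ + m a - m b) else 0) else 0 := by
      intro b
      rw [coeff_monomial_mul', one_mul]
      by_cases hb : m b ≤ κ
      · rw [if_pos hb, hΘ]
        have e1 : κ - m b + m b = κ := tsub_add_cancel_of_le hb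
        have e2 : κ - m b + m a = κ + m a - m b := (tsub_add_eq_add_tsub hb)
        have e3 : κ - m b + m a + m b = κ + m a := by rw [add_right_comm, e1]
        have e4 : wt (κ - m b) + wt (m b) = wt κ := by rw [← map_add, e1]
        simp only [θ, e1, e2]
        rw [← e2, e3, ha₀]
        by_cases hab : b = a
        · subst hab; simp
        · have hc : a ≠ b ∧ wt (κ - m b) + wt (m a) + wt (m b) = d := ⟨Ne.symm hab, by omega⟩
          have hc' : b ≠ a ∧ m b ≤ κ := ⟨hab, hb⟩
          rw [if_pos hc, if_pos hc']
          simp only [Option.some.injEq]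
      · rw [if_neg hb, if_neg fun h => hb h.2]
    rw [coeff_sum, Finset.sum_congr rfl fun b _ => hcase b]
    -- If the chosen index is a itself, the conservation relation expresses T a through the other
    -- components. Otherwise only the chosen index contributes to the sum, and coprimality shows
    -- that its monomial already divides κ.
    by_cases h0 : a₀ = a
    · subst h0
      rw [Finset.sum_eq_add_sum_sdiff_singleton_of_mem (Finset.mem_univ a₀)] at hsum ⊢
      rw [if_neg (by simp), zero_add]
      rw [if_pos le_add_self, add_tsub_cancel_right] at hsum
      rw [eq_neg_of_add_eq_zero_left hsum, ← Finset.sum_neg_distrib]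
      refine Finset.sum_congr rfl fun b hb => ?_
      have hb' : b ≠ a₀ := by simpa using hb
      simp only [hb', hb'.symm, ne_eq, not_false_eq_true, true_and, if_true, if_false, zero_sub,
        hmem b hb']
      split_ifs <;> simp
    · rw [Finset.sum_eq_single a₀]
      · have h1 : m a₀ ≤ κ := (hmem a₀ h0).mp (hpick1 _ _ ha₀)
        rw [if_pos ⟨h0, h1⟩]
        simp [h0]
      · intro b _ hb
        simp [h0, hb.symm]
      · simp

/-- Exactness of the Koszul complex, in degree one, of commuting operators with pairwise coprime
leading monomials. -/
theorem exists_potential {I : Type*} [Fintype I] [DecidableEq I] {m : I → σ →₀ ℕ}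
    (hm : ∀ a b, a ≠ b → Disjoint (m a).support (m b).support)
    {wt : (σ →₀ ℕ) →+ ℕ} {N : I → MvPolynomial σ A →+ MvPolynomial σ A}
    (hN : ∀ a, HasLeadingMonomial wt (m a) (N a))
    (hcomm : ∀ a b f, N a (N b f) = N b (N a f))
    (T : I → MvPolynomial σ A) (hT : ∑ a, N a (T a) = 0) :
    ∃ Θ : I → I → MvPolynomial σ A, (∀ a b, Θ b a = -Θ a b) ∧ (∀ a, Θ a a = 0) ∧
      ∀ a, T a = ∑ b, N b (Θ a b) := by
  classical
  obtain ⟨d, hd⟩ : ∃ d, ∀ a κ, (T a).coeff κ ≠ 0 → wt κ + wt (m a) < d := by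
    refine ⟨∑ a, ∑ κ ∈ (T a).support, (wt κ + wt (m a)) + 1, fun a κ hκ => ?_⟩
    refine Nat.lt_succ_of_le ?_
    refine le_trans ?_ (Finset.single_le_sum
      (f := fun a => ∑ κ ∈ (T a).support, (wt κ + wt (m a))) (fun _ _ => Nat.zero_le _)
      (Finset.mem_univ a))
    exact Finset.single_le_sum (f := fun κ => wt κ + wt (m a)) (fun _ _ => Nat.zero_le _)
      (mem_support_iff.mpr hκ)
  induction d generalizing T with
  | zero =>
    have h0 : ∀ a, T a = 0 := fun a => by
      ext κ
      by_contra h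
      exact absurd (hd a κ h) (Nat.not_lt_zero _)
    exact ⟨fun _ _ => 0, by simp, by simp, by simp [h0]⟩
  | succ d ih =>
    -- In the top weight d each operator agrees with multiplication by its leading monomial, so the
    -- relation reduces to the graded one.
    have htop : ∀ ν, wt ν = d → ∑ a, (monomial (m a) 1 * T a).coeff ν = 0 := by
      intro ν hν
      have h1 : ∀ a, (N a (T a)).coeff ν = (monomial (m a) 1 * T a).coeff ν := by
        intro a
        by_contra h
        obtain ⟨κ', h2, h3⟩ := hN a (T a) ν (by rwa [coeff_sub, sub_ne_zero])
        have := hd a κ' h2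
        omega
      rw [← Finset.sum_congr rfl fun a _ => h1 a, ← coeff_sum, hT, coeff_zero]
    obtain ⟨Θ, hs, h0, hw, hΘ⟩ := exists_top_potential hm wt d T htop
    have hdiv : ∑ a, N a (T a - ∑ b, N b (Θ a b)) = 0 := by
      simp only [map_sub, map_sum, Finset.sum_sub_distrib, hT, zero_sub, neg_eq_zero]
      have h3 : ∑ x : I × I, N x.1 (N x.2 (Θ x.1 x.2)) = 0 := by
        refine Finset.sum_involution (fun x _ => (x.2, x.1)) ?_ ?_ ?_ ?_
        · intro x _
          simp only
          rw [hs x.1 x.2, map_neg, map_neg, hcomm x.2 x.1, add_neg_cancel]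
        · intro x _ hx h
          apply hx
          have : x.2 = x.1 := congrArg Prod.fst h
          rw [this, h0, map_zero, map_zero]
        · simp
        · simp
      rwa [Fintype.sum_prod_type] at h3
    -- The corrected current is still conserved, by commutation and skewness, and its weights have
    -- dropped below d.
    obtain ⟨Θ', hs', h0', hΘ'⟩ := ih _ hdiv (by
      intro a κ hκ
      by_contra hlt
      apply hκ
      rw [coeff_sub, coeff_sum]
      have hle : ∀ b, (N b (Θ a b)).coeff κ = (monomial (m b) 1 * Θ a b).coeff κ := by
        intro b
        by_contra h
        obtain ⟨κ', h2, h3⟩ := hN b (Θ a b) κ (by rwa [coeff_sub, sub_ne_zero])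
        have := hw a b κ' h2
        omega
      rw [Finset.sum_congr rfl fun b _ => hle b, ← coeff_sum]
      rcases (not_lt.mp hlt).lt_or_eq with h | h
      · have h4 : (T a).coeff κ = 0 := by
          by_contra h5
          have := hd a κ h5
          omega
        rw [h4, coeff_sum, Finset.sum_eq_zero, sub_zero]
        intro b _
        rw [coeff_monomial_mul', one_mul]
        split_ifs with hb
        · by_contra h5
          have h6 := hw a b _ h5
          have h7 : wt (κ - m b) + wt (m b) = wt κ := by
            rw [← map_add, tsub_add_cancel_of_le hb]
          omega
        · rfl
      · rw [hΘ a κ h.symm, sub_self])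
    refine ⟨fun a b => Θ a b + Θ' a b, ?_, ?_, ?_⟩
    · intro a b
      simp only [hs a b, hs' a b, neg_add]
    · intro a
      simp only [h0, h0', add_zero]
    · intro a
      simp only [map_add, Finset.sum_add_distrib]
      rw [← hΘ' a, add_sub_cancel]

end Koszul

/-! ### Momentum polynomials -/

section Momentum

open MvPolynomial

/-- Variables of the symbols of `m`-linear differential expressions: the spinor `π_{iA}` (for
`false`) and the conjugate spinor `π̃_{iA'}` (for `true`) of the momentum `π_{iA} π̃_{iA'}` of the
`i`-th factor. -/
abbrev MomVar (m : ℕ) : Type := Fin m × Bool × Fin 2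

/-- The exponent of `π_{iC} π̃_{iC'}`. -/
def momExp {m : ℕ} (i : Fin m) (C C' : Fin 2) : MomVar m →₀ ℕ :=
  Finsupp.single (i, false, C) 1 + Finsupp.single (i, true, C') 1

/-- The total momentum `∑_i π_{iC} π̃_{iC'}`. -/
def totalMom (A : Type*) [CommRing A] (m : ℕ) (C C' : Fin 2) : MvPolynomial (MomVar m) A :=
  ∑ i, monomial (momExp i C C') 1

theorem totalMom_eq (A : Type*) [CommRing A] (m : ℕ) (C C' : Fin 2) :
    totalMom A m C C' = ∑ i, X (i, false, C) * X (i, true, C') := by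
  refine Finset.sum_congr rfl fun i _ => ?_
  rw [momExp, X, X, monomial_mul, one_mul]

variable {A : Type*} [CommRing A] {m : ℕ}

/-- The total derivative on symbols: `D_{CC'}` acts on the coefficients and as multiplication by the
total momentum on the variables. -/
def nabla (D : Fin 2 → Fin 2 → A →+ A) (C C' : Fin 2) :
    MvPolynomial (MomVar m) A →+ MvPolynomial (MomVar m) A :=
  coeffMap (D C C') + AddMonoidHom.mulLeft (totalMom A m C C')

theorem nabla_apply (D : Fin 2 → Fin 2 → A →+ A) (C C' : Fin 2) (f : MvPolynomial (MomVar m) A) :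
    nabla D C C' f = coeffMap (D C C') f + totalMom A m C C' * f := rfl

theorem coeffMap_monomial_mul {σ : Type*} (D : A →+ A) (s : σ →₀ ℕ) (f : MvPolynomial σ A) :
    coeffMap D (monomial s 1 * f) = monomial s 1 * coeffMap D f := by
  ext κ
  simp only [coeff_coeffMap, coeff_monomial_mul', one_mul]
  split_ifs
  · rfl
  · exact map_zero D

theorem coeffMap_totalMom_mul (D : A →+ A) (C C' : Fin 2) (f : MvPolynomial (MomVar m) A) :
    coeffMap D (totalMom A m C C' * f) = totalMom A m C C' * coeffMap D f := by
  simp only [totalMom, Finset.sum_mul, map_sum, coeffMap_monomial_mul]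

theorem nabla_comm {D : Fin 2 → Fin 2 → A →+ A}
    (hD : ∀ C C' E E' a, D C C' (D E E' a) = D E E' (D C C' a)) (C C' E E' : Fin 2)
    (f : MvPolynomial (MomVar m) A) :
    nabla D C C' (nabla D E E' f) = nabla D E E' (nabla D C C' f) := by
  have h : coeffMap (D C C') (coeffMap (D E E') f) = coeffMap (D E E') (coeffMap (D C C') f) := by
    ext κ
    simp only [coeff_coeffMap, hD]
  simp only [nabla_apply, map_add, coeffMap_totalMom_mul, h]
  ring

/-- The operator raises weights by at most `e`. -/
def RaisesBy {σ : Type*} (wt : (σ →₀ ℕ) →+ ℕ) (e : ℕ)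
    (N : MvPolynomial σ A →+ MvPolynomial σ A) : Prop :=
  ∀ f κ, (N f).coeff κ ≠ 0 → ∃ κ', f.coeff κ' ≠ 0 ∧ wt κ ≤ wt κ' + e

theorem RaisesBy.comp {σ : Type*} {wt : (σ →₀ ℕ) →+ ℕ} {e e' : ℕ}
    {N N' : MvPolynomial σ A →+ MvPolynomial σ A} (h : RaisesBy wt e N) (h' : RaisesBy wt e' N') :
    RaisesBy wt (e + e') (N.comp N') := by
  intro f κ hκ
  obtain ⟨κ₁, h1, h2⟩ := h _ _ hκ
  obtain ⟨κ₂, h3, h4⟩ := h' _ _ h1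
  exact ⟨κ₂, h3, by omega⟩

theorem coeff_add_ne_zero {σ : Type*} {f g : MvPolynomial σ A} {κ : σ →₀ ℕ}
    (h : (f + g).coeff κ ≠ 0) : f.coeff κ ≠ 0 ∨ g.coeff κ ≠ 0 := by
  by_contra! h'
  exact h (by rw [coeff_add, h'.1, h'.2, add_zero])

theorem coeff_monomial_mul_ne_zero {σ : Type*} {f : MvPolynomial σ A} {κ s : σ →₀ ℕ}
    (h : (monomial s 1 * f).coeff κ ≠ 0) : ∃ κ', f.coeff κ' ≠ 0 ∧ κ = s + κ' := by
  rw [coeff_monomial_mul', one_mul] at h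
  split_ifs at h with hs
  · exact ⟨κ - s, h, (add_tsub_cancel_of_le hs).symm⟩
  · exact absurd rfl h

theorem HasLeadingMonomial.raisesBy {σ : Type*} {wt : (σ →₀ ℕ) →+ ℕ} {s : σ →₀ ℕ}
    {N : MvPolynomial σ A →+ MvPolynomial σ A} (h : HasLeadingMonomial wt s N) :
    RaisesBy wt (wt s) N := by
  intro f κ hκ
  rw [← sub_add_cancel (N f) (monomial s 1 * f)] at hκ
  rcases coeff_add_ne_zero hκ with h1 | h1
  · obtain ⟨κ', h2, h3⟩ := h _ _ h1
    exact ⟨κ', h2, h3.le⟩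
  · obtain ⟨κ', h2, rfl⟩ := coeff_monomial_mul_ne_zero h1
    exact ⟨κ', h2, by rw [map_add, add_comm]⟩

theorem HasLeadingMonomial.comp {σ : Type*} {wt : (σ →₀ ℕ) →+ ℕ} {s s' : σ →₀ ℕ}
    {N N' : MvPolynomial σ A →+ MvPolynomial σ A} (h : HasLeadingMonomial wt s N)
    (h' : HasLeadingMonomial wt s' N') : HasLeadingMonomial wt (s + s') (N.comp N') := by
  intro f κ hκ
  have e : N.comp N' f - monomial (s + s') 1 * f =
      (N (N' f) - monomial s 1 * N' f) + monomial s 1 * (N' f - monomial s' 1 * f) := by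
    rw [mul_sub, ← mul_assoc, monomial_mul, one_mul, AddMonoidHom.comp_apply]
    ring
  rw [e] at hκ
  rcases coeff_add_ne_zero hκ with h1 | h1
  · obtain ⟨κ₁, h2, h3⟩ := h _ _ h1
    obtain ⟨κ₂, h4, h5⟩ := h'.raisesBy _ _ h2
    exact ⟨κ₂, h4, by rw [map_add]; omega⟩
  · obtain ⟨κ₁, h2, rfl⟩ := coeff_monomial_mul_ne_zero h1
    obtain ⟨κ₂, h4, h5⟩ := h' _ _ h2
    exact ⟨κ₂, h4, by rw [map_add, map_add]; omega⟩

theorem HasLeadingMonomial.sub {σ : Type*} {wt : (σ →₀ ℕ) →+ ℕ} {s : σ →₀ ℕ} {e : ℕ}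
    {N N' : MvPolynomial σ A →+ MvPolynomial σ A} (h : HasLeadingMonomial wt s N)
    (h' : RaisesBy wt e N') (he : e < wt s) : HasLeadingMonomial wt s (N - N') := by
  intro f κ hκ
  have e : (N - N') f - monomial s 1 * f = (N f - monomial s 1 * f) + (-N' f) := by
    rw [AddMonoidHom.sub_apply]
    ring
  rw [e] at hκ
  rcases coeff_add_ne_zero hκ with h1 | h1
  · exact h _ _ h1
  · rw [coeff_neg, neg_ne_zero] at h1
    obtain ⟨κ₁, h2, h3⟩ := h' _ _ h1
    exact ⟨κ₁, h2, by omega⟩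

theorem raisesBy_nabla (wt : (MomVar m →₀ ℕ) →+ ℕ) (D : Fin 2 → Fin 2 → A →+ A) (C C' : Fin 2)
    {e : ℕ} (he : ∀ i, wt (momExp i C C') ≤ e) : RaisesBy wt e (nabla D C C') := by
  intro f κ hκ
  rw [nabla_apply] at hκ
  rcases coeff_add_ne_zero hκ with h1 | h1
  · rw [coeff_coeffMap] at h1
    exact ⟨κ, fun h => h1 (by rw [h, map_zero]), Nat.le_add_right _ _⟩
  · rw [totalMom, Finset.sum_mul, coeff_sum] at h1
    obtain ⟨i, -, hi⟩ := Finset.exists_ne_zero_of_sum_ne_zero h1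
    obtain ⟨κ', h2, rfl⟩ := coeff_monomial_mul_ne_zero hi
    exact ⟨κ', h2, by rw [map_add]; have := he i; omega⟩

/-- The derivative of the coefficients does not change exponents, so it counts as a lower term as
soon as the leading monomial has positive weight. What remains is to find a weight for which one
factor dominates in the total momentum. -/
theorem hasLeadingMonomial_nabla (wt : (MomVar m →₀ ℕ) →+ ℕ) (D : Fin 2 → Fin 2 → A →+ A)
    (C C' : Fin 2) (i : Fin m) (h0 : 0 < wt (momExp i C C'))
    (hi : ∀ i', i' ≠ i → wt (momExp i' C C') < wt (momExp i C C')) :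
    HasLeadingMonomial wt (momExp i C C') (nabla D C C') := by
  intro f κ hκ
  rw [nabla_apply, totalMom, Finset.sum_mul,
    Finset.sum_eq_add_sum_sdiff_singleton_of_mem (Finset.mem_univ i), add_sub_assoc,
    add_sub_cancel_left] at hκ
  rcases coeff_add_ne_zero hκ with h1 | h1
  · rw [coeff_coeffMap] at h1
    exact ⟨κ, fun h => h1 (by rw [h, map_zero]), by omega⟩
  · rw [coeff_sum] at h1
    obtain ⟨i', h2, hi'⟩ := Finset.exists_ne_zero_of_sum_ne_zero h1
    obtain ⟨κ', h3, rfl⟩ := coeff_monomial_mul_ne_zero hi'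
    exact ⟨κ', h3, by rw [map_add]; have := hi i' (by simpa using h2); omega⟩

theorem weight_momExp (w : MomVar m → ℕ) (i : Fin m) (C C' : Fin 2) :
    Finsupp.weight w (momExp i C C') = w (i, false, C) + w (i, true, C') := by
  simp [momExp, Finsupp.weight_single]

/-- The massless field equation has no bilinear solutions: the wave operator is injective on
bilinear symbols. -/
theorem eq_zero_of_field_equation {D : Fin 2 → Fin 2 → A →+ A}
    (hD : ∀ C C' E E' a, D C C' (D E E' a) = D E E' (D C C' a))
    {Y : Fin 2 → MvPolynomial (MomVar 2) A}
    (hY : ∀ C', nabla D 0 C' (Y 1) = nabla D 1 C' (Y 0)) (C : Fin 2) : Y C = 0 := by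
  -- Only the components 0 of the first factor and the components 1 of the second have weight 1.
  -- Hence D₀₀ is led by the first factor and D₁₁ by the second, both with weight 2, while D₀₁ and
  -- D₁₀ raise weights by at most 1.
  let w : MomVar 2 → ℕ := fun v => if (v.1 = 0 ↔ v.2.2 = 0) then 1 else 0
  let wt : (MomVar 2 →₀ ℕ) →+ ℕ := Finsupp.weight w
  have h00 : HasLeadingMonomial wt (momExp (0 : Fin 2) 0 0) (nabla D 0 0) := by
    refine hasLeadingMonomial_nabla wt D 0 0 0 ?_ ?_
    · simp [wt, weight_momExp, w]
    · intro i hi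
      fin_cases i
      · exact absurd rfl hi
      · simp [wt, weight_momExp, w]
  have h11 : HasLeadingMonomial wt (momExp (1 : Fin 2) 1 1) (nabla D 1 1) := by
    refine hasLeadingMonomial_nabla wt D 1 1 1 ?_ ?_
    · simp [wt, weight_momExp, w]
    · intro i hi
      fin_cases i
      · simp [wt, weight_momExp, w]
      · exact absurd rfl hi
  have h01 : RaisesBy wt 1 (nabla (m := 2) D 0 1) := by
    refine raisesBy_nabla wt D 0 1 fun i => ?_
    fin_cases i <;> simp [wt, weight_momExp, w]
  have h10 : RaisesBy wt 1 (nabla (m := 2) D 1 0) := by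
    refine raisesBy_nabla wt D 1 0 fun i => ?_
    fin_cases i <;> simp [wt, weight_momExp, w]
  -- The wave operator D₀₀D₁₁ - D₁₀D₀₁ keeps the leading monomial of its first product, of weight 4
  -- against 2. It annihilates both components of Y by the field equation.
  have hbox := (h00.comp h11).sub (h10.comp h01) (by
    rw [map_add]
    simp [wt, weight_momExp, w])
  refine hbox.eq_zero ?_
  have c := fun C C' E E' => nabla_comm (m := 2) hD C C' E E'
  simp only [AddMonoidHom.sub_apply, AddMonoidHom.comp_apply]
  fin_cases C
  · simp only [Fin.zero_eta]
    rw [c 1 0 0 1, ← hY 0, ← hY 1, c 0 1 0 0, sub_self]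
  · simp only [Fin.mk_one]
    rw [hY 1, c 1 0 1 1, ← hY 0, c 1 1 0 0, sub_self]

/-- Trilinear conserved currents are trivial. -/
theorem exists_potential_trilinear {D : Fin 2 → Fin 2 → A →+ A}
    (hD : ∀ C C' E E' a, D C C' (D E E' a) = D E E' (D C C' a))
    (T : Fin 2 × Fin 2 → MvPolynomial (MomVar 3) A) (hT : ∑ c, nabla D c.1 c.2 (T c) = 0) :
    ∃ Θ : Fin 2 × Fin 2 → Fin 2 × Fin 2 → MvPolynomial (MomVar 3) A,
      (∀ a b, Θ b a = -Θ a b) ∧ (∀ a, Θ a a = 0) ∧ ∀ a, T a = ∑ b, nabla D b.1 b.2 (Θ a b) := by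
  -- With this weight the leading monomials are those of the factors listed in `lead`, and no two of
  -- them share a variable. With two factors coprimality would force {00, 11} onto one factor and
  -- {01, 10} onto the other, and the required inequalities between weights would contradict each
  -- other.
  let w : MomVar 3 → ℕ := fun v => match v with
    | (0, false, _) => 3
    | (1, false, 0) => 2
    | (2, true, 0) => 2
    | (1, true, 1) => 2
    | (2, false, 1) => 2
    | _ => 0
  let lead : Fin 2 × Fin 2 → Fin 3 := fun c => match c with
    | (0, 0) => 0
    | (0, 1) => 1
    | (1, 0) => 2
    | (1, 1) => 0
  refine exists_potential (m := fun c => momExp (lead c) c.1 c.2) ?_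
    (wt := Finsupp.weight w) (N := fun c => nabla D c.1 c.2) ?_
    (fun a b f => nabla_comm hD _ _ _ _ f) T hT
  · intro a b hab
    rw [Finset.disjoint_left]
    intro v hv hv'
    rw [Finsupp.mem_support_iff, momExp, Finsupp.add_apply, Finsupp.single_apply,
      Finsupp.single_apply] at hv hv'
    have h1 : v = (lead a, false, a.1) ∨ v = (lead a, true, a.2) := by
      by_contra! h
      rw [if_neg h.1.symm, if_neg h.2.symm] at hv
      exact hv rfl
    have h2 : v = (lead b, false, b.1) ∨ v = (lead b, true, b.2) := by
      by_contra! h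
      rw [if_neg h.1.symm, if_neg h.2.symm] at hv'
      exact hv' rfl
    obtain ⟨a1, a2⟩ := a
    obtain ⟨b1, b2⟩ := b
    clear hv hv'
    fin_cases a1 <;> fin_cases a2 <;> fin_cases b1 <;> fin_cases b2 <;>
      simp [lead] at hab h1 h2 <;> rcases h1 with rfl | rfl <;> simp at h2
  · rintro ⟨C, C'⟩
    refine hasLeadingMonomial_nabla _ D C C' _ ?_ ?_
    · rw [weight_momExp]
      fin_cases C <;> fin_cases C' <;> simp [lead, w]
    · intro i hi
      rw [weight_momExp, weight_momExp]
      fin_cases C <;> fin_cases C' <;> fin_cases i <;> simp [lead, w] at hi ⊢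

end Momentum

/-! ### Bilinear conserved currents -/

section Bilinear

open MvPolynomial

/-- Division with remainder: a monomial divisible by a leading monomial equals a multiple of `K a`
plus terms of strictly smaller weight, so the reduction terminates. -/
theorem exists_normal_form {σ I : Type*} [Fintype I] {m : I → σ →₀ ℕ} {wt : (σ →₀ ℕ) →+ ℕ}
    {K : I → MvPolynomial σ ℂ}
    (hK : ∀ a, HasLeadingMonomial wt (m a) (AddMonoidHom.mulLeft (K a))) (f : MvPolynomial σ ℂ) :
    ∃ (N : MvPolynomial σ ℂ) (g : I → MvPolynomial σ ℂ), f = N + ∑ a, K a * g a ∧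
      ∀ κ, N.coeff κ ≠ 0 → ∀ a, ¬ m a ≤ κ := by
  classical
  let V : Submodule ℂ (MvPolynomial σ ℂ) :=
    { carrier := {N | ∀ κ, N.coeff κ ≠ 0 → ∀ a, ¬ m a ≤ κ}
      zero_mem' := fun κ h => absurd (coeff_zero κ) h
      add_mem' := fun {f g} hf hg κ h => (coeff_add_ne_zero h).elim (hf κ) (hg κ)
      smul_mem' := fun c f hf κ h => hf κ fun h0 => h (by rw [coeff_smul, h0, smul_zero]) }
  let W : Submodule ℂ (MvPolynomial σ ℂ) := V ⊔ (Ideal.span (Set.range K)).restrictScalars ℂ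
  have hmon : ∀ d κ, wt κ < d → ∀ r, monomial κ r ∈ W := by
    intro d
    induction d with
    | zero => intro κ h; exact absurd h (Nat.not_lt_zero _)
    | succ d ih =>
      intro κ hκ r
      by_cases hn : ∀ a, ¬ m a ≤ κ
      · refine Submodule.mem_sup_left fun κ' h => ?_
        rw [coeff_monomial] at h
        split_ifs at h with h1
        · rwa [← h1]
        · exact absurd rfl h
      · push Not at hn
        obtain ⟨a, ha⟩ := hn
        have e1 : κ = m a + (κ - m a) := (add_tsub_cancel_of_le ha).symm
        have e2 : monomial κ r = K a * monomial (κ - m a) r -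
            (AddMonoidHom.mulLeft (K a) (monomial (κ - m a) r) -
              monomial (m a) 1 * monomial (κ - m a) r) := by
          rw [monomial_mul, one_mul, ← e1]
          simp
        rw [e2]
        refine sub_mem (Submodule.mem_sup_right ?_) ?_
        · exact Ideal.mul_mem_right _ _ (Ideal.subset_span ⟨a, rfl⟩)
        · set q := AddMonoidHom.mulLeft (K a) (monomial (κ - m a) r) -
              monomial (m a) 1 * monomial (κ - m a) r with hq
          rw [← support_sum_monomial_coeff q]
          refine sum_mem fun κ' hκ' => ih κ' ?_ _
          obtain ⟨κ₁, h1, h2⟩ := hK a _ κ' (mem_support_iff.mp hκ')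
          rw [coeff_monomial] at h1
          split_ifs at h1 with h3
          · rw [← h3, ← map_add, tsub_add_cancel_of_le ha] at h2
            omega
          · exact absurd rfl h1
  have hf : f ∈ W := by
    rw [← support_sum_monomial_coeff f]
    exact sum_mem fun κ _ => hmon _ κ (Nat.lt_succ_self _) _
  obtain ⟨N, hN, y, hy, rfl⟩ := Submodule.mem_sup.mp hf
  rw [Submodule.restrictScalars_mem, Ideal.mem_span_range_iff_exists_fun] at hy
  obtain ⟨c, rfl⟩ := hy
  exact ⟨N, c, by simp only [mul_comm], hN⟩

/-- Under a substitution of monomials each term of N becomes a monomial or zero. If μ survives and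
shares its image with no other surviving exponent, the coefficient of the image is a nonzero
multiple of that of μ. -/
theorem coeff_eq_zero_of_monomial_subst {σ τ : Type*} [Fintype σ] (v : σ → τ →₀ ℕ) (c : σ → ℂ)
    {N : MvPolynomial σ ℂ} (hN : aeval (fun s => monomial (v s) (c s)) N = 0) {μ : σ →₀ ℕ}
    (hμ : ∀ s, μ s ≠ 0 → c s ≠ 0)
    (huniq : ∀ κ, N.coeff κ ≠ 0 → (∀ s, κ s ≠ 0 → c s ≠ 0) →
      ∑ s, κ s • v s = ∑ s, μ s • v s → κ = μ) : N.coeff μ = 0 := by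
  classical
  have hmono : ∀ (κ : σ →₀ ℕ) r, aeval (fun s => monomial (v s) (c s)) (monomial κ r) =
      monomial (∑ s, κ s • v s) (r * ∏ s, c s ^ κ s) := by
    intro κ r
    rw [aeval_monomial, Finsupp.prod_fintype _ _ (fun s => by simp), algebraMap_eq]
    simp only [monomial_pow]
    have : ∀ t : Finset σ, ∏ s ∈ t, monomial (κ s • v s) (c s ^ κ s) =
        monomial (∑ s ∈ t, κ s • v s) (∏ s ∈ t, c s ^ κ s) := by
      intro t
      induction t using Finset.induction_on with
      | empty => simp
      | insert a t ha ih => rw [Finset.prod_insert ha, Finset.sum_insert ha, Finset.prod_insert ha,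
          ih, monomial_mul]
    rw [this, C_mul_monomial]
  have h := congrArg (MvPolynomial.coeff (∑ s, μ s • v s)) hN
  rw [← support_sum_monomial_coeff N, map_sum, coeff_sum, coeff_zero] at h
  by_contra hne
  rw [Finset.sum_eq_single μ] at h
  · rw [hmono, coeff_monomial, if_pos rfl, mul_eq_zero, Finset.prod_eq_zero_iff] at h
    rcases h with h | ⟨s, -, hs⟩
    · exact hne h
    · by_cases h0 : μ s = 0
      · rw [h0, pow_zero] at hs
        exact one_ne_zero hs
      · exact hμ s h0 (pow_eq_zero_iff h0 |>.mp hs)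
  · intro κ hκ hκμ
    rw [hmono, coeff_monomial]
    split_ifs with h1
    · by_cases h2 : ∀ s, κ s ≠ 0 → c s ≠ 0
      · exact absurd (huniq κ (mem_support_iff.mp hκ) h2 h1) hκμ
      · push Not at h2
        obtain ⟨s, h3, h4⟩ := h2
        rw [Finset.prod_eq_zero (Finset.mem_univ s) (by rw [h4, zero_pow h3]), mul_zero]
    · rfl
  · intro h0
    exact absurd (notMem_support_iff.mp h0) hne

/-- Restriction of bilinear symbols to the points `π₁ = a o`, `π₂ = b o`, `π̃₁ = -b ι`, `π̃₂ = a ι`,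
at which the total momentum vanishes. -/
def restrictNull (a b : ℂ) : MvPolynomial (MomVar 2) ℂ →ₐ[ℂ] MvPolynomial (MomVar 1) ℂ :=
  aeval fun v => C (if v.1 = 0 then (if v.2.1 then -b else a) else (if v.2.1 then a else b)) *
    X (0, v.2)

theorem restrictNull_totalMom (a b : ℂ) (C C' : Fin 2) :
    restrictNull a b (totalMom ℂ 2 C C') = 0 := by
  simp [totalMom_eq, restrictNull]
  ring

theorem momExp_le_iff {m : ℕ} (i : Fin m) (C C' : Fin 2) (κ : MomVar m →₀ ℕ) :
    momExp i C C' ≤ κ ↔ κ (i, false, C) ≠ 0 ∧ κ (i, true, C') ≠ 0 := by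
  classical
  constructor
  · intro h
    have h1 := h (i, false, C)
    have h2 := h (i, true, C')
    simp [momExp] at h1 h2
    omega
  · rintro ⟨h1, h2⟩ v
    simp only [momExp, Finsupp.add_apply, Finsupp.single_apply]
    split_ifs with h3 h4 h4
    · rw [← h4] at h3
      simp at h3
    · subst h3; omega
    · subst h4; omega
    · omega

theorem totalMom_two (C C' : Fin 2) : totalMom ℂ 2 C C' =
    X (0, false, C) * X (0, true, C') + X (1, false, C) * X (1, true, C') := by
  rw [totalMom_eq, Fin.sum_univ_two]

theorem sum_momVar_two {M : Type*} [AddCommMonoid M] (f : MomVar 2 → M) :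
    ∑ v, f v = f (0, false, 0) + f (0, false, 1) + f (0, true, 0) + f (0, true, 1) +
      (f (1, false, 0) + f (1, false, 1) + f (1, true, 0) + f (1, true, 1)) := by
  simp only [Fintype.sum_prod_type, Fin.sum_univ_two, Fintype.sum_bool]
  abel

theorem forall_momVar_two {p : MomVar 2 → Prop} : (∀ v, p v) ↔
    (p (0, false, 0) ∧ p (0, false, 1) ∧ p (0, true, 0) ∧ p (0, true, 1)) ∧
      (p (1, false, 0) ∧ p (1, false, 1) ∧ p (1, true, 0) ∧ p (1, true, 1)) := by
  simp only [Prod.forall, Fin.forall_fin_two, Bool.forall_bool]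
  tauto

/-- Exponents that are not divisible by the leading monomials of three of the components of the
total momentum. -/
def IsNormalExp (κ : MomVar 2 →₀ ℕ) : Prop :=
  (κ (0, false, 0) = 0 ∨ κ (0, true, 0) = 0) ∧ (κ (1, false, 0) = 0 ∨ κ (1, true, 1) = 0) ∧
    (κ (1, false, 1) = 0 ∨ κ (1, true, 0) = 0)

/-- Besides the null configurations, K₀₀, K₀₁ and K₁₀ have common zeros where the spinors of type
`t` have vanishing component 0 and K₁₁ is not identically zero. There the relation `hK` forces N to
vanish, and normal exponents are separated by the parametrisation. -/
theorem coeff_eq_zero_of_isNormalExp {N : MvPolynomial (MomVar 2) ℂ}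
    (hN : ∀ κ, N.coeff κ ≠ 0 → IsNormalExp κ)
    {g : Fin 3 → MvPolynomial (MomVar 2) ℂ}
    (hK : totalMom ℂ 2 1 1 * N = totalMom ℂ 2 0 0 * g 0 + totalMom ℂ 2 0 1 * g 1 +
      totalMom ℂ 2 1 0 * g 2) (t : Bool) {μ : MomVar 2 →₀ ℕ} (h1 : μ (0, t, 0) = 0)
    (h2 : μ (1, t, 0) = 0) : N.coeff μ = 0 := by
  by_contra hne
  -- For t = true this is π̃_{·0} = 0, π̃_{·1} = y₃(-y₅, y₄), π_{·0} = y₀(y₄, y₅), π_{·1} = (y₁,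
  -- y₂), where the entries run over the two factors. The pairing of π_{·0} with π̃_{·1} is zero.
  let v : MomVar 2 → Fin 6 →₀ ℕ := fun s =>
    if s.2.1 = t then
      if s.2.2 = 0 then 0 else Finsupp.single 3 1 + Finsupp.single (if s.1 = 0 then 5 else 4) 1
    else if s.2.2 = 0 then Finsupp.single 0 1 + Finsupp.single (if s.1 = 0 then 4 else 5) 1
      else Finsupp.single (if s.1 = 0 then 1 else 2) 1
  let c : MomVar 2 → ℂ := fun s =>
    if s.2.1 = t then if s.2.2 = 0 then 0 else if s.1 = 0 then -1 else 1 else 1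
  have hz : ∀ C C', C = 0 ∨ C' = 0 →
      aeval (fun s => monomial (v s) (c s)) (totalMom ℂ 2 C C') = 0 := by
    intro C C' h
    refine MvPolynomial.funext fun x => ?_
    cases t <;> fin_cases C <;> fin_cases C' <;>
      simp [totalMom_two, v, c, eval_monomial, Finsupp.prod_add_index', pow_add] at h ⊢ <;> ring
  have e11 : aeval (fun s => monomial (v s) (c s)) (totalMom ℂ 2 1 1) ≠ 0 := by
    intro h
    have h' := congrArg (eval fun i : Fin 6 => if i = 2 then (0 : ℂ) else 1) h
    cases t <;> simp [totalMom_two, v, c, eval_monomial] at h'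
  have e := congrArg (aeval fun s => monomial (v s) (c s)) hK
  rw [map_mul, map_add, map_add, map_mul, map_mul, map_mul, hz 0 0 (by simp), hz 0 1 (by simp),
    hz 1 0 (by simp), zero_mul, zero_mul, zero_mul, add_zero, add_zero, mul_eq_zero,
    or_iff_right e11] at e
  refine hne (coeff_eq_zero_of_monomial_subst v c e ?_ ?_)
  · rw [forall_momVar_two]
    cases t <;> simp [c, h1, h2]
  · intro κ hκ hc hsum
    have hn := hN κ hκ
    have hn' := hN μ hne
    rw [forall_momVar_two] at hc
    have hs := fun i => DFunLike.congr_fun hsum i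
    simp only [sum_momVar_two, v] at hs
    have s0 := hs 0
    have s1 := hs 1
    have s2 := hs 2
    have s3 := hs 3
    have s4 := hs 4
    have s5 := hs 5
    unfold IsNormalExp at hn hn'
    refine Finsupp.ext ?_
    rw [forall_momVar_two]
    cases t <;> simp [c] at hc s0 s1 s2 s3 s4 s5 <;> omega

/-- The null configurations are parametrised by monomials in o = (y₀, y₁), ι = (y₂, y₃), a = y₄, b =
y₅. By the preceding lemma a surviving exponent involves some π_{i0} and some π̃_{i0}; normal
exponents of this kind are determined by their image. -/
theorem eq_zero_of_isNormalExp {N : MvPolynomial (MomVar 2) ℂ}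
    (hN : ∀ κ, N.coeff κ ≠ 0 → IsNormalExp κ)
    {g : Fin 3 → MvPolynomial (MomVar 2) ℂ}
    (hK : totalMom ℂ 2 1 1 * N = totalMom ℂ 2 0 0 * g 0 + totalMom ℂ 2 0 1 * g 1 +
      totalMom ℂ 2 1 0 * g 2)
    (hL : ∀ a b, a ≠ 0 → b ≠ 0 → restrictNull a b N = 0) : N = 0 := by
  let v : MomVar 2 → Fin 6 →₀ ℕ := fun s => match s with
    | (0, false, 0) => Finsupp.single 0 1 + Finsupp.single 4 1
    | (1, false, 0) => Finsupp.single 0 1 + Finsupp.single 5 1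
    | (0, false, 1) => Finsupp.single 1 1 + Finsupp.single 4 1
    | (1, false, 1) => Finsupp.single 1 1 + Finsupp.single 5 1
    | (0, true, 0) => Finsupp.single 2 1 + Finsupp.single 5 1
    | (1, true, 0) => Finsupp.single 2 1 + Finsupp.single 4 1
    | (0, true, 1) => Finsupp.single 3 1 + Finsupp.single 5 1
    | (1, true, 1) => Finsupp.single 3 1 + Finsupp.single 4 1
  let c : MomVar 2 → ℂ := fun s => match s with
    | (0, true, _) => -1
    | _ => 1
  have e : aeval (fun s => monomial (v s) (c s)) N = 0 := by
    -- Vanishing is known for a, b ≠ 0 only, which is enough because a product of infinite sets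
    -- detects polynomials.
    refine funext_set (fun _ => {0}ᶜ) (fun _ => (Set.finite_singleton _).infinite_compl)
      fun x hx => ?_
    have hx' : ∀ i, x i ≠ 0 := fun i => hx i trivial
    have h := congrArg (eval fun s : MomVar 1 => match s with
      | (_, false, 0) => x 0
      | (_, false, 1) => x 1
      | (_, true, 0) => x 2
      | (_, true, 1) => x 3) (hL (x 4) (x 5) (hx' 4) (hx' 5))
    rw [map_zero] at h ⊢
    rw [← h, restrictNull, ← coe_aeval_eq_eval, ← coe_aeval_eq_eval, RingHom.coe_coe,
      RingHom.coe_coe, ← AlgHom.comp_apply, ← AlgHom.comp_apply, comp_aeval, comp_aeval]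
    congr 2
    ext s
    revert s
    rw [forall_momVar_two]
    simp [v, c, eval_monomial, aeval_monomial, Finsupp.prod_add_index', pow_add, mul_comm]
  ext μ
  rw [coeff_zero]
  by_contra hne
  refine hne (coeff_eq_zero_of_monomial_subst v c e ?_ ?_)
  · rw [forall_momVar_two]
    simp [c]
  · intro κ hκ _ hsum
    have hn := hN κ hκ
    have hn' := hN μ hne
    have ka := mt (fun h : _ ∧ _ => coeff_eq_zero_of_isNormalExp hN hK false h.1 h.2) hκ
    have kb := mt (fun h : _ ∧ _ => coeff_eq_zero_of_isNormalExp hN hK true h.1 h.2) hκ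
    have ma := mt (fun h : _ ∧ _ => coeff_eq_zero_of_isNormalExp hN hK false h.1 h.2) hne
    have mb := mt (fun h : _ ∧ _ => coeff_eq_zero_of_isNormalExp hN hK true h.1 h.2) hne
    have hs := fun i => DFunLike.congr_fun hsum i
    simp only [sum_momVar_two, v] at hs
    have s0 := hs 0
    have s1 := hs 1
    have s2 := hs 2
    have s3 := hs 3
    have s4 := hs 4
    have s5 := hs 5
    simp at s0 s1 s2 s3 s4 s5
    unfold IsNormalExp at hn hn'
    refine Finsupp.ext ?_
    rw [forall_momVar_two]
    omega

/-- Bilinear conserved currents that vanish at the null configurations are trivial. -/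
theorem exists_potential_bilinear (T : Fin 2 × Fin 2 → MvPolynomial (MomVar 2) ℂ)
    (hT : ∑ c, totalMom ℂ 2 c.1 c.2 * T c = 0)
    (hL : ∀ a b, a ≠ 0 → b ≠ 0 → restrictNull a b (T (1, 1)) = 0) :
    ∃ Θ : Fin 2 × Fin 2 → Fin 2 × Fin 2 → MvPolynomial (MomVar 2) ℂ,
      (∀ a b, Θ b a = -Θ a b) ∧ (∀ a, Θ a a = 0) ∧
        ∀ a, T a = ∑ b, totalMom ℂ 2 b.1 b.2 * Θ a b := by
  let idx : Fin 3 → Fin 2 × Fin 2 := ![(0, 0), (0, 1), (1, 0)]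
  let lead : Fin 3 → Fin 2 := ![0, 1, 1]
  -- Only three of the four components can be given coprime leading monomials; K₁₁ is left out and
  -- is dealt with through T (1, 1).
  let w : MomVar 2 → ℕ := fun v => match v with
    | (0, false, 0) => 2
    | (1, true, 0) => 1
    | (1, true, 1) => 3
    | (1, false, 1) => 1
    | _ => 0
  have hlead : ∀ a, HasLeadingMonomial (Finsupp.weight w) (momExp (lead a) (idx a).1 (idx a).2)
      (AddMonoidHom.mulLeft (totalMom ℂ 2 (idx a).1 (idx a).2)) := by
    intro a
    have h0 : AddMonoidHom.mulLeft (totalMom ℂ 2 (idx a).1 (idx a).2) =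
        nabla (fun _ _ => 0) (idx a).1 (idx a).2 := by
      ext f κ
      simp [nabla_apply]
    rw [h0]
    refine hasLeadingMonomial_nabla _ _ _ _ _ ?_ ?_
    · rw [weight_momExp]
      fin_cases a <;> simp [lead, w, idx]
    · intro i hi
      rw [weight_momExp, weight_momExp]
      fin_cases a <;> fin_cases i <;> simp [lead, w, idx] at hi ⊢
  obtain ⟨N, g, hg, hN⟩ := exists_normal_form hlead (T (1, 1))
  rw [Fin.sum_univ_three] at hg
  have hN' : ∀ κ, N.coeff κ ≠ 0 → IsNormalExp κ := by
    intro κ hκ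
    have h := hN κ hκ
    have h0 := h 0
    have h1 := h 1
    have h2 := h 2
    simp only [momExp_le_iff, lead, idx] at h0 h1 h2
    simp at h0 h1 h2
    unfold IsNormalExp
    omega
  simp only [Fintype.sum_prod_type, Fin.sum_univ_two] at hT
  simp only [idx, Matrix.cons_val_zero, Matrix.cons_val_one, Matrix.cons_val] at hg
  -- By conservation K₁₁ T(1,1), and hence K₁₁ N, lies in the ideal of the other three components.
  have hzero : N = 0 := by
    refine eq_zero_of_isNormalExp hN' (g := ![-(T (0, 0) + totalMom ℂ 2 1 1 * g 0),
      -(T (0, 1) + totalMom ℂ 2 1 1 * g 1), -(T (1, 0) + totalMom ℂ 2 1 1 * g 2)]) ?_ ?_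
    · simp only [Matrix.cons_val_zero, Matrix.cons_val_one, Matrix.cons_val]
      rw [hg] at hT
      linear_combination hT
    · intro a b ha hb
      have h := hL a b ha hb
      rw [hg] at h
      simpa [restrictNull_totalMom] using h
  rw [hzero, zero_add] at hg
  obtain ⟨Θ, hs, h0, hΘ⟩ := exists_potential (I := Fin 3)
    (m := fun a => momExp (lead a) (idx a).1 (idx a).2) (by
      intro a b hab
      rw [Finset.disjoint_left]
      intro v hv hv'
      rw [Finsupp.mem_support_iff, momExp, Finsupp.add_apply, Finsupp.single_apply,
        Finsupp.single_apply] at hv hv'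
      have h1 : v = (lead a, false, (idx a).1) ∨ v = (lead a, true, (idx a).2) := by
        by_contra! h
        rw [if_neg h.1.symm, if_neg h.2.symm] at hv
        exact hv rfl
      have h2 : v = (lead b, false, (idx b).1) ∨ v = (lead b, true, (idx b).2) := by
        by_contra! h
        rw [if_neg h.1.symm, if_neg h.2.symm] at hv'
        exact hv' rfl
      clear hv hv'
      fin_cases a <;> fin_cases b <;>
        simp [lead, idx] at hab h1 h2 <;> rcases h1 with rfl | rfl <;> simp at h2)
    hlead (fun a b f => by simp only [AddMonoidHom.coe_mulLeft]; ring)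
    (fun a => T (idx a) + totalMom ℂ 2 1 1 * g a) (by
      simp only [AddMonoidHom.coe_mulLeft, Fin.sum_univ_three, idx, Matrix.cons_val_zero,
        Matrix.cons_val_one, Matrix.cons_val]
      rw [hg] at hT
      linear_combination hT)
  -- The quotients g in T(1,1) = ∑ K_a g_a are the entries of `Θ` involving (1, 1); the other
  -- entries come from the Koszul complex of the three remaining components.
  let pos : Fin 2 × Fin 2 → Option (Fin 3) := fun c => match c with
    | (0, 0) => some 0
    | (0, 1) => some 1
    | (1, 0) => some 2
    | (1, 1) => none
  refine ⟨fun a b => match pos a, pos b with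
    | some i, some j => Θ i j
    | some i, none => -g i
    | none, some j => g j
    | none, none => 0, ?_, ?_, ?_⟩
  · intro a b
    beta_reduce
    generalize pos a = x
    generalize pos b = y
    rcases x with _ | i <;> rcases y with _ | j
    · simp
    · simp
    · simp
    · exact hs i j
  · intro a
    beta_reduce
    generalize pos a = x
    rcases x with _ | i
    · rfl
    · exact h0 i
  · have e0 := hΘ 0
    have e1 := hΘ 1
    have e2 := hΘ 2
    simp only [Fin.sum_univ_three, AddMonoidHom.coe_mulLeft, idx, Matrix.cons_val_zero,
      Matrix.cons_val_one, Matrix.cons_val] at e0 e1 e2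
    rintro ⟨C, C'⟩
    simp only [Fintype.sum_prod_type, Fin.sum_univ_two]
    fin_cases C <;> fin_cases C' <;> simp only [Fin.zero_eta, Fin.mk_one, pos]
    · linear_combination e0
    · linear_combination e1
    · linear_combination e2
    · linear_combination hg

end Bilinear

/-! ### Coordinates of jets -/

section Coordinates

/-- Exponents of monomials in `π_A` (`false`) and `π̃_{A'}` (`true`). They label the components of
symmetric spinors: `π_0^a π_1^b π̃_0^c π̃_1^d` stands for `a` unprimed indices `0`, and so on. -/
abbrev JetExp : Type := Bool × Fin 2 →₀ ℕ

/-- The number of unprimed (`false`) or primed (`true`) indices. -/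
def JetExp.deg (μ : JetExp) (b : Bool) : ℕ := μ (b, 0) + μ (b, 1)

/-- Exchange of the primed and the unprimed indices. -/
def JetExp.swap (μ : JetExp) : JetExp := Finsupp.equivFunOnFinite.symm fun v => μ (!v.1, v.2)

@[simp] theorem JetExp.swap_apply (μ : JetExp) (b : Bool) (A : Fin 2) :
    μ.swap (b, A) = μ (!b, A) := rfl

@[simp] theorem JetExp.swap_swap (μ : JetExp) : μ.swap.swap = μ := by
  ext ⟨b, A⟩
  simp

theorem JetExp.swap_add (μ ν : JetExp) : (μ + ν).swap = μ.swap + ν.swap := by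
  ext ⟨b, A⟩
  rfl

/-- The labels of the coordinates `φ` of the jet. -/
def JetExp.IsPos (n : ℕ) (μ : JetExp) : Prop := μ.deg false = n + μ.deg true

/-- The labels of the coordinates `φ̄` of the jet. -/
def JetExp.IsNeg (n : ℕ) (μ : JetExp) : Prop := μ.deg true = n + μ.deg false

instance (n : ℕ) (μ : JetExp) : Decidable (μ.IsPos n) := inferInstanceAs (Decidable (_ = _))
instance (n : ℕ) (μ : JetExp) : Decidable (μ.IsNeg n) := inferInstanceAs (Decidable (_ = _))

@[simp] theorem JetExp.isPos_swap {n : ℕ} {μ : JetExp} : μ.swap.IsPos n ↔ μ.IsNeg n := Iff.rfl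

@[simp] theorem JetExp.isNeg_swap {n : ℕ} {μ : JetExp} : μ.swap.IsNeg n ↔ μ.IsPos n := Iff.rfl

theorem JetExp.IsPos.not_isNeg {n : ℕ} (hn : 1 ≤ n) {μ : JetExp} (h : μ.IsPos n) :
    ¬ μ.IsNeg n := by
  unfold JetExp.IsPos JetExp.IsNeg at *
  omega

/-- The exponent of `π_C π̃_{C'}`. -/
def dirExp (C C' : Fin 2) : JetExp := Finsupp.single (false, C) 1 + Finsupp.single (true, C') 1

theorem swap_dirExp (C C' : Fin 2) : (dirExp C C').swap = dirExp C' C := by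
  ext ⟨b, A⟩
  cases b <;> simp [dirExp, Finsupp.single_apply]

theorem deg_add (μ ν : JetExp) (b : Bool) : (μ + ν).deg b = μ.deg b + ν.deg b := by
  simp only [JetExp.deg, Finsupp.add_apply]
  ring

theorem deg_dirExp (C C' : Fin 2) (b : Bool) : (dirExp C C').deg b = 1 := by
  fin_cases C <;> fin_cases C' <;> cases b <;> simp [dirExp, JetExp.deg]

theorem isPos_add_dirExp {n : ℕ} {μ : JetExp} {C C' : Fin 2} :
    (μ + dirExp C C').IsPos n ↔ μ.IsPos n := by
  simp only [JetExp.IsPos, deg_add, deg_dirExp]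
  omega

theorem isNeg_add_dirExp {n : ℕ} {μ : JetExp} {C C' : Fin 2} :
    (μ + dirExp C C').IsNeg n ↔ μ.IsNeg n := by
  simp only [JetExp.IsNeg, deg_add, deg_dirExp]
  omega

/-- The label of the component with index strings `A`, `A'`. -/
def strExp {a b : ℕ} (A : Idx a) (A' : Idx b) : JetExp :=
  ∑ i, Finsupp.single (false, A i) 1 + ∑ i, Finsupp.single (true, A' i) 1

theorem strExp_false {a b : ℕ} (A : Idx a) (A' : Idx b) (c : Fin 2) :
    strExp A A' (false, c) = (Finset.univ.filter fun i => A i = c).card := by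
  simp [strExp, Finsupp.single_apply]

theorem strExp_true {a b : ℕ} (A : Idx a) (A' : Idx b) (c : Fin 2) :
    strExp A A' (true, c) = (Finset.univ.filter fun i => A' i = c).card := by
  simp [strExp, Finsupp.single_apply]

theorem card_filter_idx {k : ℕ} (A : Idx k) : (Finset.univ.filter fun i => A i = 0).card +
    (Finset.univ.filter fun i => A i = 1).card = k := by
  have h : (Finset.univ.filter fun i => A i = 1) = Finset.univ.filter fun i => ¬ A i = 0 := by
    ext i
    simp only [Finset.mem_filter_univ]
    omega
  rw [h, Finset.card_filter_add_card_filter_not]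
  simp

theorem deg_strExp_false {a b : ℕ} (A : Idx a) (A' : Idx b) : (strExp A A').deg false = a := by
  rw [JetExp.deg, strExp_false, strExp_false, card_filter_idx]

theorem deg_strExp_true {a b : ℕ} (A : Idx a) (A' : Idx b) : (strExp A A').deg true = b := by
  rw [JetExp.deg, strExp_true, strExp_true, card_filter_idx]

theorem exists_perm_of_card_eq {k : ℕ} {A B : Idx k}
    (h : ∀ c, (Finset.univ.filter fun i => A i = c).card =
      (Finset.univ.filter fun i => B i = c).card) : ∃ σ : Equiv.Perm (Fin k), B ∘ σ = A := by
  have h' : ∀ c, Nonempty ({i // A i = c} ≃ {i // B i = c}) := fun c =>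
    Fintype.card_eq.mp (by rw [Fintype.card_subtype, Fintype.card_subtype, h c])
  exact ⟨Equiv.ofFiberEquiv fun c => (h' c).some, funext fun i => Equiv.ofFiberEquiv_map _ i⟩

theorem exists_perm_of_card_zero_eq {k : ℕ} {A B : Idx k}
    (h : (Finset.univ.filter fun i => A i = 0).card =
      (Finset.univ.filter fun i => B i = 0).card) : ∃ σ : Equiv.Perm (Fin k), B ∘ σ = A := by
  refine exists_perm_of_card_eq fun c => ?_
  have h1 := card_filter_idx A
  have h2 := card_filter_idx B
  fin_cases c <;> simp only [Fin.zero_eta, Fin.mk_one]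
  · exact h
  · omega

theorem SymSpinor.apply_eq {a b : ℕ} (ψ : SymSpinor a b) {A B : Idx a} {A' B' : Idx b}
    (h : strExp A A' = strExp B B') :
    (ψ : Idx a → Idx b → ℂ) A A' = (ψ : Idx a → Idx b → ℂ) B B' := by
  obtain ⟨σ, rfl⟩ := exists_perm_of_card_eq (A := A) (B := B) fun c => by
    rw [← strExp_false A A', h, strExp_false]
  obtain ⟨τ, rfl⟩ := exists_perm_of_card_eq (A := A') (B := B') fun c => by
    rw [← strExp_true (B ∘ σ) A', h, strExp_true]
  exact ψ.2 σ τ B B'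

/-- The string of `a` indices `0`, followed by indices `1`. -/
def wordIdx (k a : ℕ) : Idx k := fun i => if (i : ℕ) < a then 0 else 1

theorem card_wordIdx {k a : ℕ} (h : a ≤ k) :
    (Finset.univ.filter fun i => wordIdx k a i = 0).card = a := by
  have : (Finset.univ.filter fun i => wordIdx k a i = 0) =
      Finset.univ.filter fun i : Fin k => (i : ℕ) < a := by
    ext i
    simp [wordIdx]
  rw [this, Fin.card_filter_val_lt, min_eq_right h]

theorem strExp_wordIdx (μ : JetExp) {a b : ℕ} (ha : μ.deg false = a) (hb : μ.deg true = b) :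
    strExp (wordIdx a (μ (false, 0))) (wordIdx b (μ (true, 0))) = μ := by
  subst ha hb
  have h1 := card_wordIdx (k := μ.deg false) (a := μ (false, 0)) (Nat.le_add_right _ _)
  have h2 := card_wordIdx (k := μ.deg true) (a := μ (true, 0)) (Nat.le_add_right _ _)
  have h3 := card_filter_idx (wordIdx (μ.deg false) (μ (false, 0)))
  have h4 := card_filter_idx (wordIdx (μ.deg true) (μ (true, 0)))
  have d1 : μ.deg false = μ (false, 0) + μ (false, 1) := rfl
  have d2 : μ.deg true = μ (true, 0) + μ (true, 1) := rfl
  ext ⟨b, c⟩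
  cases b
  · rw [strExp_false]
    fin_cases c <;> simp only [Fin.zero_eta, Fin.mk_one] <;> omega
  · rw [strExp_true]
    fin_cases c <;> simp only [Fin.zero_eta, Fin.mk_one] <;> omega

/-- The coordinate of a jet with label `μ`: a component of `φ` or of `φ̄`, and `0` if `μ` is not the
label of a coordinate. -/
def jetCoord {n : ℕ} (j : Jet n) (μ : JetExp) : ℂ :=
  if μ.IsPos n then (j (μ.deg true) : Idx (n + μ.deg true) → Idx (μ.deg true) → ℂ)
      (wordIdx _ (μ (false, 0))) (wordIdx _ (μ (true, 0)))
  else if μ.IsNeg n then conj ((j (μ.deg false) : Idx (n + μ.deg false) → Idx (μ.deg false) → ℂ)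
      (wordIdx _ (μ (true, 0))) (wordIdx _ (μ (false, 0))))
  else 0

variable {n : ℕ}

theorem isPos_strExp {p : ℕ} (A : Idx (n + p)) (A' : Idx p) : (strExp A A').IsPos n := by
  rw [JetExp.IsPos, deg_strExp_false, deg_strExp_true]

theorem jetCoord_strExp (j : Jet n) {p : ℕ} (A : Idx (n + p)) (A' : Idx p) :
    jetCoord j (strExp A A') = (j p : Idx (n + p) → Idx p → ℂ) A A' := by
  rw [jetCoord, if_pos (isPos_strExp A A')]
  have h : ∀ q, (strExp A A').deg true = q → q = p := fun q hq => by
    rw [← hq, deg_strExp_true]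
  generalize hq : (strExp A A').deg true = q
  obtain rfl := h q hq
  refine SymSpinor.apply_eq _ ?_
  rw [strExp_wordIdx _ (deg_strExp_false A A') hq]

theorem exists_strExp_eq {μ : JetExp} (h : μ.IsPos n) :
    ∃ (p : ℕ) (A : Idx (n + p)) (A' : Idx p), strExp A A' = μ :=
  ⟨_, _, _, strExp_wordIdx μ h rfl⟩

/-- The condition 1 ≤ n separates the labels of φ from those of φ̄. For n = 0 the two kinds would
coincide and a label would not tell a coordinate from its conjugate. -/
theorem jetCoord_swap (hn : 1 ≤ n) (j : Jet n) (μ : JetExp) :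
    jetCoord j μ.swap = conj (jetCoord j μ) := by
  by_cases h1 : μ.IsPos n
  · have h2 := h1.not_isNeg hn
    rw [jetCoord, if_neg (by simpa using h2), if_pos (by simpa using h1), jetCoord, if_pos h1]
    rfl
  · by_cases h2 : μ.IsNeg n
    · rw [jetCoord, if_pos (by simpa using h2), jetCoord, if_neg h1, if_pos h2, Complex.conj_conj]
      rfl
    · rw [jetCoord, if_neg (by simpa using h2), if_neg (by simpa using h1), jetCoord, if_neg h1,
        if_neg h2, map_zero]

theorem jetCoord_eq_zero (j : Jet n) {μ : JetExp} (h1 : ¬ μ.IsPos n) (h2 : ¬ μ.IsNeg n) :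
    jetCoord j μ = 0 := by
  rw [jetCoord, if_neg h1, if_neg h2]

theorem strExp_cons {a b : ℕ} (C C' : Fin 2) (A : Idx a) (A' : Idx b) :
    strExp (Fin.cons C A : Idx (a + 1)) (Fin.cons C' A' : Idx (b + 1)) =
      strExp A A' + dirExp C C' := by
  simp only [strExp, Fin.sum_univ_succ, Fin.cons_zero, Fin.cons_succ, dirExp]
  abel

theorem jetCoord_shift (j : Jet n) (C C' : Fin 2) {μ : JetExp} (h : μ.IsPos n) :
    jetCoord (j.shift C C') μ = jetCoord j (μ + dirExp C C') := by
  obtain ⟨p, A, A', rfl⟩ := exists_strExp_eq h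
  rw [jetCoord_strExp, ← strExp_cons]
  exact (jetCoord_strExp j (p := _ + 1) _ _).symm

theorem jetCoord_zero (μ : JetExp) : jetCoord (0 : Jet n) μ = 0 := by
  rw [jetCoord]
  split_ifs <;> simp

theorem jetCoord_add (j k : Jet n) (μ : JetExp) :
    jetCoord (j + k) μ = jetCoord j μ + jetCoord k μ := by
  simp only [jetCoord]
  split_ifs <;> simp

theorem jetCoord_real_smul (t : ℝ) (j : Jet n) (μ : JetExp) :
    jetCoord (t • j) μ = t * jetCoord j μ := by
  simp only [jetCoord]
  split_ifs <;> simp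

theorem jetCoord_smul (z : ℂ) (j : Jet n) {μ : JetExp} (h : μ.IsPos n) :
    jetCoord (z • j) μ = z * jetCoord j μ := by
  simp only [jetCoord, if_pos h]
  simp

theorem soldering_completeness (C C' E E' : Fin 2) :
    ∑ a, invSoldering a C C' * soldering a E E' = if E = C ∧ E' = C' then 1 else 0 := by
  have h2 : (Real.sqrt 2 : ℂ) * (Real.sqrt 2 : ℂ) = 2 := by
    rw [← Complex.ofReal_mul, Real.mul_self_sqrt (by norm_num)]
    norm_num
  have h0 : (Real.sqrt 2 : ℂ) ≠ 0 := fun h => by rw [h, mul_zero] at h2; norm_num at h2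
  fin_cases C <;> fin_cases C' <;> fin_cases E <;> fin_cases E' <;>
    simp [Fin.sum_univ_four, invSoldering, soldering, pauli] <;> field_simp <;>
    simp [pow_two, h2] <;> norm_num

theorem conj_soldering (a : Fin 4) (E E' : Fin 2) :
    conj (soldering a E E') = soldering a E' E := by
  fin_cases a <;> fin_cases E <;> fin_cases E' <;> simp [soldering, pauli]

theorem jetCoord_finset_sum {ι : Type*} (s : Finset ι) (f : ι → Jet n) (μ : JetExp) :
    jetCoord (∑ i ∈ s, f i) μ = ∑ i ∈ s, jetCoord (f i) μ := by
  classical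
  induction s using Finset.induction_on with
  | empty => simp [jetCoord_zero]
  | insert a s ha ih => rw [Finset.sum_insert ha, Finset.sum_insert ha, jetCoord_add, ih]

theorem jetCoord_shiftVec (j : Jet n) (a : Fin 4) {μ : JetExp} (h : μ.IsPos n) :
    jetCoord (j.shiftVec a) μ =
      ∑ C : Fin 2, ∑ C' : Fin 2, soldering a C C' * jetCoord j (μ + dirExp C C') := by
  simp only [Jet.shiftVec, jetCoord_finset_sum, jetCoord_smul _ _ h, jetCoord_shift _ _ _ h]

/-- For the coordinates φ this is the inversion of the soldering form. For φ̄ it follows by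
conjugation, since the Pauli matrices are Hermitian. -/
theorem sum_invSoldering_jetCoord (hn : 1 ≤ n) (j : Jet n) (C C' : Fin 2) (μ : JetExp) :
    ∑ a, invSoldering a C C' * jetCoord (j.shiftVec a) μ = jetCoord j (μ + dirExp C C') := by
  have key : ∀ (f : Fin 2 → Fin 2 → ℂ), ∑ a, invSoldering a C C' *
      ∑ E : Fin 2, ∑ E' : Fin 2, soldering a E E' * f E E' = f C C' := by
    intro f
    simp only [Finset.mul_sum, ← mul_assoc]
    rw [Finset.sum_comm]
    rw [Finset.sum_congr rfl fun E _ => Finset.sum_comm]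
    simp only [← Finset.sum_mul, soldering_completeness]
    rw [Finset.sum_eq_single C, Finset.sum_eq_single C']
    · simp
    · intro E' _ h; simp [h]
    · simp
    · intro E _ h; simp [h]
    · simp
  by_cases h1 : μ.IsPos n
  · simp only [jetCoord_shiftVec _ _ h1]
    exact key _
  · by_cases h2 : μ.IsNeg n
    · have h3 : μ.swap.IsPos n := by simpa using h2
      have h4 : ∀ a, jetCoord (j.shiftVec a) μ =
          ∑ E : Fin 2, ∑ E' : Fin 2, soldering a E E' * jetCoord j (μ + dirExp E E') := by
        intro a
        rw [← JetExp.swap_swap μ, jetCoord_swap hn, jetCoord_shiftVec _ _ h3, map_sum,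
          Finset.sum_comm' (t' := Finset.univ) (s' := fun _ => Finset.univ) (by simp)]
        simp only [map_sum, map_mul, conj_soldering, ← jetCoord_swap hn, JetExp.swap_add,
          swap_dirExp, JetExp.swap_swap]
      simp only [h4]
      exact key _
    · rw [jetCoord_eq_zero j (mt isPos_add_dirExp.mp h1) (mt isNeg_add_dirExp.mp h2)]
      refine Finset.sum_eq_zero fun a _ => ?_
      rw [jetCoord_eq_zero _ h1 h2, mul_zero]

/-- The jet all of whose coordinates vanish, except the one with label `μ`. -/
def unitJet (n : ℕ) (μ : JetExp) : Jet n := fun p =>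
  ⟨fun A A' => if strExp A A' = μ then 1 else 0, fun σ τ A A' => by
    have : strExp (A ∘ σ) (A' ∘ τ) = strExp A A' := by
      simp only [strExp, Function.comp_apply]
      rw [Equiv.sum_comp σ fun i => Finsupp.single (false, A i) 1,
        Equiv.sum_comp τ fun i => Finsupp.single (true, A' i) 1]
    simp only [this]⟩

theorem unitJet_apply (n : ℕ) (μ : JetExp) {p : ℕ} (A : Idx (n + p)) (A' : Idx p) :
    (unitJet n μ p : Idx (n + p) → Idx p → ℂ) A A' = if strExp A A' = μ then 1 else 0 := rfl

theorem jetCoord_unitJet {μ ν : JetExp} (h : ν.IsPos n) :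
    jetCoord (unitJet n μ) ν = if ν = μ then 1 else 0 := by
  obtain ⟨p, A, A', rfl⟩ := exists_strExp_eq h
  rw [jetCoord_strExp, unitJet_apply]

end Coordinates

/-! ### Local functions and their derivatives -/

section LocalFunctions

variable {n : ℕ}

/-- Truncation of jets. -/
def trunc (n r : ℕ) : Jet n →ₗ[ℝ] JetUpTo n r where
  toFun j := fun p => j p
  map_add' _ _ := rfl
  map_smul' _ _ := rfl

/-- `f` represents `F` as a smooth function of the jet coordinates of order at most `r`. -/
def Represents {r : ℕ} (f : JetUpTo n r → ℂ) (F : Jet n → ℂ) : Prop :=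
  ContDiff ℝ ∞ f ∧ ∀ j, F j = f (trunc n r j)

/-- Restriction of truncated jets to lower order. -/
def lowerTrunc (n : ℕ) {r r' : ℕ} (h : r ≤ r') : JetUpTo n r' →L[ℝ] JetUpTo n r where
  toFun y := fun p => y (Fin.castLE (Nat.succ_le_succ h) p)
  map_add' _ _ := rfl
  map_smul' _ _ := rfl
  cont := continuous_pi fun p => continuous_apply (Fin.castLE (Nat.succ_le_succ h) p)

theorem Represents.raise {r r' : ℕ} (h : r ≤ r') {f : JetUpTo n r → ℂ} {F : Jet n → ℂ}
    (hf : Represents f F) : Represents (fun y => f (lowerTrunc n h y)) F :=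
  ⟨hf.1.comp (lowerTrunc n h).contDiff, hf.2⟩

/-- The algebra of smooth functions of finitely many jet coordinates. -/
def localFn (n : ℕ) : Subalgebra ℂ (Jet n → ℂ) where
  carrier := {F | ∃ (r : ℕ) (f : JetUpTo n r → ℂ), Represents f F}
  add_mem' := by
    rintro F G ⟨r, f, hf⟩ ⟨s, g, hg⟩
    have hf' := hf.raise (le_max_left r s)
    have hg' := hg.raise (le_max_right r s)
    exact ⟨max r s, _, hf'.1.add hg'.1, fun j => congrArg₂ (· + ·) (hf'.2 j) (hg'.2 j)⟩
  mul_mem' := by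
    rintro F G ⟨r, f, hf⟩ ⟨s, g, hg⟩
    have hf' := hf.raise (le_max_left r s)
    have hg' := hg.raise (le_max_right r s)
    exact ⟨max r s, _, hf'.1.mul hg'.1, fun j => congrArg₂ (· * ·) (hf'.2 j) (hg'.2 j)⟩
  algebraMap_mem' c := ⟨0, fun _ => c, contDiff_const, fun _ => rfl⟩

theorem Represents.hasLineDerivAt {r : ℕ} {f : JetUpTo n r → ℂ} {F : Jet n → ℂ}
    (hf : Represents f F) (j k : Jet n) :
    HasLineDerivAt ℝ F (fderiv ℝ f (trunc n r j) (trunc n r k)) j k := by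
  have h1 : HasFDerivAt f (fderiv ℝ f (trunc n r j)) (trunc n r j + (0 : ℝ) • trunc n r k) := by
    rw [zero_smul, add_zero]
    exact (hf.1.differentiable (by simp) _).hasFDerivAt
  have h2 : HasDerivAt (fun t : ℝ => trunc n r j + t • trunc n r k) (trunc n r k) 0 := by
    simpa using ((hasDerivAt_id (0 : ℝ)).smul_const (trunc n r k)).const_add (trunc n r j)
  have h3 := h1.comp_hasDerivAt (0 : ℝ) h2
  refine h3.congr_of_eventuallyEq (Filter.Eventually.of_forall fun t => ?_)
  simp only [Function.comp_apply]
  rw [hf.2, map_add, map_smul]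

theorem Represents.lineDeriv {r : ℕ} {f : JetUpTo n r → ℂ} {F : Jet n → ℂ}
    (hf : Represents f F) (j k : Jet n) :
    lineDeriv ℝ F j k = fderiv ℝ f (trunc n r j) (trunc n r k) :=
  (hf.hasLineDerivAt j k).lineDeriv

theorem hasLineDerivAt_localFn (F : localFn n) (j k : Jet n) :
    HasLineDerivAt ℝ (F : Jet n → ℂ) (lineDeriv ℝ (F : Jet n → ℂ) j k) j k := by
  obtain ⟨r, f, hf⟩ := F.2
  rw [hf.lineDeriv]
  exact hf.hasLineDerivAt j k

theorem Represents.lineDeriv_fun {r : ℕ} {f : JetUpTo n r → ℂ} {F : Jet n → ℂ}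
    (hf : Represents f F) (k : Jet n) :
    Represents (fun y => fderiv ℝ f y (trunc n r k)) (fun j => _root_.lineDeriv ℝ F j k) :=
  ⟨(hf.1.fderiv_right (m := ∞) (by simp)).clm_apply contDiff_const, fun j => hf.lineDeriv j k⟩

/-- The derivative of local functions in the direction of a fixed jet. -/
def dirDeriv (k : Jet n) : Derivation ℂ (localFn n) (localFn n) :=
  Derivation.mk'
    { toFun := fun F => ⟨fun j => lineDeriv ℝ (F : Jet n → ℂ) j k, by
        obtain ⟨r, f, hf⟩ := F.2
        exact ⟨r, _, hf.lineDeriv_fun k⟩⟩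
      map_add' := fun F G => Subtype.ext <| funext fun j =>
        HasDerivAt.deriv ((hasLineDerivAt_localFn F j k).add (hasLineDerivAt_localFn G j k))
      map_smul' := fun c F => Subtype.ext <| funext fun j =>
        HasDerivAt.deriv (HasDerivAt.const_smul c (hasLineDerivAt_localFn F j k)) }
    fun F G => Subtype.ext <| funext fun j => by
      have h := HasDerivAt.deriv (HasDerivAt.mul (hasLineDerivAt_localFn F j k)
        (hasLineDerivAt_localFn G j k))
      refine h.trans ?_
      simp only [zero_smul, add_zero]
      change _ = (F : Jet n → ℂ) j * lineDeriv ℝ (G : Jet n → ℂ) j k +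
        (G : Jet n → ℂ) j * lineDeriv ℝ (F : Jet n → ℂ) j k
      ring

theorem dirDeriv_apply (k : Jet n) (F : localFn n) (j : Jet n) :
    (dirDeriv k F : Jet n → ℂ) j = lineDeriv ℝ (F : Jet n → ℂ) j k := rfl

theorem dirDeriv_comm (k l : Jet n) (F : localFn n) :
    dirDeriv k (dirDeriv l F) = dirDeriv l (dirDeriv k F) := by
  obtain ⟨r, f, hf⟩ := F.2
  have key : ∀ k l : Jet n, ∀ j, (dirDeriv k (dirDeriv l F) : Jet n → ℂ) j =
      fderiv ℝ (fderiv ℝ f) (trunc n r j) (trunc n r k) (trunc n r l) := by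
    intro k l j
    rw [dirDeriv_apply]
    have h1 : ((dirDeriv l F : localFn n) : Jet n → ℂ) = fun j => lineDeriv ℝ (F : Jet n → ℂ) j l :=
      rfl
    rw [h1, (hf.lineDeriv_fun l).lineDeriv]
    have h2 : DifferentiableAt ℝ (fderiv ℝ f) (trunc n r j) :=
      (hf.1.fderiv_right (m := ∞) (by simp)).differentiable (by simp) _
    rw [fderiv_clm_apply h2 (differentiableAt_const _)]
    simp
  refine Subtype.ext (funext fun j => ?_)
  rw [key, key]
  exact (hf.1.contDiffAt.isSymmSndFDerivAt (by
    rw [minSmoothness_of_isRCLikeNormedField]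
    exact WithTop.coe_le_coe.mpr le_top)).eq _ _

/-- The coefficients of a real linear function of the jet with respect to the coordinates `φ` and
`φ̄`. -/
def linCoeff (ℓ : Jet n → ℂ) (μ : JetExp) : ℂ :=
  if μ.IsPos n then (1 / 2) * (ℓ (unitJet n μ) - Complex.I * ℓ (Complex.I • unitJet n μ))
  else if μ.IsNeg n then
    (1 / 2) * (ℓ (unitJet n μ.swap) + Complex.I * ℓ (Complex.I • unitJet n μ.swap))
  else 0

/-- The labels with at most `B` indices of each kind. -/
def boxExp (B : ℕ) : Finset JetExp := Finset.Iic (Finsupp.equivFunOnFinite.symm fun _ => B)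

theorem mem_boxExp {B : ℕ} {μ : JetExp} : μ ∈ boxExp B ↔ ∀ v, μ v ≤ B := by
  rw [boxExp, Finset.mem_Iic, Finsupp.le_def]
  rfl

theorem swap_mem_boxExp {B : ℕ} {μ : JetExp} : μ.swap ∈ boxExp B ↔ μ ∈ boxExp B := by
  simp only [mem_boxExp, Prod.forall, Bool.forall_bool, JetExp.swap_apply, Bool.not_false,
    Bool.not_true]
  tauto

theorem strExp_mem_boxExp {a b B : ℕ} (A : Idx a) (A' : Idx b) (ha : a ≤ B) (hb : b ≤ B) :
    strExp A A' ∈ boxExp B := by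
  rw [mem_boxExp]
  rintro ⟨_ | _, c⟩
  · rw [strExp_false]
    exact (Finset.card_le_univ _).trans (by simpa using ha)
  · rw [strExp_true]
    exact (Finset.card_le_univ _).trans (by simpa using hb)

theorem trunc_unitJet {r B : ℕ} (hB : n + r ≤ B) {μ : JetExp} (h : μ ∉ boxExp B) :
    trunc n r (unitJet n μ) = 0 := by
  funext p
  refine Subtype.ext (funext fun A => funext fun A' => ?_)
  change (if strExp A A' = μ then (1 : ℂ) else 0) = 0
  rw [if_neg]
  rintro rfl
  have := p.2
  exact h (strExp_mem_boxExp A A' (by omega) (by omega))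

theorem linCoeff_eq_zero {r B : ℕ} (hB : n + r ≤ B) (ℓ : Jet n → ℂ)
    (hℓ : ∀ k, trunc n r k = 0 → ℓ k = 0) {μ : JetExp} (h : μ ∉ boxExp B) : linCoeff ℓ μ = 0 := by
  have key : ∀ {ν : JetExp}, ν ∉ boxExp B → ∀ z : ℂ, ℓ (z • unitJet n ν) = 0 := by
    intro ν hν z
    refine hℓ _ ?_
    have h1 : trunc n r (z • unitJet n ν) = z • trunc n r (unitJet n ν) := rfl
    rw [h1, trunc_unitJet hB hν, smul_zero]
  have h1 := key h
  have h2 := key (mt swap_mem_boxExp.mp h)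
  have h3 := h1 1
  have h4 := h2 1
  rw [one_smul] at h3 h4
  rw [linCoeff, h1, h2, h3, h4]
  simp

/-- Such a functional sees finitely many components only. On each complex line it splits into a
linear and an antilinear part, which give the coefficients of φ and of φ̄. -/
theorem eq_sum_linCoeff (hn : 1 ≤ n) {r B : ℕ} (hB : n + r ≤ B) (ℓ : Jet n →ₗ[ℝ] ℂ)
    (hℓ : ∀ k, trunc n r k = 0 → ℓ k = 0) (k : Jet n) :
    ℓ k = ∑ μ ∈ boxExp B, linCoeff ℓ μ * jetCoord k μ := by
  have h1 : ℓ k = ∑ μ ∈ (boxExp B).filter (JetExp.IsPos n),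
      ℓ (jetCoord k μ • unitJet n μ) := by
    rw [← map_sum, ← sub_eq_zero, ← map_sub]
    refine hℓ _ (funext fun p => Subtype.ext (funext fun A => funext fun A' => ?_))
    have hp := p.2
    have h2 : ∀ s : Finset JetExp,
        (((∑ μ ∈ s, jetCoord k μ • unitJet n μ : Jet n) p : SymSpinor (n + p) p) :
          Idx (n + p) → Idx p → ℂ) A A' =
        ∑ μ ∈ s, jetCoord k μ * if strExp A A' = μ then 1 else 0 := by
      intro s
      induction s using Finset.induction_on with
      | empty => rfl
      | insert a s ha ih =>
        rw [Finset.sum_insert ha, Finset.sum_insert ha, ← ih]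
        rfl
    change ((k p : Idx (n + p) → Idx p → ℂ) A A') -
      (((∑ μ ∈ (boxExp B).filter (JetExp.IsPos n), jetCoord k μ • unitJet n μ : Jet n) p :
        SymSpinor (n + p) p) : Idx (n + p) → Idx p → ℂ) A A' = 0
    rw [h2]
    simp only [mul_ite, mul_one, mul_zero, Finset.sum_ite_eq]
    rw [if_pos, jetCoord_strExp, sub_self]
    rw [Finset.mem_filter]
    exact ⟨strExp_mem_boxExp A A' (by omega) (by omega), isPos_strExp A A'⟩
  have h2 : ∀ (z : ℂ) (e : Jet n), ℓ (z • e) =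
      (1 / 2) * (ℓ e - Complex.I * ℓ (Complex.I • e)) * z +
        (1 / 2) * (ℓ e + Complex.I * ℓ (Complex.I • e)) * conj z := by
    intro z e
    have h3 : z • e = z.re • e + z.im • (Complex.I • e) := by
      refine funext fun p => Subtype.ext (funext fun A => funext fun A' => ?_)
      change z * (e p : Idx (n + p) → Idx p → ℂ) A A' =
        z.re • (e p : Idx (n + p) → Idx p → ℂ) A A' +
          z.im • (Complex.I * (e p : Idx (n + p) → Idx p → ℂ) A A')
      apply Complex.ext <;> simp
      ring
    rw [h3, map_add, map_smul, map_smul]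
    apply Complex.ext <;> simp <;> ring
  rw [h1]
  rw [Finset.sum_congr rfl fun μ _ => h2 _ _, Finset.sum_add_distrib]
  have h4 : ∑ μ ∈ (boxExp B).filter (JetExp.IsPos n),
      (1 / 2) * (ℓ (unitJet n μ) + Complex.I * ℓ (Complex.I • unitJet n μ)) * conj (jetCoord k μ) =
      ∑ μ ∈ (boxExp B).filter (JetExp.IsNeg n), (1 / 2) * (ℓ (unitJet n μ.swap) +
        Complex.I * ℓ (Complex.I • unitJet n μ.swap)) * jetCoord k μ := by
    refine Finset.sum_nbij' JetExp.swap JetExp.swap ?_ ?_ ?_ ?_ ?_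
    · intro μ hμ
      simpa [swap_mem_boxExp] using hμ
    · intro μ hμ
      simpa [swap_mem_boxExp] using hμ
    · simp
    · simp
    · intro μ _
      rw [jetCoord_swap hn, JetExp.swap_swap]
  rw [h4, Finset.sum_filter, Finset.sum_filter, ← Finset.sum_add_distrib]
  refine Finset.sum_congr rfl fun μ _ => ?_
  rw [linCoeff]
  by_cases hp : μ.IsPos n
  · rw [if_pos hp, if_pos hp, if_neg (hp.not_isNeg hn), add_zero]
  · rw [if_neg hp, if_neg hp, zero_add]
    split_ifs
    · rfl
    · rw [zero_mul]

/-- The partial derivative with respect to the jet coordinate with label `μ`. -/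
def pd (n : ℕ) (μ : JetExp) : Derivation ℂ (localFn n) (localFn n) :=
  if μ.IsPos n then
    (1 / 2 : ℂ) • (dirDeriv (unitJet n μ) - Complex.I • dirDeriv (Complex.I • unitJet n μ))
  else if μ.IsNeg n then
    (1 / 2 : ℂ) • (dirDeriv (unitJet n μ.swap) + Complex.I • dirDeriv (Complex.I • unitJet n μ.swap))
  else 0

theorem pd_apply (μ : JetExp) (F : localFn n) (j : Jet n) :
    (pd n μ F : Jet n → ℂ) j = linCoeff (fun k => lineDeriv ℝ (F : Jet n → ℂ) j k) μ := by
  rw [pd, linCoeff]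
  split_ifs <;> rfl

/-- Transfers to `pd` what is known for directional derivatives, without distinguishing the three
kinds of labels. -/
theorem exists_pd_eq (μ : JetExp) : ∃ (k l : Jet n) (a b : ℂ),
    pd n μ = a • dirDeriv k + b • dirDeriv l := by
  rw [pd]
  split_ifs
  · exact ⟨unitJet n μ, Complex.I • unitJet n μ, 1 / 2, -(1 / 2 * Complex.I), by module⟩
  · exact ⟨unitJet n μ.swap, Complex.I • unitJet n μ.swap, 1 / 2, 1 / 2 * Complex.I, by module⟩
  · exact ⟨0, 0, 0, 0, by module⟩

theorem pd_comm (μ ν : JetExp) (F : localFn n) :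
    pd n μ (pd n ν F) = pd n ν (pd n μ F) := by
  obtain ⟨k, l, a, b, h1⟩ := exists_pd_eq (n := n) μ
  obtain ⟨k', l', a', b', h2⟩ := exists_pd_eq (n := n) ν
  rw [h1, h2]
  simp only [Derivation.smul_apply, Derivation.add_apply, Derivation.map_smul, Derivation.map_add]
  rw [dirDeriv_comm k k', dirDeriv_comm k l', dirDeriv_comm l k', dirDeriv_comm l l']
  module

/-- `F` depends only on jet coordinates with labels in `boxExp B`. -/
def OrderLE (F : localFn n) (B : ℕ) : Prop :=
  (∀ μ ∉ boxExp B, pd n μ F = 0) ∧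
    ∀ j k, lineDeriv ℝ (F : Jet n → ℂ) j k =
      ∑ μ ∈ boxExp B, (pd n μ F : Jet n → ℂ) j * jetCoord k μ

theorem exists_orderLE (hn : 1 ≤ n) (F : localFn n) : ∃ B₀, ∀ B, B₀ ≤ B → OrderLE F B := by
  obtain ⟨r, f, hf⟩ := F.2
  refine ⟨n + r, fun B hB => ⟨fun μ hμ => ?_, fun j k => ?_⟩⟩
  · refine Subtype.ext (funext fun j => ?_)
    rw [pd_apply, linCoeff_eq_zero hB _ _ hμ]
    · rfl
    · intro k hk
      rw [hf.lineDeriv, hk, map_zero]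
  · have h := eq_sum_linCoeff hn hB
      ((fderiv ℝ f (trunc n r j) : JetUpTo n r →ₗ[ℝ] ℂ).comp (trunc n r))
      (fun k hk => by rw [LinearMap.comp_apply, hk, map_zero]) k
    rw [hf.lineDeriv]
    refine h.trans (Finset.sum_congr rfl fun μ _ => ?_)
    rw [pd_apply]
    congr 2
    funext l
    rw [hf.lineDeriv]
    rfl

end LocalFunctions

/-! ### Total derivatives of local functions -/

section TotalDerivatives

variable {n : ℕ}

theorem represents_component {p : ℕ} (A : Idx (n + p)) (A' : Idx p) :
    Represents (r := p) (fun y => ((y (Fin.last p)).1 : Idx (n + p) → Idx p → ℂ) A A')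
      (fun j : Jet n => (j p : Idx (n + p) → Idx p → ℂ) A A') := by
  refine ⟨?_, fun j => rfl⟩
  have h1 : ContDiff ℝ ∞ fun y : JetUpTo n p => y (Fin.last p) :=
    (ContinuousLinearMap.proj (Fin.last p) : JetUpTo n p →L[ℝ] SymSpinor (n + p) p).contDiff
  have h2 := ((SymSpinor (n + p) p).subtypeL.restrictScalars ℝ).contDiff (n := ∞) |>.comp h1
  exact contDiff_pi.mp (contDiff_pi.mp h2 A) A'

/-- The jet coordinate with label `μ`, as a local function. -/
def coordFn (n : ℕ) (μ : JetExp) : localFn n :=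
  ⟨fun j => jetCoord j μ, by
    by_cases h1 : μ.IsPos n
    · simp only [jetCoord, if_pos h1]
      exact ⟨_, _, represents_component _ _⟩
    · by_cases h2 : μ.IsNeg n
      · simp only [jetCoord, if_neg h1, if_pos h2]
        have h := represents_component (n := n) (p := μ.deg false)
          (wordIdx _ (μ (true, 0))) (wordIdx _ (μ (false, 0)))
        exact ⟨_, _, Complex.conjCLE.contDiff.comp h.1, fun j => congrArg conj (h.2 j)⟩
      · simp only [jetCoord, if_neg h1, if_neg h2]
        exact (localFn n).zero_mem⟩

theorem coordFn_apply (μ : JetExp) (j : Jet n) : (coordFn n μ : Jet n → ℂ) j = jetCoord j μ := rfl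

theorem lineDeriv_jetCoord (μ : JetExp) (j k : Jet n) :
    lineDeriv ℝ (fun j : Jet n => jetCoord j μ) j k = jetCoord k μ := by
  have h : HasDerivAt (fun t : ℝ => jetCoord (j + t • k) μ) (jetCoord k μ) 0 := by
    simp only [jetCoord_add, jetCoord_real_smul]
    have h1 : HasDerivAt (fun t : ℝ => (t : ℂ)) 1 (0 : ℝ) := Complex.ofRealCLM.hasDerivAt
    simpa using (h1.mul_const (jetCoord k μ)).const_add (jetCoord j μ)
  exact h.deriv

theorem pd_coordFn (hn : 1 ≤ n) (μ ν : JetExp) :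
    pd n ν (coordFn n μ) = if ν = μ ∧ (ν.IsPos n ∨ ν.IsNeg n) then 1 else 0 := by
  have key : ∀ (ν : JetExp) (j : Jet n), (pd n ν (coordFn n μ) : Jet n → ℂ) j =
      if ν = μ ∧ (ν.IsPos n ∨ ν.IsNeg n) then 1 else 0 := by
    intro ν j
    rw [pd_apply]
    change linCoeff (fun k => lineDeriv ℝ (fun j : Jet n => jetCoord j μ) j k) ν = _
    simp only [lineDeriv_jetCoord]
    have hval : ∀ (ν : JetExp) (z : ℂ), jetCoord (z • unitJet n ν) μ =
        if μ.IsPos n then z * (if μ = ν then 1 else 0)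
        else if μ.IsNeg n then conj z * (if μ.swap = ν then 1 else 0) else 0 := by
      intro ν z
      by_cases h1 : μ.IsPos n
      · rw [if_pos h1, jetCoord_smul _ _ h1, jetCoord_unitJet h1]
      · rw [if_neg h1]
        by_cases h2 : μ.IsNeg n
        · have h3 : μ.swap.IsPos n := by simpa using h2
          rw [if_pos h2, ← JetExp.swap_swap μ, jetCoord_swap hn, jetCoord_smul _ _ h3,
            jetCoord_unitJet h3, map_mul, JetExp.swap_swap]
          congr 1
          split_ifs <;> simp
        · rw [if_neg h2, jetCoord_eq_zero _ h1 h2]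
    have hval1 := fun ν => hval ν 1
    simp only [one_smul] at hval1
    simp only [linCoeff, hval, hval1]
    have hsw : ∀ {a b : JetExp}, a.swap = b.swap ↔ a = b := fun {a b} =>
      ⟨fun h => by rw [← JetExp.swap_swap a, h, JetExp.swap_swap], fun h => by rw [h]⟩
    by_cases hν : ν.IsPos n
    · rw [if_pos hν]
      by_cases h1 : μ.IsPos n
      · simp only [if_pos h1, hν, true_or, and_true, eq_comm (a := ν)]
        split_ifs
        · linear_combination (-(1 / 2) : ℂ) * Complex.I_mul_I
        · ring
      · have h3 : ν ≠ μ := fun h => h1 (h ▸ hν)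
        simp only [if_neg h1, h3, false_and, if_false]
        by_cases h2 : μ.IsNeg n
        · simp only [if_pos h2, map_one, Complex.conj_I]
          split_ifs
          · linear_combination ((1 / 2) : ℂ) * Complex.I_mul_I
          · ring
        · simp [if_neg h2]
    · rw [if_neg hν]
      by_cases hν' : ν.IsNeg n
      · rw [if_pos hν']
        by_cases h1 : μ.IsPos n
        · have h3 : ν ≠ μ := fun h => hν (h ▸ h1)
          simp only [if_pos h1, h3, false_and, if_false]
          split_ifs
          · linear_combination ((1 / 2) : ℂ) * Complex.I_mul_I
          · ring
        · simp only [if_neg h1]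
          by_cases h2 : μ.IsNeg n
          · simp only [if_pos h2, map_one, Complex.conj_I, hsw, hν', or_true, and_true,
              eq_comm (a := ν)]
            split_ifs
            · linear_combination (-(1 / 2) : ℂ) * Complex.I_mul_I
            · ring
          · have h3 : ν ≠ μ := fun h => h2 (h ▸ hν')
            simp [if_neg h2, h3]
      · simp [hν, hν']
  refine Subtype.ext (funext fun j => ?_)
  rw [key]
  split_ifs <;> rfl

theorem totalDeriv_eq (hn : 1 ≤ n) {F : localFn n} {B : ℕ} (hB : OrderLE F B) (C C' : Fin 2)
    (x : Minkowski) (j : Jet n) :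
    totalDeriv C C' (fun _ j => (F : Jet n → ℂ) j) x j =
      ∑ μ ∈ boxExp B, (pd n μ F : Jet n → ℂ) j * jetCoord j (μ + dirExp C C') := by
  have h1 : ∀ a, totalDerivVec a (fun _ j => (F : Jet n → ℂ) j) x j =
      lineDeriv ℝ (F : Jet n → ℂ) j (j.shiftVec a) := fun a => rfl
  simp only [totalDeriv, h1, hB.2]
  simp only [Finset.mul_sum]
  rw [Finset.sum_comm]
  refine Finset.sum_congr rfl fun μ _ => ?_
  rw [← sum_invSoldering_jetCoord hn, Finset.mul_sum]
  exact Finset.sum_congr rfl fun a _ => by ring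

theorem coe_finset_sum {ι : Type*} (s : Finset ι) (f : ι → localFn n) (j : Jet n) :
    ((∑ i ∈ s, f i : localFn n) : Jet n → ℂ) j = ∑ i ∈ s, (f i : Jet n → ℂ) j := by
  rw [AddSubmonoidClass.coe_finsetSum, Finset.sum_apply]

theorem totalDeriv_mem (hn : 1 ≤ n) (C C' : Fin 2) (F : localFn n) :
    (fun j => totalDeriv C C' (fun _ j => (F : Jet n → ℂ) j) 0 j) ∈ localFn n := by
  obtain ⟨B, hB⟩ := exists_orderLE hn F
  have h : (fun j => totalDeriv C C' (fun _ j => (F : Jet n → ℂ) j) 0 j) =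
      ((∑ μ ∈ boxExp B, pd n μ F * coordFn n (μ + dirExp C C') : localFn n) : Jet n → ℂ) := by
    funext j
    rw [totalDeriv_eq hn (hB B le_rfl), coe_finset_sum]
    rfl
  rw [h]
  exact Subtype.property _

/-- The total derivative `D_{CC'}` on local functions, as a function. -/
def totalDFun (hn : 1 ≤ n) (C C' : Fin 2) (F : localFn n) : localFn n :=
  ⟨fun j => totalDeriv C C' (fun _ j => (F : Jet n → ℂ) j) 0 j, totalDeriv_mem hn C C' F⟩

theorem totalDFun_eq (hn : 1 ≤ n) (C C' : Fin 2) {F : localFn n} {B : ℕ} (hB : OrderLE F B) :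
    totalDFun hn C C' F = ∑ μ ∈ boxExp B, pd n μ F * coordFn n (μ + dirExp C C') := by
  refine Subtype.ext (funext fun j => ?_)
  rw [coe_finset_sum]
  exact totalDeriv_eq hn hB C C' 0 j

/-- A common bound on the labels lets the expansions of several functions be compared term by term.
-/
theorem exists_orderLE_list (hn : 1 ≤ n) (l : List (localFn n)) :
    ∃ B, ∀ F ∈ l, OrderLE F B := by
  have : ∃ B₀, ∀ B, B₀ ≤ B → ∀ F ∈ l, OrderLE F B := by
    induction l with
    | nil => exact ⟨0, fun _ _ _ h => by simp at h⟩
    | cons F l ih =>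
      obtain ⟨B₁, h1⟩ := ih
      obtain ⟨B₂, h2⟩ := exists_orderLE hn F
      refine ⟨max B₁ B₂, fun B hB G hG => ?_⟩
      rcases List.mem_cons.mp hG with rfl | hG
      · exact h2 B ((le_max_right _ _).trans hB)
      · exact h1 B ((le_max_left _ _).trans hB) G hG
  obtain ⟨B₀, h⟩ := this
  exact ⟨B₀, h B₀ le_rfl⟩

/-- The total derivative `D_{CC'}` on local functions. -/
def totalD (hn : 1 ≤ n) (C C' : Fin 2) : Derivation ℂ (localFn n) (localFn n) :=
  Derivation.mk'
    { toFun := totalDFun hn C C'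
      map_add' := fun F G => by
        obtain ⟨B, hB⟩ := exists_orderLE_list hn [F, G, F + G]
        rw [totalDFun_eq hn C C' (hB F (by simp)), totalDFun_eq hn C C' (hB G (by simp)),
          totalDFun_eq hn C C' (hB (F + G) (by simp)), ← Finset.sum_add_distrib]
        exact Finset.sum_congr rfl fun μ _ => by rw [Derivation.map_add, add_mul]
      map_smul' := fun c F => by
        obtain ⟨B, hB⟩ := exists_orderLE_list hn [F, c • F]
        rw [totalDFun_eq hn C C' (hB F (by simp)), totalDFun_eq hn C C' (hB (c • F) (by simp)),
          Finset.smul_sum]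
        exact Finset.sum_congr rfl fun μ _ => by
          rw [Derivation.map_smul, smul_mul_assoc, RingHom.id_apply] }
    fun F G => by
      obtain ⟨B, hB⟩ := exists_orderLE_list hn [F, G, F * G]
      change totalDFun hn C C' (F * G) = F • totalDFun hn C C' G + G • totalDFun hn C C' F
      rw [totalDFun_eq hn C C' (hB F (by simp)), totalDFun_eq hn C C' (hB G (by simp)),
        totalDFun_eq hn C C' (hB (F * G) (by simp)), Finset.smul_sum, Finset.smul_sum,
        ← Finset.sum_add_distrib]
      exact Finset.sum_congr rfl fun μ _ => by
        rw [Derivation.leibniz]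
        simp only [smul_eq_mul]
        ring

theorem totalD_apply (hn : 1 ≤ n) (C C' : Fin 2) (F : localFn n) (x : Minkowski) (j : Jet n) :
    (totalD hn C C' F : Jet n → ℂ) j = totalDeriv C C' (fun _ j => (F : Jet n → ℂ) j) x j := rfl

theorem totalD_eq (hn : 1 ≤ n) (C C' : Fin 2) {F : localFn n} {B : ℕ} (hB : OrderLE F B) :
    totalD hn C C' F = ∑ μ ∈ boxExp B, pd n μ F * coordFn n (μ + dirExp C C') :=
  totalDFun_eq hn C C' hB

theorem pd_eq_zero {μ : JetExp} (h1 : ¬ μ.IsPos n) (h2 : ¬ μ.IsNeg n) : pd n μ = 0 := by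
  rw [pd, if_neg h1, if_neg h2]

/-- In D F = ∑ ∂_μF φ_{μ+e}, where e is the label of the direction CC', the derivative ∂_ν also
meets the factor with μ + e = ν. This commutator is what turns D into multiplication by momentum on
symbols. -/
theorem pd_totalD (hn : 1 ≤ n) (C C' : Fin 2) (ν : JetExp) (F : localFn n) :
    pd n ν (totalD hn C C' F) = totalD hn C C' (pd n ν F) +
      if dirExp C C' ≤ ν then pd n (ν - dirExp C C') F else 0 := by
  obtain ⟨B, hB⟩ := exists_orderLE_list hn [F, pd n ν F]
  have hF := hB F (by simp)
  rw [totalD_eq hn C C' hF, totalD_eq hn C C' (hB (pd n ν F) (by simp)), map_sum]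
  simp only [Derivation.leibniz, smul_eq_mul, Finset.sum_add_distrib, pd_comm ν]
  rw [add_comm]
  congr 1
  · exact Finset.sum_congr rfl fun μ _ => mul_comm _ _
  · simp only [pd_coordFn hn, mul_ite, mul_one, mul_zero]
    by_cases hle : dirExp C C' ≤ ν
    · rw [if_pos hle]
      have e : ν - dirExp C C' + dirExp C C' = ν := tsub_add_cancel_of_le hle
      by_cases hH : ν.IsPos n ∨ ν.IsNeg n
      · rw [Finset.sum_congr rfl fun μ _ => if_congr (Q := ν - dirExp C C' = μ) ?_ rfl rfl,
          Finset.sum_ite_eq]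
        · split_ifs with hm
          · rfl
          · exact (hF.1 _ hm).symm
        · simp only [hH, and_true]
          exact ⟨fun h => by rw [h, add_tsub_cancel_right], fun h => by rw [← h, e]⟩
      · rw [Finset.sum_eq_zero fun μ _ => if_neg fun h => hH h.2]
        push Not at hH
        rw [pd_eq_zero, Derivation.zero_apply]
        · rw [← isPos_add_dirExp (C := C) (C' := C'), e]
          exact hH.1
        · rw [← isNeg_add_dirExp (C := C) (C' := C'), e]
          exact hH.2
    · rw [if_neg hle]
      refine Finset.sum_eq_zero fun μ _ => if_neg fun h => hle ?_
      rw [h.1]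
      exact le_add_self

theorem totalD_coordFn (hn : 1 ≤ n) (C C' : Fin 2) (μ : JetExp) :
    totalD hn C C' (coordFn n μ) = coordFn n (μ + dirExp C C') := by
  obtain ⟨B, hB⟩ := exists_orderLE hn (coordFn n μ)
  rw [totalD_eq hn C C' (hB _ (le_max_left B (∑ v, μ v)))]
  simp only [pd_coordFn hn, ite_mul, one_mul, zero_mul]
  by_cases hH : μ.IsPos n ∨ μ.IsNeg n
  · rw [Finset.sum_congr rfl fun ν _ => if_congr (Q := μ = ν) ?_ rfl rfl, Finset.sum_ite_eq,
      if_pos]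
    · rw [mem_boxExp]
      intro v
      exact (Finset.single_le_sum (f := fun v => μ v) (fun _ _ => Nat.zero_le _)
        (Finset.mem_univ v)).trans (le_max_right _ _)
    · exact ⟨fun h => h.1.symm, fun h => by rw [← h]; exact ⟨rfl, hH⟩⟩
  · rw [Finset.sum_eq_zero fun ν _ => if_neg fun h => hH (by rw [← h.1]; exact h.2)]
    push Not at hH
    refine Subtype.ext (funext fun j => ?_)
    rw [coordFn_apply, jetCoord_eq_zero]
    · rfl
    · rw [isPos_add_dirExp]; exact hH.1
    · rw [isNeg_add_dirExp]; exact hH.2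

/-- The double derivative consists of a term with second partial derivatives, which commute, and a
term ∂_μF φ_{μ+e+e'}, symmetric in the two shifts. -/
theorem totalD_comm (hn : 1 ≤ n) (C C' E E' : Fin 2) (F : localFn n) :
    totalD hn C C' (totalD hn E E' F) = totalD hn E E' (totalD hn C C' F) := by
  obtain ⟨B₀, hB₀⟩ := exists_orderLE hn F
  have hF := hB₀ B₀ le_rfl
  have key : ∀ C C' E E', totalD hn C C' (totalD hn E E' F) =
      (∑ μ ∈ boxExp B₀, totalD hn C C' (pd n μ F) * coordFn n (μ + dirExp E E')) +
      ∑ μ ∈ boxExp B₀, pd n μ F * coordFn n (μ + dirExp E E' + dirExp C C') := by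
    intro C C' E E'
    rw [totalD_eq hn E E' hF, map_sum, ← Finset.sum_add_distrib]
    refine Finset.sum_congr rfl fun μ _ => ?_
    rw [Derivation.leibniz, totalD_coordFn]
    simp only [smul_eq_mul]
    ring
  have key2 : ∀ C C' E E',
      ∑ μ ∈ boxExp B₀, totalD hn C C' (pd n μ F) * coordFn n (μ + dirExp E E') =
      ∑ μ ∈ boxExp B₀, ∑ ν ∈ boxExp B₀,
        pd n ν (pd n μ F) * coordFn n (ν + dirExp C C') * coordFn n (μ + dirExp E E') := by
    intro C C' E E'
    refine Finset.sum_congr rfl fun μ _ => ?_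
    have hμ : totalD hn C C' (pd n μ F) =
        ∑ ν ∈ boxExp B₀, pd n ν (pd n μ F) * coordFn n (ν + dirExp C C') := by
      obtain ⟨B₁, hB₁⟩ := exists_orderLE hn (pd n μ F)
      rw [totalD_eq hn C C' (hB₁ _ (le_max_right B₀ B₁))]
      symm
      refine Finset.sum_subset ?_ fun ν _ hν => ?_
      · intro ν hν
        rw [mem_boxExp] at hν ⊢
        exact fun v => (hν v).trans (le_max_left _ _)
      · rw [pd_comm, hF.1 ν hν, map_zero, zero_mul]
    rw [hμ, Finset.sum_mul]
  rw [key C C' E E', key E E' C C', key2, key2, Finset.sum_comm]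
  congr 1
  · refine Finset.sum_congr rfl fun μ _ => Finset.sum_congr rfl fun ν _ => ?_
    rw [pd_comm]
    ring
  · refine Finset.sum_congr rfl fun μ _ => ?_
    rw [add_right_comm]

theorem hasDerivAt_ray (F : localFn n) (j : Jet n) (t : ℝ) :
    HasDerivAt (fun t : ℝ => (F : Jet n → ℂ) (t • j))
      (lineDeriv ℝ (F : Jet n → ℂ) (t • j) j) t := by
  have h3 : HasDerivAt (fun s : ℝ => (F : Jet n → ℂ) (t • j + s • j))
      (lineDeriv ℝ (F : Jet n → ℂ) (t • j) j) (t - t) := by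
    rw [sub_self]
    exact hasLineDerivAt_localFn F (t • j) j
  refine (h3.comp_sub_const t t).congr_of_eventuallyEq (Filter.Eventually.of_forall fun s => ?_)
  simp only
  rw [← add_smul, add_sub_cancel]

end TotalDerivatives

/-! ### Symbols of local functions -/

section Symbols

open MvPolynomial

variable {n m : ℕ}

/-- The exponents of the variables of the `i`-th factor. -/
def part (κ : MomVar m →₀ ℕ) (i : Fin m) : JetExp :=
  Finsupp.equivFunOnFinite.symm fun v => κ (i, v)

@[simp] theorem part_apply (κ : MomVar m →₀ ℕ) (i : Fin m) (v : Bool × Fin 2) :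
    part κ i v = κ (i, v) := rfl

theorem part_add (κ κ' : MomVar m →₀ ℕ) : part (κ + κ') = part κ + part κ' := by
  funext i
  ext v
  rfl

theorem part_momExp (i : Fin m) (C C' : Fin 2) :
    part (momExp i C C') = Pi.single i (dirExp C C') := by
  funext i'
  ext ⟨b, A⟩
  by_cases h : i = i'
  · subst h
    simp [momExp, dirExp, Finsupp.single_apply]
  · rw [Pi.single_eq_of_ne (Ne.symm h)]
    simp [momExp, h]

theorem momExp_le_iff_part (i : Fin m) (C C' : Fin 2) (κ : MomVar m →₀ ℕ) :
    momExp i C C' ≤ κ ↔ dirExp C C' ≤ part κ i := by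
  constructor
  · intro h v
    have := h (i, v)
    have e := congrArg (fun f => f i v) (part_momExp (m := m) i C C')
    simp only [part_apply, Pi.single_eq_same] at e
    rw [part_apply, ← e]
    exact this
  · rintro h ⟨i', v⟩
    have e := congrArg (fun f => f i' v) (part_momExp (m := m) i C C')
    simp only [part_apply] at e
    rw [e]
    by_cases hi : i' = i
    · subst hi
      rw [Pi.single_eq_same]
      exact h v
    · rw [Pi.single_eq_of_ne hi]
      exact Nat.zero_le _

theorem part_sub (κ : MomVar m →₀ ℕ) (i : Fin m) (C C' : Fin 2) :
    part (κ - momExp i C C') = Function.update (part κ) i (part κ i - dirExp C C') := by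
  funext i'
  ext v
  have e := congrArg (fun f => f i' v) (part_momExp (m := m) i C C')
  simp only [part_apply] at e
  rw [part_apply, Finsupp.tsub_apply, e]
  by_cases hi : i' = i
  · subst hi
    rw [Pi.single_eq_same, Function.update_self]
    rfl
  · rw [Pi.single_eq_of_ne hi, Function.update_of_ne hi]
    rfl

/-- Iterated partial derivatives. -/
def iterPd (n : ℕ) : (m : ℕ) → (Fin m → JetExp) → localFn n →ₗ[ℂ] localFn n
  | 0, _ => LinearMap.id
  | m + 1, μ => (pd n (μ 0)).toLinearMap ∘ₗ iterPd n m fun i => μ i.succ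

theorem iterPd_succ (μ : Fin (m + 1) → JetExp) (F : localFn n) :
    iterPd n (m + 1) μ F = pd n (μ 0) (iterPd n m (fun i => μ i.succ) F) := rfl

theorem pd_iterPd (ν : JetExp) (μ : Fin m → JetExp) (F : localFn n) :
    pd n ν (iterPd n m μ F) = iterPd n m μ (pd n ν F) := by
  induction m with
  | zero => rfl
  | succ m ih => rw [iterPd_succ, iterPd_succ, pd_comm, ih]

theorem iterPd_eq_zero (μ : Fin m → JetExp) (i : Fin m) {F : localFn n} (h : pd n (μ i) F = 0) :
    iterPd n m μ F = 0 := by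
  induction m with
  | zero => exact i.elim0
  | succ m ih =>
    rw [iterPd_succ]
    induction i using Fin.cases with
    | zero => rw [pd_iterPd, h, map_zero]
    | succ i => rw [ih _ i h, map_zero]

theorem iterPd_totalD (hn : 1 ≤ n) (C C' : Fin 2) (μ : Fin m → JetExp) (F : localFn n) :
    iterPd n m μ (totalD hn C C' F) = totalD hn C C' (iterPd n m μ F) +
      ∑ i, if dirExp C C' ≤ μ i then
        iterPd n m (Function.update μ i (μ i - dirExp C C')) F else 0 := by
  induction m with
  | zero => simp [iterPd]
  | succ m ih =>
    rw [iterPd_succ, ih, map_add, pd_totalD, Fin.sum_univ_succ, add_assoc, ← iterPd_succ,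
      map_sum]
    congr 2
    refine Finset.sum_congr rfl fun i _ => ?_
    split_ifs
    · rw [iterPd_succ]
      congr 3
      funext k
      by_cases hk : k = i
      · subst hk
        simp
      · simp [Function.update_of_ne, hk]
    · exact map_zero _

theorem finite_support_iterPd (hn : 1 ≤ n) (m : ℕ) (F : localFn n) :
    (fun κ : MomVar m →₀ ℕ => iterPd n m (part κ) F).support.Finite := by
  obtain ⟨B, hB⟩ := exists_orderLE hn F
  have hF := (hB B le_rfl).1
  refine (Set.finite_Iic (Finsupp.equivFunOnFinite.symm fun _ : MomVar m => B)).subset ?_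
  intro κ hκ
  rw [Set.mem_Iic]
  rintro ⟨i, v⟩
  by_contra hlt
  refine hκ (iterPd_eq_zero _ i (hF _ fun h => hlt ?_))
  exact mem_boxExp.mp h v

/-- The polynomial of the `m`-th derivatives of a local function. -/
def symb (hn : 1 ≤ n) (m : ℕ) (F : localFn n) : MvPolynomial (MomVar m) (localFn n) :=
  (exists_coeff_eq _ (finite_support_iterPd hn m F)).choose

theorem coeff_symb (hn : 1 ≤ n) (F : localFn n) (κ : MomVar m →₀ ℕ) :
    (symb hn m F).coeff κ = iterPd n m (part κ) F :=
  (exists_coeff_eq _ (finite_support_iterPd hn m F)).choose_spec κ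

/-- The total derivatives, as additive maps. -/
def totalDHom (hn : 1 ≤ n) (C C' : Fin 2) : localFn n →+ localFn n :=
  (totalD hn C C' : localFn n →ₗ[ℂ] localFn n).toAddMonoidHom

@[simp] theorem totalDHom_apply (hn : 1 ≤ n) (C C' : Fin 2) (F : localFn n) :
    totalDHom hn C C' F = totalD hn C C' F := rfl

theorem coeff_totalMom_mul {A : Type*} [CommRing A] (C C' : Fin 2) (f : MvPolynomial (MomVar m) A)
    (κ : MomVar m →₀ ℕ) : (totalMom A m C C' * f).coeff κ =
      ∑ i, if dirExp C C' ≤ part κ i then f.coeff (κ - momExp i C C') else 0 := by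
  simp only [totalMom, Finset.sum_mul, coeff_sum, coeff_monomial_mul', one_mul,
    momExp_le_iff_part]

/-- The commutator of `pd` and `totalD`, applied once for each of the m derivatives: lowering the
i-th label is multiplication by the momentum of the i-th factor. -/
theorem symb_totalD (hn : 1 ≤ n) (C C' : Fin 2) (F : localFn n) :
    symb hn m (totalD hn C C' F) = nabla (totalDHom hn) C C' (symb hn m F) := by
  ext κ : 1
  rw [nabla_apply, coeff_add, coeff_coeffMap, coeff_symb, coeff_symb, iterPd_totalD,
    totalDHom_apply, coeff_totalMom_mul]
  simp only [coeff_symb, part_sub]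

theorem symb_sub (hn : 1 ≤ n) (F G : localFn n) :
    symb hn m (F - G) = symb hn m F - symb hn m G := by
  ext κ : 1
  rw [coeff_sub, coeff_symb, coeff_symb, coeff_symb, map_sub]

theorem symb_zero (hn : 1 ≤ n) : symb hn m (0 : localFn n) = 0 := by
  ext κ : 1
  rw [coeff_symb, map_zero, coeff_zero]

theorem symb_sum (hn : 1 ≤ n) {ι : Type*} (s : Finset ι) (F : ι → localFn n) :
    symb hn m (∑ i ∈ s, F i) = ∑ i ∈ s, symb hn m (F i) := by
  ext κ : 1
  rw [coeff_sum, coeff_symb, map_sum]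
  exact Finset.sum_congr rfl fun i _ => (coeff_symb hn _ κ).symm

/-- The local function with a given symbol: the variables of the factors are replaced by jet
coordinates. -/
def realize (n m : ℕ) : MvPolynomial (MomVar m) (localFn n) →ₗ[localFn n] localFn n :=
  (basisMonomials (MomVar m) (localFn n)).constr (localFn n) fun κ => ∏ i, coordFn n (part κ i)

theorem realize_monomial (κ : MomVar m →₀ ℕ) (a : localFn n) :
    realize n m (monomial κ a) = a * ∏ i, coordFn n (part κ i) := by
  have h : monomial κ a = a • basisMonomials (MomVar m) (localFn n) κ := by
    rw [coe_basisMonomials, smul_monomial, smul_eq_mul, mul_one]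
  rw [h, map_smul, realize, Module.Basis.constr_basis, smul_eq_mul]

theorem totalD_prod (hn : 1 ≤ n) (C C' : Fin 2) (μ : Fin m → JetExp) :
    totalD hn C C' (∏ i, coordFn n (μ i)) = 
      ∑ i : Fin m, ∏ i' : Fin m,
        coordFn n ((μ + Pi.single i (dirExp C C') : Fin m → JetExp) i') := by
  induction m with
  | zero => simp
  | succ m ih =>
    rw [Fin.prod_univ_succ, Derivation.leibniz, ih, totalD_coordFn, Fin.sum_univ_succ, add_comm]
    simp only [Fin.prod_univ_succ, smul_eq_mul]
    congr 1
    · rw [mul_comm]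
      simp
    · rw [Finset.mul_sum]
      refine Finset.sum_congr rfl fun i _ => ?_
      refine congrArg₂ (· * ·) (by simp) ?_
      · refine Finset.prod_congr rfl fun k _ => ?_
        by_cases hk : k = i
        · subst hk
          simp
        · simp [hk]

/-- Leibniz' rule: differentiating the i-th coordinate of a product multiplies by the i-th momentum.
Potentials found for symbols thereby become potentials for local functions. -/
theorem totalD_realize (hn : 1 ≤ n) (C C' : Fin 2) (f : MvPolynomial (MomVar m) (localFn n)) :
    totalD hn C C' (realize n m f) = realize n m (nabla (totalDHom hn) C C' f) := by
  induction f using MvPolynomial.induction_on' with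
  | monomial κ a =>
    have h1 : coeffMap (totalDHom hn C C') (monomial κ a) = monomial κ (totalD hn C C' a) := by
      ext κ' : 1
      rw [coeff_coeffMap, coeff_monomial, coeff_monomial]
      split_ifs
      · rfl
      · exact map_zero _
    rw [nabla_apply, h1, map_add, realize_monomial, realize_monomial, Derivation.leibniz,
      totalD_prod, totalMom, Finset.sum_mul, map_sum, smul_eq_mul, smul_eq_mul, add_comm,
      mul_comm (totalD hn C C' a), Finset.mul_sum]
    congr 1
    refine Finset.sum_congr rfl fun i _ => ?_
    rw [monomial_mul, one_mul, realize_monomial, part_add, part_momExp, add_comm]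
  | add f g hf hg => rw [map_add, map_add, map_add, map_add, hf, hg]

/-- Evaluation at the zero jet. -/
def evalZero (n : ℕ) : localFn n →ₐ[ℂ] ℂ where
  toFun F := (F : Jet n → ℂ) 0
  map_one' := rfl
  map_mul' _ _ := rfl
  map_zero' := rfl
  map_add' _ _ := rfl
  commutes' _ := rfl

theorem evalZero_apply (F : localFn n) : evalZero n F = (F : Jet n → ℂ) 0 := rfl

/-- Every term of D F contains a jet coordinate. At the zero jet only multiplication by the total
momentum is left of `nabla`, so the linear and quadratic parts become pure polynomial algebra. -/
theorem evalZero_totalD (hn : 1 ≤ n) (C C' : Fin 2) (F : localFn n) :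
    evalZero n (totalD hn C C' F) = 0 := by
  obtain ⟨B, hB⟩ := exists_orderLE hn F
  rw [totalD_eq hn C C' (hB B le_rfl), map_sum]
  refine Finset.sum_eq_zero fun μ _ => ?_
  rw [map_mul, evalZero_apply (coordFn _ _), coordFn_apply, jetCoord_zero, mul_zero]

/-- The symbol at the zero jet. -/
def symbZero (hn : 1 ≤ n) (m : ℕ) (F : localFn n) : MvPolynomial (MomVar m) ℂ :=
  map (evalZero n : localFn n →+* ℂ) (symb hn m F)

theorem coeff_symbZero (hn : 1 ≤ n) (F : localFn n) (κ : MomVar m →₀ ℕ) :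
    (symbZero hn m F).coeff κ = evalZero n (iterPd n m (part κ) F) := by
  rw [symbZero, coeff_map, coeff_symb]
  rfl

theorem symbZero_totalD (hn : 1 ≤ n) (C C' : Fin 2) (F : localFn n) :
    symbZero hn m (totalD hn C C' F) = totalMom ℂ m C C' * symbZero hn m F := by
  ext κ : 1
  rw [coeff_symbZero, iterPd_totalD, map_add, evalZero_totalD, zero_add, map_sum,
    coeff_totalMom_mul]
  refine Finset.sum_congr rfl fun i _ => ?_
  split_ifs
  · rw [coeff_symbZero, part_sub]
  · exact map_zero _

theorem symbZero_zero (hn : 1 ≤ n) : symbZero hn m (0 : localFn n) = 0 := by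
  rw [symbZero, symb_zero, map_zero]

theorem symbZero_sub (hn : 1 ≤ n) (F G : localFn n) :
    symbZero hn m (F - G) = symbZero hn m F - symbZero hn m G := by
  rw [symbZero, symb_sub, map_sub, symbZero, symbZero]

theorem symbZero_sum (hn : 1 ≤ n) {ι : Type*} (s : Finset ι) (F : ι → localFn n) :
    symbZero hn m (∑ i ∈ s, F i) = ∑ i ∈ s, symbZero hn m (F i) := by
  rw [symbZero, symb_sum, map_sum]
  rfl

/-- The constant coefficient differential polynomial with a given symbol. -/
def realizeC (n m : ℕ) : MvPolynomial (MomVar m) ℂ →ₗ[ℂ] localFn n where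
  toFun P := realize n m (map (algebraMap ℂ (localFn n)) P)
  map_add' P Q := by rw [map_add, map_add]
  map_smul' c P := by
    rw [smul_eq_C_mul, map_mul, map_C, ← smul_eq_C_mul, map_smul, RingHom.id_apply,
      algebraMap_smul]

theorem realizeC_monomial (κ : MomVar m →₀ ℕ) (a : ℂ) :
    realizeC n m (monomial κ a) = a • ∏ i, coordFn n (part κ i) := by
  change realize n m (map (algebraMap ℂ (localFn n)) (monomial κ a)) = _
  rw [map_monomial, realize_monomial, Algebra.smul_def]

theorem totalD_realizeC (hn : 1 ≤ n) (C C' : Fin 2) (P : MvPolynomial (MomVar m) ℂ) :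
    totalD hn C C' (realizeC n m P) = realizeC n m (totalMom ℂ m C C' * P) := by
  induction P using MvPolynomial.induction_on' with
  | monomial κ a =>
    rw [realizeC_monomial, Derivation.map_smul, totalD_prod, totalMom, Finset.sum_mul, map_sum,
      Finset.smul_sum]
    refine Finset.sum_congr rfl fun i _ => ?_
    rw [monomial_mul, one_mul, realizeC_monomial, part_add, part_momExp, add_comm]
  | add f g hf hg => rw [map_add, map_add, hf, hg, mul_add, map_add]

end Symbols

/-! ### Means along rays and the Taylor formula -/

section RayMeans

variable {E : Type} [NormedAddCommGroup E] [NormedSpace ℝ E] [FiniteDimensional ℝ E]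

theorem hasFDerivAt_rayIntegral {F : Type} [NormedAddCommGroup F] [NormedSpace ℝ F]
    {f : E → F} (hf : ContDiff ℝ 1 f) {w : ℝ → ℝ} (hw : Continuous w) (y : E) :
    HasFDerivAt (fun y => ∫ t in (0 : ℝ)..1, w t • f (t • y))
      (∫ t in (0 : ℝ)..1, (t * w t) • fderiv ℝ f (t • y)) y := by
  have hf' : Continuous (fderiv ℝ f) := hf.continuous_fderiv (by simp)
  have hc : Continuous fun z : ℝ × E => (z.1 * w z.1) • fderiv ℝ f (z.1 • z.2) := by fun_prop
  obtain ⟨b, hb⟩ := ((isCompact_Icc (a := (0 : ℝ)) (b := 1)).prod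
    (isCompact_closedBall y 1)).exists_bound_of_continuousOn hc.continuousOn
  have hcf := hf.continuous
  refine intervalIntegral.hasFDerivAt_integral_of_dominated_of_fderiv_le (𝕜 := ℝ)
    (F := fun y t => w t • f (t • y)) (F' := fun y t => (t * w t) • fderiv ℝ f (t • y))
    (bound := fun _ => b) (Metric.closedBall_mem_nhds y one_pos) ?_ ?_ ?_ ?_ ?_ ?_
  · refine Filter.Eventually.of_forall fun z => Continuous.aestronglyMeasurable ?_
    fun_prop
  · exact Continuous.intervalIntegrable (by fun_prop) _ _
  · exact Continuous.aestronglyMeasurable (by fun_prop)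
  · refine Filter.Eventually.of_forall fun t ht z hz => ?_
    rw [Set.uIoc_of_le zero_le_one] at ht
    exact hb (t, z) ⟨⟨ht.1.le, ht.2⟩, hz⟩
  · exact continuous_const.intervalIntegrable _ _
  · refine Filter.Eventually.of_forall fun t _ z _ => ?_
    have h1 : HasFDerivAt (fun x : E => t • x) (t • ContinuousLinearMap.id ℝ E) z :=
      (hasFDerivAt_id z).const_smul t
    have h2 := ((hf.differentiable (by simp) (t • z)).hasFDerivAt.comp z h1).const_smul (w t)
    refine h2.congr_fderiv ?_
    ext v
    simp [smul_smul, mul_comm]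

/-- The derivative of a ray integral is the ray integral of the derivative with weight t w(t). The
induction therefore has to range over all weights and all target spaces. -/
theorem contDiff_rayIntegral_nat (N : ℕ) : ∀ {F : Type} [NormedAddCommGroup F] [NormedSpace ℝ F]
    {f : E → F} (_ : ContDiff ℝ ∞ f) {w : ℝ → ℝ} (_ : Continuous w),
    ContDiff ℝ N fun y => ∫ t in (0 : ℝ)..1, w t • f (t • y) := by
  induction N with
  | zero =>
    intro F _ _ f hf w hw
    have hcf := hf.continuous
    rw [Nat.cast_zero, contDiff_zero]
    refine intervalIntegral.continuous_parametric_intervalIntegral_of_continuous' ?_ _ _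
    simp only [Function.uncurry_def]
    fun_prop
  | succ N ih =>
    intro F _ _ f hf w hw
    rw [Nat.cast_add, Nat.cast_one, contDiff_succ_iff_hasFDerivAt]
    refine ⟨_, ?_, fun y => hasFDerivAt_rayIntegral (hf.of_le (by simp)) hw y⟩
    exact ih (hf.fderiv_right (m := ∞) (by simp)) (by fun_prop)

theorem contDiff_rayIntegral {F : Type} [NormedAddCommGroup F] [NormedSpace ℝ F]
    {f : E → F} (hf : ContDiff ℝ ∞ f) {w : ℝ → ℝ} (hw : Continuous w) :
    ContDiff ℝ ∞ fun y => ∫ t in (0 : ℝ)..1, w t • f (t • y) :=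
  contDiff_infty.mpr fun N => contDiff_rayIntegral_nat N hf hw

variable {n : ℕ}

theorem Represents.rayMean {r : ℕ} {f : JetUpTo n r → ℂ} {F : Jet n → ℂ} (hf : Represents f F)
    {w : ℝ → ℝ} (hw : Continuous w) :
    Represents (fun y => ∫ t in (0 : ℝ)..1, w t • f (t • y))
      (fun j => ∫ t in (0 : ℝ)..1, w t • F (t • j)) :=
  ⟨contDiff_rayIntegral hf.1 hw, fun j => by simp only [hf.2, map_smul]⟩

theorem continuous_ray (F : localFn n) (j : Jet n) :
    Continuous fun t : ℝ => (F : Jet n → ℂ) (t • j) :=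
  continuous_iff_continuousAt.mpr fun t => (hasDerivAt_ray F j t).continuousAt

theorem continuous_smul_ray (w : C(ℝ, ℝ)) (F : localFn n) (j : Jet n) :
    Continuous fun t : ℝ => w t • (F : Jet n → ℂ) (t • j) :=
  w.continuous.smul (continuous_ray F j)

/-- The weighted mean `j ↦ ∫₀¹ w(t) F(t j) dt` of a local function. -/
def rayMean (w : C(ℝ, ℝ)) : localFn n →ₗ[ℂ] localFn n where
  toFun F := ⟨fun j => ∫ t in (0 : ℝ)..1, w t • (F : Jet n → ℂ) (t • j), by
    obtain ⟨r, f, hf⟩ := F.2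
    exact ⟨r, _, hf.rayMean w.continuous⟩⟩
  map_add' F G := Subtype.ext <| funext fun j => by
    change ∫ t in (0 : ℝ)..1, w t • ((F : Jet n → ℂ) (t • j) + (G : Jet n → ℂ) (t • j)) =
      (∫ t in (0 : ℝ)..1, w t • (F : Jet n → ℂ) (t • j)) +
        ∫ t in (0 : ℝ)..1, w t • (G : Jet n → ℂ) (t • j)
    simp only [smul_add]
    exact intervalIntegral.integral_add ((continuous_smul_ray w F j).intervalIntegrable _ _)
      ((continuous_smul_ray w G j).intervalIntegrable _ _)
  map_smul' c F := Subtype.ext <| funext fun j => by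
    change ∫ t in (0 : ℝ)..1, w t • (c • (F : Jet n → ℂ) (t • j)) =
      c • ∫ t in (0 : ℝ)..1, w t • (F : Jet n → ℂ) (t • j)
    rw [← intervalIntegral.integral_smul]
    simp only [smul_comm c]

theorem rayMean_apply (w : C(ℝ, ℝ)) (F : localFn n) (j : Jet n) :
    (rayMean w F : Jet n → ℂ) j = ∫ t in (0 : ℝ)..1, w t • (F : Jet n → ℂ) (t • j) := rfl

theorem dirDeriv_rayMean (w : C(ℝ, ℝ)) (k : Jet n) (F : localFn n) :
    dirDeriv k (rayMean w F) = rayMean (ContinuousMap.id ℝ * w) (dirDeriv k F) := by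
  obtain ⟨r, f, hf⟩ := F.2
  refine Subtype.ext (funext fun j => ?_)
  rw [rayMean_apply, dirDeriv_apply]
  have h1 : ((rayMean w F : localFn n) : Jet n → ℂ) =
    fun j => ∫ t in (0 : ℝ)..1, w t • (F : Jet n → ℂ) (t • j) := rfl
  have hf' : Continuous (fderiv ℝ f) := hf.1.continuous_fderiv (by simp)
  rw [h1, (hf.rayMean w.continuous).lineDeriv,
    (hasFDerivAt_rayIntegral (hf.1.of_le (by simp)) w.continuous _).fderiv,
    ContinuousLinearMap.intervalIntegral_apply (Continuous.intervalIntegrable (by fun_prop) _ _)]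
  refine intervalIntegral.integral_congr fun t _ => ?_
  simp only [dirDeriv_apply, hf.lineDeriv, map_smul]
  rfl

theorem pd_rayMean (w : C(ℝ, ℝ)) (μ : JetExp) (F : localFn n) :
    pd n μ (rayMean w F) = rayMean (ContinuousMap.id ℝ * w) (pd n μ F) := by
  obtain ⟨k, l, a, b, h1⟩ := exists_pd_eq (n := n) μ
  simp only [h1, Derivation.add_apply, Derivation.smul_apply, dirDeriv_rayMean, map_add, map_smul]

theorem rayMean_mul_coordFn (w : C(ℝ, ℝ)) (μ : JetExp) (F : localFn n) :
    rayMean w (F * coordFn n μ) = rayMean (ContinuousMap.id ℝ * w) F * coordFn n μ := by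
  refine Subtype.ext (funext fun j => ?_)
  change ∫ t in (0 : ℝ)..1, w t • ((F : Jet n → ℂ) (t • j) * jetCoord (t • j) μ) =
    (∫ t in (0 : ℝ)..1, (t * w t) • (F : Jet n → ℂ) (t • j)) * jetCoord j μ
  rw [← intervalIntegral.integral_mul_const]
  refine intervalIntegral.integral_congr fun t _ => ?_
  simp only [jetCoord_real_smul, Complex.real_smul, Complex.ofReal_mul]
  ring

/-- The total derivative commutes with rescaling of the jet: the factor t gained by differentiating
under the integral is the one needed to bring a jet coordinate back inside. -/
theorem totalD_rayMean (hn : 1 ≤ n) (w : C(ℝ, ℝ)) (C C' : Fin 2) (F : localFn n) :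
    totalD hn C C' (rayMean w F) = rayMean w (totalD hn C C' F) := by
  obtain ⟨B, hB⟩ := exists_orderLE_list hn [F, rayMean w F]
  rw [totalD_eq hn C C' (hB F (by simp)), totalD_eq hn C C' (hB _ (by simp)), map_sum]
  exact Finset.sum_congr rfl fun μ _ => by rw [pd_rayMean, rayMean_mul_coordFn]

theorem OrderLE.pd (hn : 1 ≤ n) {F : localFn n} {B : ℕ} (hF : OrderLE F B) (ν : JetExp) :
    OrderLE (MasslessSpin.pd n ν F) B := by
  have h0 : ∀ μ ∉ boxExp B, MasslessSpin.pd n μ (MasslessSpin.pd n ν F) = 0 := fun μ hμ => by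
    rw [pd_comm, hF.1 μ hμ, map_zero]
  refine ⟨h0, fun j k => ?_⟩
  obtain ⟨B₁, hB₁⟩ := exists_orderLE hn (MasslessSpin.pd n ν F)
  rw [(hB₁ _ (le_max_right B B₁)).2]
  symm
  refine Finset.sum_subset ?_ fun μ _ hμ => ?_
  · intro μ hμ
    rw [mem_boxExp] at hμ ⊢
    exact fun v => (hμ v).trans (le_max_left _ _)
  · rw [h0 μ hμ]
    exact zero_mul _

theorem OrderLE.iterPd (hn : 1 ≤ n) {F : localFn n} {B : ℕ} (hF : OrderLE F B) {m : ℕ}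
    (μ : Fin m → JetExp) : OrderLE (iterPd n m μ F) B := by
  induction m with
  | zero => exact hF
  | succ m ih => exact (ih fun i => μ i.succ).pd hn (μ 0)

/-- Integration by parts along rays. -/
theorem smul_sub_eq_rayMean {F : localFn n} {B : ℕ} (hF : OrderLE F B) {w w' : C(ℝ, ℝ)}
    (hw : ∀ t, HasDerivAt w (w' t) t) :
    (w 1 : ℂ) • F - algebraMap ℂ (localFn n) (w 0 * evalZero n F) =
      rayMean w' F + ∑ μ ∈ boxExp B, rayMean w (pd n μ F) * coordFn n μ := by
  refine Subtype.ext (funext fun j => ?_)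
  have hc := continuous_smul_ray w' F j
  have hcd : ∀ μ, Continuous fun t : ℝ =>
      w t • (pd n μ F : Jet n → ℂ) (t • j) * jetCoord j μ := fun μ =>
    (continuous_smul_ray w (pd n μ F) j).mul continuous_const
  have hcs : Continuous fun t : ℝ => ∑ μ ∈ boxExp B,
      w t • (pd n μ F : Jet n → ℂ) (t • j) * jetCoord j μ :=
    continuous_finsetSum _ fun μ _ => hcd μ
  have h1 : ∀ t, HasDerivAt (fun t => w t • (F : Jet n → ℂ) (t • j))
      (w' t • (F : Jet n → ℂ) (t • j) +
        ∑ μ ∈ boxExp B, w t • (pd n μ F : Jet n → ℂ) (t • j) * jetCoord j μ) t := by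
    intro t
    have h2 := (hw t).smul (hasDerivAt_ray F j t)
    rw [hF.2, Finset.smul_sum, add_comm] at h2
    simp only [smul_mul_assoc]
    exact h2
  have h2 := intervalIntegral.integral_eq_sub_of_hasDerivAt (a := 0) (b := 1)
    (fun t _ => h1 t) ((hc.add hcs).intervalIntegrable _ _)
  rw [intervalIntegral.integral_add (hc.intervalIntegrable _ _) (hcs.intervalIntegrable _ _),
    intervalIntegral.integral_finsetSum (fun μ _ => (hcd μ).intervalIntegrable _ _)] at h2
  simp only [intervalIntegral.integral_mul_const, one_smul, zero_smul] at h2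
  change (w 1 : ℂ) * (F : Jet n → ℂ) j - w 0 * (F : Jet n → ℂ) 0 = (rayMean w' F : Jet n → ℂ) j +
    ((∑ μ ∈ boxExp B, rayMean w (pd n μ F) * coordFn n μ : localFn n) : Jet n → ℂ) j
  rw [coe_finset_sum]
  simp only [← Complex.real_smul]
  exact h2.symm

end RayMeans

/-! ### Taylor's formula in terms of symbols -/

section Taylor

open MvPolynomial

variable {n m : ℕ}

/-- The exponent with given parts. -/
def glue (μ : Fin m → JetExp) : MomVar m →₀ ℕ :=
  Finsupp.equivFunOnFinite.symm fun v => μ v.1 v.2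

@[simp] theorem part_glue (μ : Fin m → JetExp) : part (glue μ) = μ := by
  funext i
  ext v
  rfl

theorem glue_part (κ : MomVar m →₀ ℕ) : glue (part κ) = κ := by
  ext v
  rfl

theorem sum_support_eq {A : Type*} [CommRing A] {B : ℕ} {f : MvPolynomial (MomVar m) A}
    (hf : ∀ κ, f.coeff κ ≠ 0 → ∀ i, part κ i ∈ boxExp B) (M : (MomVar m →₀ ℕ) → A) :
    ∑ κ ∈ f.support, f.coeff κ * M κ = ∑ μ : Fin m → boxExp B,
      f.coeff (glue fun i => (μ i : JetExp)) * M (glue fun i => (μ i : JetExp)) := by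
  classical
  have hinj : Function.Injective fun μ : Fin m → boxExp B => glue fun i => (μ i : JetExp) := by
    intro μ μ' h
    have h2 := congrArg part h
    simp only [part_glue] at h2
    exact funext fun i => Subtype.ext (congrFun h2 i)
  rw [← Finset.sum_image (s := Finset.univ) (f := fun κ => f.coeff κ * M κ) hinj.injOn]
  refine Finset.sum_subset (fun κ hκ => ?_) fun κ _ hκ => ?_
  · rw [Finset.mem_image]
    exact ⟨fun i => ⟨part κ i, hf κ (mem_support_iff.mp hκ) i⟩, Finset.mem_univ _, glue_part κ⟩
  · rw [notMem_support_iff.mp hκ, zero_mul]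

theorem realize_eq_sum {B : ℕ} {f : MvPolynomial (MomVar m) (localFn n)}
    (hf : ∀ κ, f.coeff κ ≠ 0 → ∀ i, part κ i ∈ boxExp B) :
    realize n m f = ∑ μ : Fin m → boxExp B,
      f.coeff (glue fun i => (μ i : JetExp)) * ∏ i, coordFn n (μ i) := by
  have h1 : realize n m f = ∑ κ ∈ f.support, f.coeff κ * ∏ i, coordFn n (part κ i) := by
    conv_lhs => rw [f.as_sum]
    rw [map_sum]
    exact Finset.sum_congr rfl fun κ _ => realize_monomial κ _
  rw [h1, sum_support_eq hf]
  simp only [part_glue]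

/-- The sum `∑ L(∂_{μ₁} ⋯ ∂_{μ_m} F) φ_{μ₁} ⋯ φ_{μ_m}`. -/
def taylorSum (B m : ℕ) (L : localFn n →+ localFn n) (F : localFn n) : localFn n :=
  ∑ μ : Fin m → boxExp B, L (iterPd n m (fun i => μ i) F) * ∏ i, coordFn n (μ i)

/-- Writes the Taylor terms through symbols. The value at zero as L gives the Taylor polynomial, and
a ray mean gives the integral remainder. -/
theorem realize_coeffMap_symb (hn : 1 ≤ n) {B : ℕ} {F : localFn n} (hF : OrderLE F B)
    (L : localFn n →+ localFn n) :
    realize n m (coeffMap L (symb hn m F)) = taylorSum B m L F := by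
  rw [realize_eq_sum (B := B), taylorSum]
  · simp only [coeff_coeffMap, coeff_symb, part_glue]
  · intro κ hκ i
    by_contra h
    rw [coeff_coeffMap, coeff_symb, iterPd_eq_zero _ i (hF.1 _ h), map_zero] at hκ
    exact hκ rfl

theorem taylorSum_succ (B m : ℕ) (L : localFn n →+ localFn n) (F : localFn n) :
    taylorSum B (m + 1) L F = ∑ μ : Fin m → boxExp B,
      (∑ ν ∈ boxExp B, L (pd n ν (iterPd n m (fun i => μ i) F)) * coordFn n ν) *
        ∏ i, coordFn n (μ i) := by
  rw [taylorSum, ← (Fin.consEquiv fun _ : Fin (m + 1) => (boxExp B : Type)).sum_comp,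
    Fintype.sum_prod_type, Finset.sum_comm]
  refine Finset.sum_congr rfl fun μ _ => ?_
  rw [Finset.sum_mul]
  refine Eq.trans ?_ (Finset.sum_coe_sort (boxExp B) fun ν =>
    L (pd n ν (iterPd n m (fun i => μ i) F)) * coordFn n ν * ∏ i, coordFn n (μ i))
  refine Finset.sum_congr rfl fun ν _ => ?_
  rw [Fin.prod_univ_succ, iterPd_succ, ← mul_assoc]
  rfl

/-- The value at the zero jet, as a constant function. -/
def constZero (n : ℕ) : localFn n →+ localFn n :=
  ((Algebra.ofId ℂ (localFn n)).comp (evalZero n) : localFn n →+* localFn n).toAddMonoidHom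

theorem constZero_apply (F : localFn n) :
    constZero n F = algebraMap ℂ (localFn n) (evalZero n F) := rfl

theorem realize_constZero (hn : 1 ≤ n) (F : localFn n) :
    realize n m (coeffMap (constZero n) (symb hn m F)) = realizeC n m (symbZero hn m F) := by
  change _ = realize n m (map _ _)
  congr 1
  ext κ : 1
  rw [coeff_coeffMap, coeff_map, symbZero, coeff_map]
  rfl

/-- The weight `(1 - t)^k / k!` of the remainder in Taylor's formula. -/
def taylorWeight (k : ℕ) : C(ℝ, ℝ) := ⟨fun t => (1 - t) ^ k / (k ! : ℝ), by fun_prop⟩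

theorem taylorWeight_apply (k : ℕ) (t : ℝ) : taylorWeight k t = (1 - t) ^ k / (k ! : ℝ) := rfl

theorem hasDerivAt_taylorWeight (k : ℕ) (t : ℝ) :
    HasDerivAt (taylorWeight (k + 1)) ((-taylorWeight k) t) t := by
  have h1 : HasDerivAt (fun t : ℝ => (1 - t) ^ (k + 1) / ((k + 1)! : ℝ))
      ((((k + 1 : ℕ) : ℝ) * (1 - t) ^ k * (-1)) / ((k + 1)! : ℝ)) t := by
    have := ((hasDerivAt_id t).const_sub 1).pow (k + 1)
    simpa using this.div_const ((k + 1)! : ℝ)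
  refine h1.congr_deriv ?_
  rw [ContinuousMap.neg_apply, taylorWeight_apply, Nat.factorial_succ]
  have h2 : ((k : ℝ) + 1) ≠ 0 := by positivity
  have h3 : (k ! : ℝ) ≠ 0 := by positivity
  push_cast
  field_simp

theorem rayMean_taylorWeight {F : localFn n} {B : ℕ} (hF : OrderLE F B) (k : ℕ) :
    rayMean (taylorWeight k) F = algebraMap ℂ (localFn n) (((k + 1)! : ℂ)⁻¹ * evalZero n F) +
      ∑ μ ∈ boxExp B, rayMean (taylorWeight (k + 1)) (pd n μ F) * coordFn n μ := by
  have h := smul_sub_eq_rayMean hF (hasDerivAt_taylorWeight k)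
  have h1 : rayMean (-taylorWeight k) F = -rayMean (taylorWeight k) F := by
    refine Subtype.ext (funext fun j => ?_)
    change ∫ t in (0 : ℝ)..1, (-taylorWeight k t) • (F : Jet n → ℂ) (t • j) =
      -∫ t in (0 : ℝ)..1, taylorWeight k t • (F : Jet n → ℂ) (t • j)
    simp only [neg_smul, intervalIntegral.integral_neg]
  have e1 : ((taylorWeight (k + 1) 1 : ℝ) : ℂ) = 0 := by simp [taylorWeight_apply]
  have e0 : ((taylorWeight (k + 1) 0 : ℝ) : ℂ) = ((k + 1)! : ℂ)⁻¹ := by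
    simp [taylorWeight_apply]
  rw [h1, e1, e0, zero_smul, zero_sub] at h
  rw [← sub_eq_zero, ← sub_eq_zero.mpr h]
  abel

/-- One step of Taylor's formula, by integration by parts in each coefficient. The factor 1/(k+1)!
is the value at t = 0 of the next weight, which vanishes at t = 1. -/
theorem taylorSum_taylorWeight (hn : 1 ≤ n) {F : localFn n} {B : ℕ} (hF : OrderLE F B) (m k : ℕ) :
    taylorSum B m (rayMean (taylorWeight k) : localFn n →ₗ[ℂ] localFn n).toAddMonoidHom F =
      ((k + 1)! : ℂ)⁻¹ • taylorSum B m (constZero n) F +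
      taylorSum B (m + 1) (rayMean (taylorWeight (k + 1)) :
        localFn n →ₗ[ℂ] localFn n).toAddMonoidHom F := by
  rw [taylorSum_succ, taylorSum, taylorSum, Finset.smul_sum, ← Finset.sum_add_distrib]
  refine Finset.sum_congr rfl fun μ _ => ?_
  simp only [LinearMap.toAddMonoidHom_coe]
  rw [rayMean_taylorWeight (hF.iterPd hn _), add_mul, constZero_apply, map_mul,
    ← Algebra.smul_def, smul_mul_assoc]

theorem eq_constZero_add {F : localFn n} {B : ℕ} (hF : OrderLE F B) :
    F = constZero n F +
      taylorSum B 1 (rayMean (taylorWeight 0) : localFn n →ₗ[ℂ] localFn n).toAddMonoidHom F := by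
  have hw : ∀ t, HasDerivAt (taylorWeight 0) ((0 : C(ℝ, ℝ)) t) t := fun t => by
    have h : (taylorWeight 0 : ℝ → ℝ) = fun _ => 1 := by
      funext t
      simp [taylorWeight_apply]
    rw [h]
    exact hasDerivAt_const t 1
  have h := smul_sub_eq_rayMean hF hw
  have h1 : rayMean (0 : C(ℝ, ℝ)) F = 0 := by
    refine Subtype.ext (funext fun j => ?_)
    rw [rayMean_apply]
    simp
  rw [h1, taylorWeight_apply, taylorWeight_apply] at h
  simp at h
  rw [taylorSum_succ]
  rw [sub_eq_iff_eq_add'] at h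
  refine h.trans ?_
  simp [constZero_apply, iterPd]

/-- Taylor's formula to second order. -/
theorem taylor_two (hn : 1 ≤ n) (F : localFn n) :
    F = algebraMap ℂ (localFn n) (evalZero n F) + realizeC n 1 (symbZero hn 1 F) +
      realize n 2 (coeffMap (rayMean (taylorWeight 1) : localFn n →ₗ[ℂ] localFn n).toAddMonoidHom
        (symb hn 2 F)) := by
  obtain ⟨B, hB⟩ := exists_orderLE hn F
  have hF := hB B le_rfl
  conv_lhs => rw [eq_constZero_add hF, taylorSum_taylorWeight hn hF]
  rw [realize_coeffMap_symb hn hF, ← realize_constZero, realize_coeffMap_symb hn hF,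
    constZero_apply, ← add_assoc]
  simp

/-- Taylor's formula to third order. -/
theorem taylor_three (hn : 1 ≤ n) (F : localFn n) :
    F = algebraMap ℂ (localFn n) (evalZero n F) + realizeC n 1 (symbZero hn 1 F) +
      (2 : ℂ)⁻¹ • realizeC n 2 (symbZero hn 2 F) +
      realize n 3 (coeffMap (rayMean (taylorWeight 2) : localFn n →ₗ[ℂ] localFn n).toAddMonoidHom
        (symb hn 3 F)) := by
  obtain ⟨B, hB⟩ := exists_orderLE hn F
  have hF := hB B le_rfl
  conv_lhs => rw [taylor_two hn F, realize_coeffMap_symb hn hF, taylorSum_taylorWeight hn hF]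
  rw [realize_coeffMap_symb hn hF, ← realize_constZero, ← realize_constZero,
    realize_coeffMap_symb hn hF, realize_coeffMap_symb hn hF, ← add_assoc]
  simp [Nat.factorial]

end Taylor

/-! ### Covariant polynomials of one momentum -/

section Slice

open MvPolynomial

variable {m : ℕ}

/-- The point with coordinates `π_{iA} = o_{iA}`, `π̃_{iA'} = ι_{iA'}`. -/
def momPt (o ι : Fin m → Fin 2 → ℂ) : MomVar m → ℂ := fun v =>
  if v.2.1 then ι v.1 v.2.2 else o v.1 v.2.2

@[simp] theorem momPt_false (o ι : Fin m → Fin 2 → ℂ) (i : Fin m) (A : Fin 2) :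
    momPt o ι (i, false, A) = o i A := rfl

@[simp] theorem momPt_true (o ι : Fin m → Fin 2 → ℂ) (i : Fin m) (A : Fin 2) :
    momPt o ι (i, true, A) = ι i A := rfl

/-- The point of the real slice `π̃ = π̄` with `π = o`. -/
def slicePt (o : Fin m → Fin 2 → ℂ) : MomVar m → ℂ := momPt o fun i A => conj (o i A)

@[simp] theorem slicePt_false (o : Fin m → Fin 2 → ℂ) (i : Fin m) (A : Fin 2) :
    slicePt o (i, false, A) = o i A := rfl

@[simp] theorem slicePt_true (o : Fin m → Fin 2 → ℂ) (i : Fin m) (A : Fin 2) :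
    slicePt o (i, true, A) = conj (o i A) := rfl

/-- A polynomial that vanishes on the real slice is zero. -/
theorem eq_zero_of_slice {P : MvPolynomial (MomVar m) ℂ} (h : ∀ o, eval (slicePt o) P = 0) :
    P = 0 := by
  -- The change of variables π = x + i y, π̃ = x - i y; the real slice corresponds to real x and y.
  let θ : MvPolynomial (MomVar m) ℂ →ₐ[ℂ] MvPolynomial (MomVar m) ℂ := aeval fun v =>
    X (v.1, false, v.2.2) + C (if v.2.1 then -Complex.I else Complex.I) * X (v.1, true, v.2.2)
  have hθ : ∀ (x : MomVar m → ℂ) (Q : MvPolynomial (MomVar m) ℂ), eval x (θ Q) =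
      eval (fun v => x (v.1, false, v.2.2) +
        (if v.2.1 then -Complex.I else Complex.I) * x (v.1, true, v.2.2)) Q := by
    intro x Q
    induction Q using MvPolynomial.induction_on with
    | C a => simp [θ]
    | add p q hp hq => simp only [map_add, hp, hq]
    | mul_X p v hp => rw [map_mul, map_mul, hp, map_mul]; simp [θ]
  have h0 : θ P = 0 := by
    refine funext_set (fun _ => Set.range ((↑) : ℝ → ℂ))
      (fun _ => Set.infinite_range_of_injective Complex.ofReal_injective) fun x hx => ?_
    rw [map_zero, hθ, ← h fun i A => x (i, false, A) + Complex.I * x (i, true, A)]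
    congr 2
    funext v
    obtain ⟨i, b, A⟩ := v
    cases b
    · simp
    · obtain ⟨s, hs⟩ := hx (i, false, A) (Set.mem_univ _)
      obtain ⟨t, ht⟩ := hx (i, true, A) (Set.mem_univ _)
      simp only [slicePt_true, if_true, ← hs, ← ht]
      simp
  refine MvPolynomial.funext fun x => ?_
  have h1 := hθ (momPt (fun i A => (x (i, false, A) + x (i, true, A)) / 2)
    fun i A => (x (i, false, A) - x (i, true, A)) / (2 * Complex.I)) P
  rw [h0, map_zero] at h1
  rw [map_zero, h1]
  congr 2
  funext v
  obtain ⟨i, b, A⟩ := v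
  have hI := Complex.I_ne_zero
  cases b <;> simp <;> field_simp <;> ring

theorem eq_of_slice {P Q : MvPolynomial (MomVar m) ℂ}
    (h : ∀ o, eval (slicePt o) P = eval (slicePt o) Q) : P = Q :=
  sub_eq_zero.mp (eq_zero_of_slice fun o => by rw [map_sub, h, sub_self])

/-- The product `π_{iA₁} ⋯ π_{iA_a} π̃_{iA'₁} ⋯ π̃_{iA'_b}`. -/
def strMom (i : Fin m) {a b : ℕ} (A : Idx a) (A' : Idx b) : MvPolynomial (MomVar m) ℂ :=
  (∏ k, X (i, false, A k)) * ∏ k, X (i, true, A' k)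

theorem eval_strMom (x : MomVar m → ℂ) (i : Fin m) {a b : ℕ} (A : Idx a) (A' : Idx b) :
    eval x (strMom i A A') = (∏ k, x (i, false, A k)) * ∏ k, x (i, true, A' k) := by
  simp [strMom, map_prod]

/-- The number of indices `1`. -/
def ones {k : ℕ} (E : Idx k) : ℕ := (Finset.univ.filter fun i => E i = 1).card

theorem ones_eq_zero {k : ℕ} {E : Idx k} (h : ones E = 0) : E = 0 := by
  rw [ones, Finset.card_eq_zero, Finset.filter_eq_empty_iff] at h
  funext i
  have := h (Finset.mem_univ i)
  change E i = 0
  omega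

theorem exists_perm_of_ones_eq {k : ℕ} {A B : Idx k} (h : ones A = ones B) :
    ∃ σ : Equiv.Perm (Fin k), B ∘ σ = A :=
  exists_perm_of_card_zero_eq (by
    have h1 := card_filter_idx A
    have h2 := card_filter_idx B
    unfold ones at h
    omega)

/-- The unipotent matrix that fixes the first basis vector. -/
def unip (z : ℂ) : SL2C := ⟨!![1, z; 0, 1], by simp⟩

theorem coeff_unip (z : ℂ) {k : ℕ} (E : Idx k) : coeff (unip z) 0 E = z ^ ones E := by
  have h : ∀ c : Fin 2, (unip z : Matrix (Fin 2) (Fin 2) ℂ) 0 c = if c = 1 then z else 1 := by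
    intro c
    fin_cases c <;> simp [unip]
  simp only [coeff, Pi.zero_apply, h, ones]
  rw [Finset.prod_ite]
  simp

theorem coeff_zero_right (g : SL2C) {k : ℕ} (A : Idx k) :
    coeff g A 0 = ∏ i, (g : Matrix (Fin 2) (Fin 2) ℂ) (A i) 0 := rfl

theorem act_eq_of_eq_zero {a a' p q : ℕ} (g : SL2C) {t : Arr a a' p q}
    (h : ∀ C C' E E', (C ≠ 0 ∨ C' ≠ 0 ∨ E ≠ 0 ∨ E' ≠ 0) → t C C' E E' = 0)
    (A : Idx a) (A' : Idx a') (B : Idx p) (B' : Idx q) :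
    Arr.act g t A A' B B' =
      coeff g A 0 * conj (coeff g A' 0) * coeff g B 0 * conj (coeff g B' 0) * t 0 0 0 0 := by
  rw [Arr.act, Fintype.sum_eq_single 0, Fintype.sum_eq_single 0, Fintype.sum_eq_single 0,
    Fintype.sum_eq_single 0]
  · intro E' hE'
    rw [h _ _ _ _ (.inr (.inr (.inr hE'))), mul_zero]
  · intro E hE
    exact Finset.sum_eq_zero fun E' _ => by rw [h _ _ _ _ (.inr (.inr (.inl hE))), mul_zero]
  · intro C' hC'
    exact Finset.sum_eq_zero fun E _ => Finset.sum_eq_zero fun E' _ => by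
      rw [h _ _ _ _ (.inr (.inl hC')), mul_zero]
  · intro C hC
    exact Finset.sum_eq_zero fun C' _ => Finset.sum_eq_zero fun E _ =>
      Finset.sum_eq_zero fun E' _ => by rw [h _ _ _ _ (.inl hC), mul_zero]

/-- Symmetric arrays are determined by the polynomials `∑ t_{EE'} z^E z̄^E'`. -/
theorem eq_zero_of_sum_ones {p q : ℕ} {t : Idx p → Idx q → ℂ}
    (hsym : ∀ (τ : Equiv.Perm (Fin p)) (τ' : Equiv.Perm (Fin q)) B B',
      t (B ∘ τ) (B' ∘ τ') = t B B') {c : ℂ}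
    (h : ∀ z, ∑ E, ∑ E', z ^ ones E * conj z ^ ones E' * t E E' = c)
    {B : Idx p} {B' : Idx q} (hB : B ≠ 0 ∨ B' ≠ 0) : t B B' = 0 := by
  classical
  -- The sums are read as polynomials in one variable and its conjugate, which are independent on
  -- the slice. Each pair of strings contributes the monomial counting its indices 1.
  let e : Idx p → Idx q → MomVar 1 →₀ ℕ := fun E E' =>
    Finsupp.single (0, false, 0) (ones E) + Finsupp.single (0, true, 0) (ones E')
  have he : ∀ E E' F F', e E E' = e F F' ↔ ones E = ones F ∧ ones E' = ones F' := by
    intro E E' F F'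
    constructor
    · intro h
      have h1 := DFunLike.congr_fun h (0, false, 0)
      have h2 := DFunLike.congr_fun h (0, true, 0)
      simp [e] at h1 h2
      exact ⟨h1, h2⟩
    · rintro ⟨h1, h2⟩
      simp only [e, h1, h2]
  have key : ∑ E, ∑ E', monomial (e E E') (t E E') = C c := by
    refine eq_of_slice fun o => ?_
    rw [eval_C, ← h (o 0 0), map_sum]
    refine Finset.sum_congr rfl fun E _ => ?_
    rw [map_sum]
    refine Finset.sum_congr rfl fun E' _ => ?_
    rw [eval_monomial]
    simp only [e]
    rw [Finsupp.prod_add_index' (by simp) (by simp [pow_add]), Finsupp.prod_single_index (by simp),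
      Finsupp.prod_single_index (by simp)]
    simp
    ring
  have h2 := congrArg (fun f => MvPolynomial.coeff (e B B') f) key
  have h3 : e B B' ≠ 0 := by
    intro h0
    have h4 : e B B' = e 0 0 := by rw [h0]; simp [e, ones]
    rw [he] at h4
    have z : ∀ k, ones (0 : Idx k) = 0 := fun k => by simp [ones]
    rw [z, z] at h4
    rcases hB with hB | hB
    · exact hB (ones_eq_zero h4.1)
    · exact hB (ones_eq_zero h4.2)
  simp only [coeff_sum, coeff_monomial, coeff_C, if_neg h3.symm] at h2
  -- By symmetry all strings with the same counts carry the same value, so the coefficient is that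
  -- value times a positive number of strings.
  have h5 : ∀ E E', (if e E E' = e B B' then t E E' else 0) =
      (if e E E' = e B B' then 1 else 0) * t B B' := by
    intro E E'
    split_ifs with h6
    · rw [he] at h6
      obtain ⟨σ, rfl⟩ := exists_perm_of_ones_eq h6.1
      obtain ⟨τ, rfl⟩ := exists_perm_of_ones_eq h6.2
      rw [hsym, one_mul]
    · rw [zero_mul]
  simp only [h5, ← Finset.sum_mul] at h2
  rcases mul_eq_zero.mp h2 with h6 | h6
  · exfalso
    have h7 : ∑ E, ∑ E', (if e E E' = e B B' then (1 : ℕ) else 0) = 0 := by exact_mod_cast h6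
    rw [Finset.sum_eq_zero_iff] at h7
    have h8 := h7 B (Finset.mem_univ _)
    rw [Finset.sum_eq_zero_iff] at h8
    have h9 := h8 B' (Finset.mem_univ _)
    simp at h9
  · exact h6

/-- Arrays that are invariant under the unipotent group, symmetric, and concentrated in the
components with `A = 0`, `A' = 0`, have a single component. -/
theorem eq_zero_of_unip_invariant {a a' p q : ℕ} {t : Arr a a' p q}
    (hsym : ∀ (τ : Equiv.Perm (Fin p)) (τ' : Equiv.Perm (Fin q)) A A' B B',
      t A A' (B ∘ τ) (B' ∘ τ') = t A A' B B')
    (hinv : ∀ z, Arr.act (unip z) t = t)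
    (hvan : ∀ A A' B B', (A ≠ 0 ∨ A' ≠ 0) → t A A' B B' = 0)
    (A : Idx a) (A' : Idx a') (B : Idx p) (B' : Idx q)
    (h : A ≠ 0 ∨ A' ≠ 0 ∨ B ≠ 0 ∨ B' ≠ 0) : t A A' B B' = 0 := by
  by_cases hA : A ≠ 0 ∨ A' ≠ 0
  · exact hvan _ _ _ _ hA
  push Not at hA
  obtain ⟨rfl, rfl⟩ := hA
  refine eq_zero_of_sum_ones (t := fun E E' => t 0 0 E E') (c := t 0 0 0 0)
    (fun τ τ' B B' => hsym τ τ' 0 0 B B') (fun z => ?_) (by simpa using h)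
  have h1 := congrFun (congrFun (congrFun (congrFun (hinv z) 0) 0) 0) 0
  rw [Arr.act, Fintype.sum_eq_single 0, Fintype.sum_eq_single 0] at h1
  · rw [← h1]
    have h0 : ∀ k, coeff (unip z) (0 : Idx k) 0 = 1 := fun k => by
      rw [coeff_unip]
      simp [ones]
    simp only [h0, coeff_unip, map_one, one_mul, map_pow]
  · intro C' hC'
    exact Finset.sum_eq_zero fun E _ => Finset.sum_eq_zero fun E' _ => by
      rw [hvan _ _ _ _ (.inr hC'), mul_zero]
  · intro C hC
    exact Finset.sum_eq_zero fun C' _ => Finset.sum_eq_zero fun E _ =>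
      Finset.sum_eq_zero fun E' _ => by rw [hvan _ _ _ _ (.inl hC), mul_zero]

/-- A matrix of determinant one with prescribed first column. -/
def colMat (o : Fin 2 → ℂ) (h : o 0 ≠ 0) : SL2C :=
  ⟨!![o 0, 0; o 1, (o 0)⁻¹], by simp [h]⟩

theorem colMat_apply (o : Fin 2 → ℂ) (h : o 0 ≠ 0) (c : Fin 2) :
    (colMat o h : Matrix (Fin 2) (Fin 2) ℂ) c 0 = o c := by
  fin_cases c <;> rfl

theorem colMat_mulVec (o : Fin 2 → ℂ) (h : o 0 ≠ 0) :
    (colMat o h : Matrix (Fin 2) (Fin 2) ℂ).mulVec ![1, 0] = o := by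
  funext c
  simp [Matrix.mulVec, dotProduct, colMat_apply]

theorem unip_mulVec (z : ℂ) : (unip z : Matrix (Fin 2) (Fin 2) ℂ).mulVec ![1, 0] = ![1, 0] := by
  funext c
  fin_cases c <;> simp [Matrix.mulVec, dotProduct, unip]

/-- Covariant arrays of polynomials of one momentum, with all the contractions of the indices
`A`, `A'` with the momentum equal to zero, are multiples of the product of momenta. -/
theorem eq_strMom_of_covariant {a a' p q : ℕ}
    {P : Idx a → Idx a' → Idx p → Idx q → MvPolynomial (MomVar 1) ℂ}
    (hsym : ∀ (τ : Equiv.Perm (Fin p)) (τ' : Equiv.Perm (Fin q)) A A' B B',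
      P A A' (B ∘ τ) (B' ∘ τ') = P A A' B B')
    (hcov : ∀ (g : SL2C) (o : Fin 2 → ℂ) A A' B B',
      eval (slicePt fun _ => (g : Matrix (Fin 2) (Fin 2) ℂ).mulVec o) (P A A' B B') =
        Arr.act g (fun C C' E E' => eval (slicePt fun _ => o) (P C C' E E')) A A' B B')
    (hvan : ∀ A A' B B', (A ≠ 0 ∨ A' ≠ 0) → eval (slicePt fun _ => ![1, 0]) (P A A' B B') = 0) :
    ∃ c : ℂ, ∀ A A' B B', P A A' B B' = C c * (strMom 0 A A' * strMom 0 B B') := by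
  let t : Arr a a' p q := fun C C' E E' => eval (slicePt fun _ => ![1, 0]) (P C C' E E')
  -- The spinor (1, 0) is fixed by the unipotent matrices, so the value there is invariant under
  -- them and reduces to one component.
  have ht : ∀ C C' E E', (C ≠ 0 ∨ C' ≠ 0 ∨ E ≠ 0 ∨ E' ≠ 0) → t C C' E E' = 0 := by
    refine eq_zero_of_unip_invariant (fun τ τ' A A' B B' => ?_) (fun z => ?_) hvan
    · simp only [t, hsym]
    · funext A A' B B'
      rw [← hcov, unip_mulVec]
  refine ⟨t 0 0 0 0, fun A A' B B' => ?_⟩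
  -- A matrix `colMat` moving (1, 0) to o requires o₀ ≠ 0. The factor π₀ takes care of the remaining
  -- points and is cancelled afterwards.
  have h1 : X (0, false, 0) * P A A' B B' =
      X (0, false, 0) * (C (t 0 0 0 0) * (strMom 0 A A' * strMom 0 B B')) := by
    refine eq_of_slice fun o => ?_
    have ho : o = fun _ => o 0 := funext fun i => by rw [Subsingleton.elim i 0]
    rw [map_mul, map_mul _ (X _), eval_X, slicePt_false]
    by_cases h0 : o 0 0 = 0
    · rw [h0, zero_mul, zero_mul]
    · congr 1
      have h2 := hcov (colMat (o 0) h0) ![1, 0] A A' B B'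
      rw [colMat_mulVec, ← ho, act_eq_of_eq_zero _ ht] at h2
      rw [h2]
      simp only [coeff_zero_right, colMat_apply, map_mul, eval_C, eval_strMom, slicePt_false,
        slicePt_true, map_prod, t]
      ring
  exact mul_left_cancel₀ (X_ne_zero _) h1

end Slice

/-! ### Covariance of symbols -/

section Covariance

open MvPolynomial

variable {n m : ℕ}

theorem prod_idx {M : Type*} [CommMonoid M] {k : ℕ} (f : Fin 2 → M) (A : Idx k) :
    ∏ i, f (A i) = f 0 ^ (Finset.univ.filter fun i => A i = 0).card *
      f 1 ^ (Finset.univ.filter fun i => A i = 1).card := by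
  rw [← Finset.prod_fiberwise' Finset.univ A f, Fin.prod_univ_two, Finset.prod_const,
    Finset.prod_const]

/-- The jet of a plane wave with momentum spinor `o`, at the origin. -/
def planeJet (n : ℕ) (o : Fin 2 → ℂ) : Jet n := fun p =>
  ⟨fun A A' => (∏ i, o (A i)) * ∏ i, conj (o (A' i)), fun σ τ A A' => by
    simp only [Function.comp_apply]
    rw [Equiv.prod_comp σ fun i => o (A i), Equiv.prod_comp τ fun i => conj (o (A' i))]⟩

theorem jetCoord_planeJet (hn : 1 ≤ n) (o : Fin 2 → ℂ) {μ : JetExp}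
    (h : μ.IsPos n ∨ μ.IsNeg n) : jetCoord (planeJet n o) μ =
      ∏ v : Bool × Fin 2, (if v.1 then conj (o v.2) else o v.2) ^ μ v := by
  have key : ∀ {μ : JetExp}, μ.IsPos n → jetCoord (planeJet n o) μ =
      o 0 ^ μ (false, 0) * o 1 ^ μ (false, 1) *
        (conj (o 0) ^ μ (true, 0) * conj (o 1) ^ μ (true, 1)) := by
    intro μ h
    obtain ⟨p, A, A', rfl⟩ := exists_strExp_eq h
    rw [jetCoord_strExp]
    change (∏ i, o (A i)) * ∏ i, conj (o (A' i)) = _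
    rw [prod_idx o A, prod_idx (fun c => conj (o c)) A', strExp_false, strExp_false, strExp_true,
      strExp_true]
  have e : ∏ v : Bool × Fin 2, (if v.1 then conj (o v.2) else o v.2) ^ μ v =
      o 0 ^ μ (false, 0) * o 1 ^ μ (false, 1) *
        (conj (o 0) ^ μ (true, 0) * conj (o 1) ^ μ (true, 1)) := by
    rw [Fintype.prod_prod_type, Fintype.prod_bool, Fin.prod_univ_two, Fin.prod_univ_two, mul_comm]
    simp
  rw [e]
  rcases h with h | h
  · exact key h
  · have h' : μ.swap.IsPos n := by simpa using h
    rw [← JetExp.swap_swap μ, jetCoord_swap hn, key h', JetExp.swap_swap]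
    simp only [JetExp.swap_apply, map_mul, map_pow, Complex.conj_conj, Bool.not_true,
      Bool.not_false]
    ring

theorem sum_coeff_prod (g : SL2C) {k : ℕ} (A : Idx k) (o : Fin 2 → ℂ) :
    ∑ B : Idx k, coeff g A B * ∏ i, o (B i) =
      ∏ i, (g : Matrix (Fin 2) (Fin 2) ℂ).mulVec o (A i) := by
  simp only [Matrix.mulVec, dotProduct]
  rw [Finset.prod_univ_sum, Fintype.piFinset_univ]
  refine Finset.sum_congr rfl fun B _ => ?_
  rw [coeff, ← Finset.prod_mul_distrib]

theorem act_planeJet (g : SL2C) (o : Fin 2 → ℂ) :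
    (planeJet n o).act g = planeJet n ((g : Matrix (Fin 2) (Fin 2) ℂ).mulVec o) := by
  refine funext fun p => Subtype.ext (funext fun A => funext fun A' => ?_)
  change ∑ B : Idx (n + p), ∑ B' : Idx p, coeff g A B * conj (coeff g A' B') *
    ((∏ i, o (B i)) * ∏ i, conj (o (B' i))) = (∏ i, _) * ∏ i, conj _
  rw [← sum_coeff_prod, ← map_prod, ← sum_coeff_prod, map_sum, Finset.sum_mul_sum]
  refine Finset.sum_congr rfl fun B _ => Finset.sum_congr rfl fun B' _ => ?_
  rw [map_mul, map_prod]
  ring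

/-- The action of `SL(2,ℂ)` on jets, as a real linear map. -/
def actLin (g : SL2C) : Jet n →ₗ[ℝ] Jet n where
  toFun := Jet.act g
  map_add' j k := by
    refine funext fun p => Subtype.ext (funext fun A => funext fun A' => ?_)
    change ∑ B : Idx (n + p), ∑ B' : Idx p, coeff g A B * conj (coeff g A' B') *
      ((j p).1 B B' + (k p).1 B B') = (∑ B : Idx (n + p), ∑ B' : Idx p, _) +
        ∑ B : Idx (n + p), ∑ B' : Idx p, _
    simp only [mul_add, Finset.sum_add_distrib]
  map_smul' t j := by
    refine funext fun p => Subtype.ext (funext fun A => funext fun A' => ?_)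
    change ∑ B : Idx (n + p), ∑ B' : Idx p, coeff g A B * conj (coeff g A' B') *
      (t • (j p).1 B B') = t • ∑ B : Idx (n + p), ∑ B' : Idx p, _
    simp only [Finset.smul_sum, mul_smul_comm]

theorem actLin_apply (g : SL2C) (j : Jet n) : actLin g j = j.act g := rfl

/-- Iterated directional derivatives. -/
def iterDir (n : ℕ) : (m : ℕ) → (Fin m → Jet n) → localFn n →ₗ[ℂ] localFn n
  | 0, _ => LinearMap.id
  | m + 1, k => (dirDeriv (k 0)).toLinearMap ∘ₗ iterDir n m fun i => k i.succ

theorem iterDir_succ (k : Fin (m + 1) → Jet n) (F : localFn n) :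
    iterDir n (m + 1) k F = dirDeriv (k 0) (iterDir n m (fun i => k i.succ) F) := rfl

theorem dirDeriv_eq {F : localFn n} {B : ℕ} (hF : OrderLE F B) (k : Jet n) :
    dirDeriv k F = ∑ μ ∈ boxExp B, jetCoord k μ • pd n μ F := by
  refine Subtype.ext (funext fun j => ?_)
  rw [dirDeriv_apply, hF.2, coe_finset_sum]
  exact Finset.sum_congr rfl fun μ _ => mul_comm _ _

theorem iterDir_eq (hn : 1 ≤ n) {F : localFn n} {B : ℕ} (hF : OrderLE F B) (k : Fin m → Jet n) :
    iterDir n m k F = ∑ μ : Fin m → boxExp B,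
      (∏ i, jetCoord (k i) (μ i)) • iterPd n m (fun i => μ i) F := by
  induction m with
  | zero => simp [iterDir, iterPd]
  | succ m ih =>
    rw [iterDir_succ, ih, map_sum, ← (Fin.consEquiv fun _ : Fin (m + 1) =>
      (boxExp B : Type)).sum_comp, Fintype.sum_prod_type, Finset.sum_comm]
    refine Finset.sum_congr rfl fun μ _ => ?_
    rw [Derivation.map_smul, dirDeriv_eq (hF.iterPd hn _), Finset.smul_sum]
    refine (Finset.sum_coe_sort (boxExp B) fun ν => (∏ i, jetCoord (k i.succ) (μ i)) •
      jetCoord (k 0) ν • pd n ν (iterPd n m (fun i => μ i) F)).symm.trans ?_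
    refine Finset.sum_congr rfl fun ν _ => ?_
    rw [Fin.prod_univ_succ, iterPd_succ, smul_smul, mul_comm]
    rfl

theorem iterDir_comp (Φ : Jet n →ₗ[ℝ] Jet n) {F G : localFn n}
    (h : ∀ j, (F : Jet n → ℂ) (Φ j) = (G : Jet n → ℂ) j) (k : Fin m → Jet n) (j : Jet n) :
    (iterDir n m (fun i => Φ (k i)) F : Jet n → ℂ) (Φ j) = (iterDir n m k G : Jet n → ℂ) j := by
  induction m generalizing j with
  | zero => exact h j
  | succ m ih =>
    rw [iterDir_succ, iterDir_succ, dirDeriv_apply, dirDeriv_apply, lineDeriv, lineDeriv]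
    congr 1
    funext t
    rw [← ih, map_add, map_smul]

/-- The values of symbols on the real slice are derivatives along plane waves. -/
theorem eval_symbZero (hn : 1 ≤ n) (F : localFn n) (o : Fin m → Fin 2 → ℂ) :
    eval (slicePt o) (symbZero hn m F) =
      evalZero n (iterDir n m (fun i => planeJet n (o i)) F) := by
  obtain ⟨B, hB⟩ := exists_orderLE hn F
  have hF := hB B le_rfl
  rw [eval_eq', sum_support_eq (B := B), iterDir_eq hn hF, map_sum]
  · refine Finset.sum_congr rfl fun μ _ => ?_
    rw [map_smul, coeff_symbZero, part_glue, smul_eq_mul, mul_comm]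
    -- At labels that belong to no coordinate the jet coordinate is zero while the monomial in o
    -- need not be; there the iterated derivative vanishes.
    by_cases h : ∀ i, (μ i : JetExp).IsPos n ∨ (μ i : JetExp).IsNeg n
    · congr 1
      rw [Fintype.prod_prod_type]
      refine Finset.prod_congr rfl fun i _ => ?_
      rw [jetCoord_planeJet hn _ (h i)]
      rfl
    · push Not at h
      obtain ⟨i, h1, h2⟩ := h
      rw [iterPd_eq_zero _ i (by rw [pd_eq_zero h1 h2]; rfl), map_zero, mul_zero, mul_zero]
  · intro κ hκ i
    by_contra h
    rw [coeff_symbZero, iterPd_eq_zero _ i (hF.1 _ h), map_zero] at hκ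
    exact hκ rfl

/-- The action of `SL(2,ℂ)` on arrays with values in a complex vector space. -/
def actV {V : Type*} [AddCommGroup V] [Module ℂ V] {a a' p q : ℕ} (g : SL2C)
    (F : Idx a → Idx a' → Idx p → Idx q → V) : Idx a → Idx a' → Idx p → Idx q → V :=
  fun A A' B B' => ∑ C : Idx a, ∑ C' : Idx a', ∑ E : Idx p, ∑ E' : Idx q,
    (coeff g A C * conj (coeff g A' C') * coeff g B E * conj (coeff g B' E')) • F C C' E E'

theorem map_actV {V W : Type*} [AddCommGroup V] [Module ℂ V] [AddCommGroup W] [Module ℂ W]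
    (L : V →ₗ[ℂ] W) {a a' p q : ℕ} (g : SL2C) (F : Idx a → Idx a' → Idx p → Idx q → V)
    (A : Idx a) (A' : Idx a') (B : Idx p) (B' : Idx q) :
    L (actV g F A A' B B') = actV g (fun C C' E E' => L (F C C' E E')) A A' B B' := by
  simp only [actV, map_sum, map_smul]

theorem actV_complex {a a' p q : ℕ} (g : SL2C) (F : Arr a a' p q) : actV g F = Arr.act g F := rfl

/-- Evaluation at a jet. -/
def evalJet (j : Jet n) : localFn n →ₗ[ℂ] ℂ where
  toFun F := (F : Jet n → ℂ) j
  map_add' _ _ := rfl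
  map_smul' _ _ := rfl

/-- Symbols of covariant functions are covariant. -/
theorem eval_symbZero_covariant (hn : 1 ≤ n) {a a' p q : ℕ}
    {F : Idx a → Idx a' → Idx p → Idx q → localFn n}
    (hF : ∀ (g : SL2C) (j : Jet n) A A' B B', (F A A' B B' : Jet n → ℂ) (j.act g) =
      Arr.act g (fun C C' E E' => (F C C' E E' : Jet n → ℂ) j) A A' B B')
    (g : SL2C) (o : Fin m → Fin 2 → ℂ) (A : Idx a) (A' : Idx a') (B : Idx p) (B' : Idx q) :
    eval (slicePt fun i => (g : Matrix (Fin 2) (Fin 2) ℂ).mulVec (o i))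
        (symbZero hn m (F A A' B B')) =
      Arr.act g (fun C C' E E' => eval (slicePt o) (symbZero hn m (F C C' E E'))) A A' B B' := by
  simp only [eval_symbZero, ← act_planeJet]
  -- The equivariance of F is differentiated m times at the zero jet, a fixed point of the action,
  -- along plane waves, which the action permutes.
  have h := iterDir_comp (m := m) (actLin g) (F := F A A' B B') (G := actV g F A A' B B')
    (fun j => by
      rw [actLin_apply, hF, ← actV_complex]
      exact (map_actV (evalJet j) g F A A' B B').symm) (fun i => planeJet n (o i)) 0
  rw [map_zero] at h
  refine h.trans ?_
  change ((evalZero n).toLinearMap ∘ₗ iterDir n m _) (actV g F A A' B B') = _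
  rw [map_actV]
  rfl

/-- The components of a translation invariant local spinor function, as local functions. -/
theorem exists_components {a a' p q : ℕ} {X : SpinorFn n a a' p q} (hl : IsLocal X)
    (hc : IsCovariant X) : ∃ F : Idx a → Idx a' → Idx p → Idx q → localFn n,
      (∀ x j A A' B B', X x j A A' B B' = (F A A' B B' : Jet n → ℂ) j) ∧
      ∀ (g : SL2C) (j : Jet n) A A' B B', (F A A' B B' : Jet n → ℂ) (j.act g) =
        Arr.act g (fun C C' E E' => (F C C' E E' : Jet n → ℂ) j) A A' B B' := by
  obtain ⟨r, f, hf, hX⟩ := hl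
  -- Covariance with g = 1 and the translation taking the image of the origin to x removes the
  -- dependence on x.
  have hx : ∀ x j, X x j = X 0 j := by
    intro x j
    have hone : ∀ {k : ℕ} (A B : Idx k), coeff 1 A B = if A = B then 1 else 0 := by
      intro k A B
      simp only [coeff, Matrix.SpecialLinearGroup.coe_one, Matrix.one_apply]
      rw [Finset.prod_ite_zero]
      simp [funext_iff]
    have h1 : ∀ j : Jet n, j.act 1 = j := by
      intro j
      refine funext fun p => Subtype.ext (funext fun A => funext fun A' => ?_)
      change ∑ B : Idx (n + p), ∑ B' : Idx p, coeff 1 A B * conj (coeff 1 A' B') * (j p).1 B B' = _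
      simp [hone, apply_ite, ite_mul]
    have h2 : ∀ t : Arr a a' p q, Arr.act 1 t = t := by
      intro t
      funext A A' B B'
      simp [Arr.act, hone, apply_ite, ite_mul]
    have h3 := hc 1 (x - lorentz 1 0) 0 j
    rwa [h1, h2, add_sub_cancel] at h3
  refine ⟨fun A A' B B' => ⟨fun j => X 0 j A A' B B', r, fun y => f (0, y) A A' B B', ?_, ?_⟩,
    ?_, ?_⟩
  · have h1 : ContDiff ℝ ∞ fun y : JetUpTo n r => f (0, y) :=
      hf.comp (contDiff_const.prodMk contDiff_id)
    exact contDiff_pi.mp (contDiff_pi.mp (contDiff_pi.mp (contDiff_pi.mp h1 A) A') B) B'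
  · intro j
    change X 0 j A A' B B' = _
    rw [hX]
    rfl
  · intro x j A A' B B'
    rw [hx]
  · intro g j A A' B B'
    have h1 := hc g 0 0 j
    rw [hx] at h1
    change X 0 (j.act g) A A' B B' = _
    rw [h1]

end Covariance

/-! ### Symmetry operators -/

section Operators

open MvPolynomial

variable {n : ℕ}

/-- The label of the component with lists of indices `L`, `L'`. -/
def listExp (L L' : List (Fin 2)) : JetExp :=
  (L.map fun c => Finsupp.single (false, c) 1).sum +
    (L'.map fun c => Finsupp.single (true, c) 1).sum

theorem sum_getD {M : Type*} [AddCommMonoid M] {N : ℕ} {L : List (Fin 2)} (h : L.length = N)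
    (f : Fin 2 → M) : ∑ i : Fin N, f (L.getD i 0) = (L.map f).sum := by
  subst h
  induction L with
  | nil => simp
  | cons c L ih =>
    rw [List.length_cons, Fin.sum_univ_succ, List.map_cons, List.sum_cons, ← ih]
    simp

theorem fld_eq_jetCoord (j : Jet n) {p : ℕ} {L L' : List (Fin 2)} (h : L.length = n + p)
    (h' : L'.length = p) : j.fld p L L' = jetCoord j (listExp L L') := by
  rw [Jet.fld, ← jetCoord_strExp, strExp, listExp]
  congr 2
  · exact sum_getD h fun c => Finsupp.single (false, c) 1
  · exact sum_getD h' fun c => Finsupp.single (true, c) 1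

theorem swap_listExp (L L' : List (Fin 2)) : (listExp L L').swap = listExp L' L := by
  have h : ∀ (b : Bool) (L : List (Fin 2)),
      JetExp.swap (L.map fun c => Finsupp.single (b, c) 1).sum =
        (L.map fun c => Finsupp.single (!b, c) 1).sum := by
    intro b L
    induction L with
    | nil => ext v; rfl
    | cons c L ih =>
      rw [List.map_cons, List.sum_cons, JetExp.swap_add, ih, List.map_cons, List.sum_cons]
      congr 1
      ext ⟨b', A⟩
      cases b <;> cases b' <;> simp [Finsupp.single_apply]
  rw [listExp, JetExp.swap_add, h, h, listExp, add_comm]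
  rfl

theorem cfld_eq_jetCoord (hn : 1 ≤ n) (j : Jet n) {p : ℕ} {L L' : List (Fin 2)}
    (h : L.length = p) (h' : L'.length = n + p) :
    j.cfld p L L' = jetCoord j (listExp L L') := by
  rw [Jet.cfld, fld_eq_jetCoord j h' h, ← jetCoord_swap hn, swap_listExp]

theorem listExp_ofFn {a b : ℕ} (A : Idx a) (A' : Idx b) :
    listExp (List.ofFn A) (List.ofFn A') = strExp A A' := by
  rw [listExp, strExp, List.map_ofFn, List.map_ofFn, List.sum_ofFn, List.sum_ofFn]
  rfl

theorem listExp_append (L₁ L₂ L₁' L₂' : List (Fin 2)) :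
    listExp (L₁ ++ L₂) (L₁' ++ L₂') = listExp L₁ L₁' + listExp L₂ L₂' := by
  simp only [listExp, List.map_append, List.sum_append]
  abel

theorem deg_listExp (L L' : List (Fin 2)) (b : Bool) :
    (listExp L L').deg b = if b then L'.length else L.length := by
  have h : ∀ (b b' : Bool) (L : List (Fin 2)),
      JetExp.deg (L.map fun c => Finsupp.single (b', c) 1).sum b =
        if b = b' then L.length else 0 := by
    intro b b' L
    induction L with
    | nil => simp [JetExp.deg]
    | cons c L ih =>
      rw [List.map_cons, List.sum_cons, deg_add, ih]
      cases b <;> cases b' <;> fin_cases c <;> simp [JetExp.deg, add_comm]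
  rw [listExp, deg_add, h, h]
  cases b <;> simp

theorem strMom_eq_monomial {m : ℕ} (i : Fin m) {a b : ℕ} (A : Idx a) (A' : Idx b) :
    strMom i A A' = monomial (glue (Pi.single i (strExp A A'))) 1 := by
  have h : ∀ (s : Bool) {k : ℕ} (A : Idx k), ∏ l, X (R := ℂ) (i, s, A l) =
      monomial (glue (Pi.single i (∑ l, Finsupp.single (s, A l) 1))) 1 := by
    intro s k A
    induction k with
    | zero =>
      have : glue (Pi.single i (∑ l : Fin 0, Finsupp.single (s, A l) 1)) = (0 : MomVar m →₀ ℕ) := by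
        ext v
        simp [glue]
      rw [this]
      simp
    | succ k ih =>
      rw [Fin.prod_univ_succ, ih fun l => A l.succ, X, monomial_mul, one_mul, Fin.sum_univ_succ]
      refine congrArg (fun κ => monomial κ (1 : ℂ)) ?_
      ext ⟨i', v⟩
      by_cases hi : i' = i
      · subst hi
        simp [glue, Finsupp.single_apply]
      · simp [glue, hi]
  rw [strMom, h, h, monomial_mul, one_mul]
  refine congrArg (fun κ => monomial κ (1 : ℂ)) ?_
  ext ⟨i', v⟩
  by_cases hi : i' = i
  · subst hi
    simp [glue, strExp]
  · simp [glue, hi]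

theorem realizeC_strMom_mul {a b p q : ℕ} (A : Idx a) (A' : Idx b) (B : Idx p) (B' : Idx q)
    (c : ℂ) : realizeC n 1 (C c * (strMom 0 A A' * strMom 0 B B')) =
      c • coordFn n (strExp A A' + strExp B B') := by
  rw [← smul_eq_C_mul, map_smul, strMom_eq_monomial, strMom_eq_monomial, monomial_mul, one_mul,
    realizeC_monomial, part_add, part_glue, part_glue]
  simp

/-- `∑_C ε_{AC} o_C`. -/
def epsVec (o : Fin 2 → ℂ) (A : Fin 2) : ℂ := ∑ B, eps A B * o B

/-- Determinant one means that ε is invariant, so the vector ε o transforms contragrediently to o.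
-/
theorem sum_epsVec_mul (g : SL2C) (o : Fin 2 → ℂ) (E : Fin 2) :
    ∑ A, epsVec ((g : Matrix (Fin 2) (Fin 2) ℂ).mulVec o) A *
      (g : Matrix (Fin 2) (Fin 2) ℂ) A E = epsVec o E := by
  have hdet := g.2
  rw [Matrix.det_fin_two] at hdet
  fin_cases E <;> simp [epsVec, eps, Matrix.mulVec, dotProduct]
  · linear_combination o 1 * hdet
  · linear_combination -o 0 * hdet

theorem sum_eps_mul_epsVec (o : Fin 2 → ℂ) (B : Fin 2) :
    ∑ A, eps A B * epsVec o A = o B := by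
  fin_cases B <;> simp [epsVec, eps]

theorem sum_mul_prod {k : ℕ} (f : Fin k → Fin 2 → ℂ) (h : Fin 2 → ℂ) :
    ∑ A : Idx k, (∏ i, f i (A i)) * ∏ i, h (A i) = ∏ i, ∑ c, f i c * h c := by
  rw [Finset.prod_univ_sum, Fintype.piFinset_univ]
  exact Finset.sum_congr rfl fun A _ => Finset.prod_mul_distrib.symm

/-- For o = (-z, 1) the vector ε o is (1, z), and the hypothesis becomes the vanishing of a
polynomial in z whose coefficients are multiples of the components of v. -/
theorem eq_zero_of_sum_epsVec {k : ℕ} {v : Idx k → ℂ}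
    (hsym : ∀ (τ : Equiv.Perm (Fin k)) A, v (A ∘ τ) = v A)
    (h : ∀ o, ∑ A, v A * ∏ i, epsVec o (A i) = 0) (A : Idx k) : v A = 0 := by
  have h1 : ∀ z, ∑ A : Idx k, ∑ A' : Idx 0, z ^ ones A * conj z ^ ones A' * v A = 0 := by
    intro z
    rw [← h ![-z, 1]]
    refine Finset.sum_congr rfl fun A _ => ?_
    have h2 : ∀ c, epsVec ![-z, 1] c = if c = 1 then z else 1 := by
      intro c
      fin_cases c <;> simp [epsVec, eps]
    simp only [h2]
    rw [Finset.prod_ite]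
    simp [ones]
    ring
  have h2 : ∀ A : Idx k, A ≠ 0 → v A = 0 := fun A hA =>
    eq_zero_of_sum_ones (t := fun A (_ : Idx 0) => v A) (fun τ _ A _ => hsym τ A) h1
      (B' := 0) (.inl hA)
  by_cases hA : A = 0
  · have h3 := h1 0
    rw [Fintype.sum_eq_single 0 (fun A hA => by simp [h2 A hA])] at h3
    simpa [hA, ones] using h3
  · exact h2 A hA

theorem act_zero_right {a p q : ℕ} (g : SL2C) (t : Arr a 0 p q) (A : Idx a) (A' : Idx 0)
    (B : Idx p) (B' : Idx q) : Arr.act g t A A' B B' = ∑ F, ∑ E, ∑ E',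
      coeff g A F * (coeff g B E * conj (coeff g B' E') * t F ![] E E') := by
  rw [Arr.act]
  refine Finset.sum_congr rfl fun F _ => ?_
  rw [Fintype.sum_eq_single ![] fun b hb => absurd (Subsingleton.elim _ _) hb]
  refine Finset.sum_congr rfl fun E _ => Finset.sum_congr rfl fun E' _ => ?_
  simp [coeff]
  ring

theorem act_zero_zero {p q : ℕ} (g : SL2C) (t : Arr 0 0 p q) (A A' : Idx 0)
    (B : Idx p) (B' : Idx q) : Arr.act g t A A' B B' = ∑ E, ∑ E',
      coeff g B E * conj (coeff g B' E') * t ![] ![] E E' := by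
  rw [act_zero_right, Fintype.sum_eq_single ![] fun b hb => absurd (Subsingleton.elim _ _) hb]
  refine Finset.sum_congr rfl fun E _ => Finset.sum_congr rfl fun E' _ => ?_
  simp [coeff]

/-- Invariant arrays `V_{A_n B_p B'_q}` are multiples of the symmetrised product of the
`ε_{A_iB_i}`. -/
theorem eq_smul_elementary {p q : ℕ} {V : Arr n 0 p q}
    (hsym : ∀ (σ : Equiv.Perm (Fin n)) (τ : Equiv.Perm (Fin p)) (τ' : Equiv.Perm (Fin q)) A A' B B',
      V (A ∘ σ) A' (B ∘ τ) (B' ∘ τ') = V A A' B B')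
    (hinv : ∀ g, Arr.act g V = V) :
    (∃ c : ℂ, ∀ j x, V = c • elementaryOperator n p q x j) ∧ (¬ (p = n ∧ q = 0) → V = 0) := by
  have hsymA : ∀ B B' (σ : Equiv.Perm (Fin n)) A, V (A ∘ σ) ![] B B' = V A ![] B B' :=
    fun B B' σ A => hsym σ 1 1 A ![] B B'
  -- All indices A are contracted with ε π. The result is a covariant polynomial of degree n in π
  -- that does not involve π̃.
  let W : Idx 0 → Idx 0 → Idx p → Idx q → MvPolynomial (MomVar 1) ℂ := fun _ _ B B' =>
    ∑ A, C (V A ![] B B') * ∏ i, ∑ E, C (eps (A i) E) * X (0, false, E)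
  have hW : ∀ (x : MomVar 1 → ℂ) A A' B B', eval x (W A A' B B') =
      ∑ A, V A ![] B B' * ∏ i, epsVec (fun E => x (0, false, E)) (A i) := by
    intro x A A' B B'
    simp [W, epsVec, map_prod, map_sum]
  obtain ⟨c, hc⟩ := eq_strMom_of_covariant (P := W) (fun τ τ' A A' B B' => by
      simp only [W]
      exact Finset.sum_congr rfl fun A _ => by rw [← hsym 1 τ τ' A ![] B B']; rfl)
    (fun g o A A' B B' => by
      have e : ∀ o : Fin 2 → ℂ, (fun E => slicePt (m := 1) (fun _ => o) (0, false, E)) = o :=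
        fun o => rfl
      rw [act_zero_zero]
      simp only [hW, e]
      have h1 : ∀ A, V A ![] B B' = ∑ E, ∑ E', ∑ F,
          coeff g A F * (coeff g B E * conj (coeff g B' E') * V F ![] E E') := by
        intro A
        conv_lhs => rw [← hinv g]
        rw [act_zero_right, Finset.sum_comm]
        exact Finset.sum_congr rfl fun E _ => Finset.sum_comm
      simp only [h1, Finset.sum_mul]
      rw [Finset.sum_comm]
      refine Finset.sum_congr rfl fun E _ => ?_
      rw [Finset.sum_comm]
      refine Finset.sum_congr rfl fun E' _ => ?_
      rw [Finset.sum_comm, Finset.mul_sum]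
      refine Finset.sum_congr rfl fun F _ => ?_
      have h2 := sum_mul_prod (fun i c => (g : Matrix (Fin 2) (Fin 2) ℂ) c (F i))
        (epsVec ((g : Matrix (Fin 2) (Fin 2) ℂ).mulVec o))
      simp only [mul_comm ((g : Matrix (Fin 2) (Fin 2) ℂ) _ _), sum_epsVec_mul] at h2
      rw [← h2, Finset.mul_sum, Finset.mul_sum]
      refine Finset.sum_congr rfl fun A _ => ?_
      simp [coeff]
      ring)
    (fun A A' B B' h => by
      rcases h with h | h <;> exact absurd (Subsingleton.elim _ _) h)
  have hval : ∀ (o ι : Fin 2 → ℂ) B B', ∑ A, V A ![] B B' * ∏ i, epsVec o (A i) =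
      c * ((∏ k, o (B k)) * ∏ k, ι (B' k)) := by
    intro o ι B B'
    have h1 := hW (momPt (fun _ => o) fun _ => ι) ![] ![] B B'
    rw [hc ![] ![]] at h1
    simp only [map_mul, eval_C, eval_strMom, momPt_false, momPt_true, Finset.univ_eq_empty,
      Finset.prod_empty, one_mul] at h1
    exact h1.symm
  -- Degrees are compared. For q > 0 the product of momenta vanishes at π̃ = 0, and for q = 0
  -- doubling π separates degree n from degree p.
  have hzero : ¬ (p = n ∧ q = 0) → V = 0 := by
    intro hpq
    funext A A' B B'
    rw [Subsingleton.elim A' ![]]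
    refine eq_zero_of_sum_epsVec (v := fun A => V A ![] B B') (hsymA B B') (fun o => ?_) A
    by_cases hq : q = 0
    · have hp : p ≠ n := fun h => hpq ⟨h, hq⟩
      subst hq
      have h1 := hval o 0 B B'
      have h2 := hval (fun E => 2 * o E) 0 B B'
      have h3 : epsVec (fun E => 2 * o E) = fun A => 2 * epsVec o A := by
        funext A
        simp [epsVec]
        ring
      rw [h3] at h2
      simp only [Finset.prod_mul_distrib, Finset.prod_const, Finset.card_univ, Fintype.card_fin,
        mul_left_comm _ ((2 : ℂ) ^ _), ← Finset.mul_sum] at h2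
      rw [h1, mul_assoc, mul_left_comm c] at h2
      rw [h1]
      have h4 : ((2 : ℂ) ^ n - 2 ^ p) ≠ 0 := by
        rw [sub_ne_zero]
        intro h
        exact hp (Nat.pow_right_injective le_rfl (by exact_mod_cast h.symm))
      refine (mul_eq_zero.mp (?_ : ((2 : ℂ) ^ n - 2 ^ p) * _ = 0)).resolve_left h4
      linear_combination h2
    · rw [hval o 0]
      have : ∏ k : Fin q, (0 : Fin 2 → ℂ) (B' k) = 0 :=
        Finset.prod_eq_zero (Finset.mem_univ ⟨0, Nat.pos_of_ne_zero hq⟩) rfl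
      rw [this, mul_zero, mul_zero]
  refine ⟨?_, hzero⟩
  by_cases hpq : p = n ∧ q = 0
  · obtain ⟨rfl, rfl⟩ := hpq
    refine ⟨c, fun j x => ?_⟩
    funext A A' B B'
    rw [Subsingleton.elim A' ![], ← sub_eq_zero]
    let U : Idx p → ℂ := fun A => elementaryOperator p p 0 x j A ![] B B'
    -- The array and the multiple of the elementary operator have the same contractions with all
    -- spinors ε o.
    refine eq_zero_of_sum_epsVec (v := fun A => V A ![] B B' - c * U A)
      (fun σ A => ?_) (fun o => ?_) A
    · have : U (A ∘ σ) = U A := by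
        simp only [U, elementaryOperator]
        congr 1
        rw [← Equiv.sum_comp (Equiv.mulRight σ : Equiv.Perm (Equiv.Perm (Fin p)))]
        exact Finset.sum_congr rfl fun e _ =>
          Equiv.prod_comp σ fun i => eps (A i) (B (e i))
      rw [this, hsymA]
    · simp only [sub_mul, Finset.sum_sub_distrib, mul_assoc, ← Finset.mul_sum]
      rw [hval o 0, sub_eq_zero]
      congr 1
      simp only [U, elementaryOperator, div_mul_eq_mul_div, Finset.sum_mul]
      rw [← Finset.sum_div, Finset.sum_comm]
      have h1 : ∀ e : Fin p ≃ Fin p,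
          ∑ A : Idx p, (∏ i, eps (A i) (B (e i))) * ∏ i, epsVec o (A i) = ∏ k, o (B k) := by
        intro e
        rw [sum_mul_prod fun i c => eps c (B (e i))]
        simp only [sum_eps_mul_epsVec]
        exact Equiv.prod_comp e fun k => o (B k)
      simp only [h1, Finset.sum_const, Finset.card_univ, Fintype.card_perm, Fintype.card_fin,
        nsmul_eq_mul, Finset.univ_eq_empty, Finset.prod_empty, mul_one]
      rw [mul_div_cancel_left₀]
      exact_mod_cast Nat.factorial_ne_zero p
  · exact ⟨0, fun j x => by rw [hzero hpq, zero_smul]⟩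

theorem evalZero_invariant {a a' p q : ℕ} {F : Idx a → Idx a' → Idx p → Idx q → localFn n}
    (hF : ∀ (g : SL2C) (j : Jet n) A A' B B', (F A A' B B' : Jet n → ℂ) (j.act g) =
      Arr.act g (fun C C' E E' => (F C C' E E' : Jet n → ℂ) j) A A' B B') (g : SL2C) :
    Arr.act g (fun A A' B B' => evalZero n (F A A' B B')) =
      fun A A' B B' => evalZero n (F A A' B B') := by
  funext A A' B B'
  have h := hF g 0 A A' B B'
  rw [← actLin_apply, map_zero] at h
  exact h.symm

/-- Covariant symmetry operators are linear combinations of the basic ones. -/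
theorem mem_span_basicOperators (hn : 1 ≤ n) {p q : ℕ} {X : SpinorFn n n 0 p q}
    (hX : IsCovariantSymmetryOperator X) :
    X ∈ Submodule.span ℂ {Y | IsBasicOperator n p q Y} := by
  obtain ⟨F, hXF, hcov⟩ := exists_components hX.isLocal hX.isCovariant
  have hsym : ∀ (σ : Equiv.Perm (Fin n)) (τ : Equiv.Perm (Fin p)) (τ' : Equiv.Perm (Fin q))
      A A' B B', F (A ∘ σ) A' (B ∘ τ) (B' ∘ τ') = F A A' B B' := by
    intro σ τ τ' A A' B B'
    refine Subtype.ext (funext fun j => ?_)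
    have h := hX.isSymm σ 1 τ τ' 0 j A A' B B'
    rw [hXF, hXF] at h
    exact h
  have hfield : ∀ (i : Fin n) A (C' : Fin 2) B B',
      totalD hn 0 C' (F (Function.update A i 1) ![] B B') =
        totalD hn 1 C' (F (Function.update A i 0) ![] B B') := by
    intro i A C' B B'
    refine Subtype.ext (funext fun j => ?_)
    have h := hX.symmetry_eq i A C' B B' 0 j
    simp only [hXF, ← totalD_apply hn] at h
    simp [eps] at h
    linear_combination -h
  -- The second derivatives vanish at every jet, not only at zero, because the symbol has local
  -- functions as coefficients. By Taylor's formula X is then affine in the jet.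
  have hsymb : ∀ A B B', symb hn 2 (F A ![] B B') = 0 := by
    intro A B B'
    have h := eq_zero_of_field_equation (D := totalDHom hn)
      (fun C C' E E' a => totalD_comm hn C C' E E' a)
      (Y := fun c => symb hn 2 (F (Function.update A ⟨0, hn⟩ c) ![] B B'))
      (fun C' => by rw [← symb_totalD, ← symb_totalD, hfield]) (A ⟨0, hn⟩)
    rwa [Function.update_eq_self] at h
  obtain ⟨c, hc⟩ := eq_strMom_of_covariant
    (P := fun A A' B B' => symbZero hn 1 (F A A' B B'))
    (fun τ τ' A A' B B' => by
      have := hsym 1 τ τ' A A' B B'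
      rw [Equiv.Perm.coe_one, Function.comp_id] at this
      rw [this])
    (fun g o A A' B B' => eval_symbZero_covariant hn hcov g (fun _ => o) A A' B B')
    (fun A A' B B' h => by
      have hA : A ≠ 0 := h.resolve_right fun h' => h' (Subsingleton.elim _ _)
      obtain ⟨i, hi⟩ := Function.ne_iff.mp hA
      have hi' : A i = 1 := by
        change A i ≠ 0 at hi
        omega
      -- At the momentum with π = π̃ = (1, 0) only D₀₀ survives, so the field equation kills every
      -- component with an index A equal to 1.
      have h1 := congrArg (fun F => eval (slicePt fun _ => ![1, 0]) (symbZero hn 1 F))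
        (hfield i A 0 B B')
      have hu : Function.update A i 1 = A := by rw [← hi', Function.update_eq_self]
      simp only [symbZero_totalD, map_mul, totalMom_eq, hu] at h1
      rw [Subsingleton.elim A' ![]]
      simpa using h1)
  have hlin : ∀ A A' B B' (j : Jet n), (F A A' B B' : Jet n → ℂ) j =
      evalZero n (F A A' B B') + c * jetCoord j (listExp (List.ofFn B ++ List.ofFn A)
        (List.ofFn B')) := by
    intro A A' B B' j
    rw [Subsingleton.elim A' ![]]
    have h := congrArg (fun F : localFn n => (F : Jet n → ℂ) j) (taylor_two hn (F A ![] B B'))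
    rw [hsymb, map_zero, map_zero, add_zero, hc, realizeC_strMom_mul] at h
    refine h.trans ?_
    have e : listExp (List.ofFn B ++ List.ofFn A) (List.ofFn B') =
        strExp A (![] : Idx 0) + strExp B B' := by
      rw [← listExp_ofFn, ← listExp_ofFn, ← listExp_append]
      simp only [listExp, List.map_append, List.sum_append, List.ofFn_zero, List.nil_append]
      abel
    rw [e]
    rfl
  obtain ⟨L, hL⟩ : ∃ L : SpinorFn n n 0 p q, ∀ x j A A' B B', L x j A A' B B' =
      jetCoord j (listExp (List.ofFn B ++ List.ofFn A) (List.ofFn B')) :=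
    ⟨fun _ j A _ B B' => _, fun _ _ _ _ _ _ => rfl⟩
  have hXeq : X = (fun _ _ A A' B B' => evalZero n (F A A' B B')) + c • L := by
    funext x j A A' B B'
    rw [hXF, hlin, ← hL x j A A' B B']
    rfl
  obtain ⟨⟨d, hd⟩, h0⟩ := eq_smul_elementary (V := fun A A' B B' => evalZero n (F A A' B B'))
    (fun σ τ τ' A A' B B' => by rw [hsym]) (evalZero_invariant hcov)
  rw [hXeq]
  refine Submodule.add_mem _ ?_ (Submodule.smul_mem _ _ ?_)
  · by_cases hpq : p = n ∧ q = 0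
    · have h1 : (fun _ _ A A' B B' => evalZero n (F A A' B B') : SpinorFn n n 0 p q) =
          d • elementaryOperator n p q := by
        funext x j
        exact hd j x
      rw [h1]
      exact Submodule.smul_mem _ _ (Submodule.subset_span (.elementary hpq.1 hpq.2))
    · have h1 : (fun _ _ A A' B B' => evalZero n (F A A' B B') : SpinorFn n n 0 p q) = 0 := by
        funext x j
        exact h0 hpq
      rw [h1]
      exact Submodule.zero_mem _
  · by_cases h1 : q = p
    · have h2 : L = spacetimeOperator n p q := by
        funext x j A A' B B'
        rw [hL]
        exact (fld_eq_jetCoord j (by simp [add_comm]) (by simp [h1])).symm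
      rw [h2]
      exact Submodule.subset_span (.spacetime h1)
    · by_cases h2 : q = 2 * n + p
      · have h3 : L = chiralOperator n p q := by
          funext x j A A' B B'
          rw [hL]
          exact (cfld_eq_jetCoord hn j (by simp [add_comm]) (by simp [h2]; ring)).symm
        rw [h3]
        exact Submodule.subset_span (.chiral h2)
      -- For all other numbers of indices the label p + n, q belongs to no jet coordinate.
      · have h3 : L = 0 := by
          funext x j A A' B B'
          rw [hL, jetCoord_eq_zero]
          · rfl
          · simp [JetExp.IsPos, deg_listExp]
            omega
          · simp [JetExp.IsNeg, deg_listExp]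
            omega
        rw [h3]
        exact Submodule.zero_mem _

end Operators

/-! ### Curls -/

section Curls

open MvPolynomial

variable {G H : Type*} [AddCommGroup G] [Module ℂ G] [AddCommGroup H] [Module ℂ H]

/-- `T_{AA'} = D_A^{C'} θ_{A'C'} + D_{A'}^C ψ_{AC}` with symmetric `θ`, `ψ`. -/
def IsSpinorCurl (D : Fin 2 → Fin 2 → G →ₗ[ℂ] G) (T : Fin 2 → Fin 2 → G) : Prop :=
  ∃ θ ψ : Fin 2 → Fin 2 → G, (∀ A B, θ A B = θ B A) ∧ (∀ A B, ψ A B = ψ B A) ∧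
    ∀ A A', T A A' = (∑ C' : Fin 2, ∑ E' : Fin 2, eps C' E' • D A E' (θ A' C')) +
      ∑ C : Fin 2, ∑ E : Fin 2, eps C E • D E A' (ψ A C)

variable {D : Fin 2 → Fin 2 → G →ₗ[ℂ] G}

theorem IsSpinorCurl.add {T T' : Fin 2 → Fin 2 → G} (h : IsSpinorCurl D T)
    (h' : IsSpinorCurl D T') : IsSpinorCurl D (T + T') := by
  obtain ⟨θ, ψ, h1, h2, h3⟩ := h
  obtain ⟨θ', ψ', h1', h2', h3'⟩ := h'
  refine ⟨θ + θ', ψ + ψ', fun A B => by simp only [Pi.add_apply, h1 A B, h1' A B],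
    fun A B => by simp only [Pi.add_apply, h2 A B, h2' A B], fun A A' => ?_⟩
  simp only [Pi.add_apply, h3, h3', map_add, smul_add, Finset.sum_add_distrib]
  abel

theorem IsSpinorCurl.smul {T : Fin 2 → Fin 2 → G} (c : ℂ) (h : IsSpinorCurl D T) :
    IsSpinorCurl D (c • T) := by
  obtain ⟨θ, ψ, h1, h2, h3⟩ := h
  refine ⟨c • θ, c • ψ, fun A B => by simp only [Pi.smul_apply, h1 A B],
    fun A B => by simp only [Pi.smul_apply, h2 A B], fun A A' => ?_⟩
  simp only [Pi.smul_apply, h3, map_smul, smul_add, Finset.smul_sum, smul_comm c]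

theorem IsSpinorCurl.map {D' : Fin 2 → Fin 2 → H →ₗ[ℂ] H} (L : G →ₗ[ℂ] H)
    (hL : ∀ C C' x, L (D C C' x) = D' C C' (L x)) {T : Fin 2 → Fin 2 → G}
    (h : IsSpinorCurl D T) : IsSpinorCurl D' fun A A' => L (T A A') := by
  obtain ⟨θ, ψ, h1, h2, h3⟩ := h
  refine ⟨fun A B => L (θ A B), fun A B => L (ψ A B), fun A B => congrArg L (h1 A B),
    fun A B => congrArg L (h2 A B), fun A A' => ?_⟩
  simp only [h3, map_add, map_sum, map_smul, hL]

/-- The components of a current with upper indices. -/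
def raise (T : Fin 2 → Fin 2 → G) (c : Fin 2 × Fin 2) : G :=
  ∑ A, ∑ A', (eps A c.1 * eps A' c.2) • T A A'

theorem raise_one_one (T : Fin 2 → Fin 2 → G) : raise T (1, 1) = T 0 0 := by
  simp [raise, eps]

theorem raise_one_zero (T : Fin 2 → Fin 2 → G) : raise T (1, 0) = -T 0 1 := by
  simp [raise, eps]

theorem raise_zero_one (T : Fin 2 → Fin 2 → G) : raise T (0, 1) = -T 1 0 := by
  simp [raise, eps]

theorem raise_zero_zero (T : Fin 2 → Fin 2 → G) : raise T (0, 0) = T 1 1 := by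
  simp [raise, eps]

/-- Divergences of skew tensors are curls. -/
theorem isSpinorCurl_of_skew {T : Fin 2 → Fin 2 → G}
    {Θ : Fin 2 × Fin 2 → Fin 2 × Fin 2 → G} (hskew : ∀ a b, Θ b a = -Θ a b)
    (hdiag : ∀ a, Θ a a = 0) (hT : ∀ a, raise T a = ∑ b, D b.1 b.2 (Θ a b)) :
    IsSpinorCurl D T := by
  have h11 := hT (1, 1)
  have h10 := hT (1, 0)
  have h01 := hT (0, 1)
  have h00 := hT (0, 0)
  rw [raise_one_one] at h11
  rw [raise_one_zero] at h10
  rw [raise_zero_one] at h01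
  rw [raise_zero_zero] at h00
  simp only [Fintype.sum_prod_type, Fin.sum_univ_two, hdiag, map_zero] at h11 h10 h01 h00
  rw [neg_eq_iff_eq_neg] at h10 h01
  -- The decomposition of a skew tensor into its two symmetric spinor parts. The components
  -- (1,1)(0,0) and (1,0)(0,1) are shared between them, whence the halves.
  refine ⟨!![Θ (1, 1) (0, 1), -(2 : ℂ)⁻¹ • (Θ (1, 1) (0, 0) + Θ (1, 0) (0, 1));
      -(2 : ℂ)⁻¹ • (Θ (1, 1) (0, 0) + Θ (1, 0) (0, 1)), Θ (1, 0) (0, 0)],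
    !![Θ (1, 1) (1, 0), (2 : ℂ)⁻¹ • (Θ (1, 0) (0, 1) - Θ (1, 1) (0, 0));
      (2 : ℂ)⁻¹ • (Θ (1, 0) (0, 1) - Θ (1, 1) (0, 0)), Θ (0, 1) (0, 0)], ?_, ?_, ?_⟩
  · intro A B
    fin_cases A <;> fin_cases B <;> rfl
  · intro A B
    fin_cases A <;> fin_cases B <;> rfl
  · rw [hskew (1, 1) (1, 0)] at h10
    rw [hskew (1, 1) (0, 1), hskew (1, 0) (0, 1)] at h01
    rw [hskew (1, 1) (0, 0), hskew (1, 0) (0, 0), hskew (0, 1) (0, 0)] at h00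
    intro A A'
    fin_cases A <;> fin_cases A' <;>
      simp [Fin.sum_univ_two, eps, h11, h10, h01, h00] <;> module

variable {n m : ℕ}

/-- Multiplication by the total momentum, as a linear map. -/
def momLin (m : ℕ) (C C' : Fin 2) : MvPolynomial (MomVar m) ℂ →ₗ[ℂ] MvPolynomial (MomVar m) ℂ :=
  LinearMap.mulLeft ℂ (totalMom ℂ m C C')

@[simp] theorem momLin_apply (C C' : Fin 2) (P : MvPolynomial (MomVar m) ℂ) :
    momLin m C C' P = totalMom ℂ m C C' * P := rfl

/-- The total derivatives, as linear maps. -/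
def totalDLin (hn : 1 ≤ n) (C C' : Fin 2) : localFn n →ₗ[ℂ] localFn n := totalD hn C C'

@[simp] theorem totalDLin_apply (hn : 1 ≤ n) (C C' : Fin 2) (F : localFn n) :
    totalDLin hn C C' F = totalD hn C C' F := rfl

theorem IsSpinorCurl.realizeC (hn : 1 ≤ n) {P : Fin 2 → Fin 2 → MvPolynomial (MomVar m) ℂ}
    (h : IsSpinorCurl (momLin m) P) :
    IsSpinorCurl (totalDLin hn) fun A A' => realizeC n m (P A A') :=
  IsSpinorCurl.map (D := momLin m) (D' := totalDLin hn) (MasslessSpin.realizeC n m)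
    (fun C C' P => by rw [momLin_apply, totalDLin_apply, totalD_realizeC]) h

theorem raise_map (L : G →+ H) (hL : ∀ (c : ℂ) x, L (c • x) = c • L x) (T : Fin 2 → Fin 2 → G)
    (c : Fin 2 × Fin 2) : L (raise T c) = raise (fun A A' => L (T A A')) c := by
  simp only [raise, map_sum, hL]

/-- The cubic remainder of a conserved current is a curl. -/
theorem isSpinorCurl_remainder (hn : 1 ≤ n) {T : Fin 2 → Fin 2 → localFn n}
    (hT : ∑ c, totalD hn c.1 c.2 (raise T c) = 0) :
    IsSpinorCurl (totalDLin hn) fun A A' => realize n 3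
      (coeffMap (rayMean (taylorWeight 2) : localFn n →ₗ[ℂ] localFn n).toAddMonoidHom
        (symb hn 3 (T A A'))) := by
  have h1 : ∑ c, nabla (totalDHom hn) c.1 c.2 (symb hn 3 (raise T c)) = 0 := by
    simp only [← symb_totalD, ← symb_sum, hT, symb_zero]
  obtain ⟨Θ, hskew, hdiag, hΘ⟩ := exists_potential_trilinear (D := totalDHom hn)
    (fun C C' E E' a => totalD_comm hn C C' E E' a) _ h1
  -- The potential of the third symbol is averaged coefficientwise. This commutes with `nabla`
  -- because ray means commute with D, so realizing it gives a potential of the remainder.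
  let J : MvPolynomial (MomVar 3) (localFn n) →+ MvPolynomial (MomVar 3) (localFn n) :=
    coeffMap (rayMean (taylorWeight 2) : localFn n →ₗ[ℂ] localFn n).toAddMonoidHom
  have hJ : ∀ C C' f, J (nabla (totalDHom hn) C C' f) = nabla (totalDHom hn) C C' (J f) := by
    intro C C' f
    rw [nabla_apply, nabla_apply, map_add, coeffMap_totalMom_mul]
    congr 1
    ext κ : 1
    simp only [J, coeff_coeffMap, totalDHom_apply, LinearMap.toAddMonoidHom_coe, totalD_rayMean]
  let L : localFn n →+ localFn n :=
    { toFun := fun F => realize n 3 (J (symb hn 3 F))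
      map_zero' := by rw [symb_zero, map_zero, map_zero]
      map_add' := fun F F' => by
        have : symb hn 3 (F + F') = symb hn 3 F + symb hn 3 F' := by
          rw [← sub_neg_eq_add, symb_sub, ← zero_sub, symb_sub, symb_zero]
          ring
        rw [this, map_add, map_add] }
  have hLs : ∀ (c : ℂ) F, L (c • F) = c • L F := by
    intro c F
    have h2 : J (symb hn 3 (c • F)) = algebraMap ℂ (localFn n) c • J (symb hn 3 F) := by
      ext κ : 1
      rw [coeff_smul]
      simp only [J, coeff_coeffMap, coeff_symb, LinearMap.toAddMonoidHom_coe, map_smul]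
      rw [algebraMap_smul]
    change realize n 3 (J (symb hn 3 (c • F))) = c • realize n 3 (J (symb hn 3 F))
    rw [h2, map_smul, algebraMap_smul]
  refine isSpinorCurl_of_skew (Θ := fun a b => realize n 3 (J (Θ a b)))
    (fun a b => by rw [hskew, map_neg, map_neg]) (fun a => by rw [hdiag, map_zero, map_zero])
    fun a => ?_
  refine (raise_map L hLs T a).symm.trans ?_
  change realize n 3 (J (symb hn 3 (raise T a))) = _
  rw [hΘ, map_sum, map_sum]
  refine Finset.sum_congr rfl fun b _ => ?_
  rw [hJ, totalDLin_apply, totalD_realize]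

/-- The spinorial coordinates, as real linear functions. -/
def spinLin (A A' : Fin 2) : Minkowski →ₗ[ℝ] ℂ where
  toFun x := spinCoord x A A'
  map_add' x y := by simp [spinCoord, add_mul, Finset.sum_add_distrib]
  map_smul' t x := by simp [spinCoord, Finset.mul_sum, mul_assoc]

theorem spinLin_single (a : Fin 4) (A A' : Fin 2) :
    spinLin A A' (Pi.single a 1) = soldering a A A' := by
  change ∑ b, ((Pi.single a 1 : Minkowski) b : ℂ) * soldering b A A' = _
  rw [Finset.sum_eq_single a]
  · simp
  · intro b _ hb
    simp [hb]
  · simp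

/-- The total derivative of a linear function of `x` plus a local function of the jet. -/
theorem totalDeriv_lin_add (hn : 1 ≤ n) (ℓ : Minkowski →ₗ[ℝ] ℂ) (F : localFn n) (C C' : Fin 2)
    (x : Minkowski) (j : Jet n) :
    totalDeriv C C' (fun x j => ℓ x + (F : Jet n → ℂ) j) x j =
      (∑ a, invSoldering a C C' * ℓ (Pi.single a 1)) + (totalD hn C C' F : Jet n → ℂ) j := by
  rw [totalD_apply hn C C' F x, totalDeriv, totalDeriv, ← Finset.sum_add_distrib]
  refine Finset.sum_congr rfl fun a _ => ?_
  rw [← mul_add]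
  congr 1
  have h1 := hasLineDerivAt_localFn F j (j.shiftVec a)
  have h2 : HasDerivAt (fun t : ℝ => ℓ (x + t • Pi.single a 1)) (ℓ (Pi.single a 1)) 0 := by
    simp only [map_add, map_smul]
    simpa using ((hasDerivAt_id (0 : ℝ)).smul_const (ℓ (Pi.single a 1))).const_add (ℓ x)
  exact (h2.add h1).deriv

/-- A potential, linear in `x`, of a constant current. -/
def constPotential (V : Fin 2 → Fin 2 → ℂ) (A' C' : Fin 2) : Minkowski →ₗ[ℝ] ℂ :=
  ∑ F, ∑ F', ((V F A' * eps C' F' + V F C' * eps A' F') / 3) • spinLin F F'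

theorem constPotential_symm (V : Fin 2 → Fin 2 → ℂ) (A' C' : Fin 2) :
    constPotential V A' C' = constPotential V C' A' := by
  simp only [constPotential, add_comm]

/-- In the contraction with ε over C' and E' the first term gives V twice and the second once, which
explains the denominator 3. -/
theorem sum_invSoldering_constPotential (V : Fin 2 → Fin 2 → ℂ) (A' C' C E' : Fin 2) :
    ∑ a, invSoldering a C E' * constPotential V A' C' (Pi.single a 1) =
      (V C A' * eps C' E' + V C C' * eps A' E') / 3 := by
  have h1 : ∀ a, constPotential V A' C' (Pi.single a 1) = ∑ F, ∑ F',
      ((V F A' * eps C' F' + V F C' * eps A' F') / 3) * soldering a F F' := by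
    intro a
    simp [constPotential, spinLin_single]
  have h2 : ∀ f : Fin 2 → Fin 2 → ℂ, ∑ a, invSoldering a C E' * ∑ F, ∑ F', f F F' *
      soldering a F F' = f C E' := by
    intro f
    have h3 : ∀ a, invSoldering a C E' * ∑ F, ∑ F', f F F' * soldering a F F' =
        ∑ F, ∑ F', f F F' * (invSoldering a C E' * soldering a F F') := by
      intro a
      simp only [Finset.mul_sum]
      exact Finset.sum_congr rfl fun F _ => Finset.sum_congr rfl fun F' _ => by ring
    simp only [h3]
    rw [Finset.sum_comm, Finset.sum_congr rfl fun F _ => Finset.sum_comm]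
    simp only [← Finset.mul_sum, soldering_completeness]
    fin_cases C <;> fin_cases E' <;> simp
  simp only [h1, h2]

/-- The sorted rearrangement of an index string. -/
def sortIdx {k : ℕ} (B : Idx k) : Idx k := wordIdx k (Finset.univ.filter fun i => B i = 0).card

theorem sortIdx_comp {k : ℕ} (B : Idx k) (τ : Equiv.Perm (Fin k)) : sortIdx (B ∘ τ) = sortIdx B := by
  rw [sortIdx, sortIdx]
  congr 1
  refine Finset.card_bij (fun i _ => τ i) ?_ ?_ ?_
  · simp
  · intro i _ i' _ h
    exact τ.injective h
  · intro i hi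
    exact ⟨τ.symm i, by simpa using hi, by simp⟩

theorem exists_sortIdx_comp {k : ℕ} (B : Idx k) : ∃ σ : Equiv.Perm (Fin k), sortIdx B ∘ σ = B :=
  exists_perm_of_card_zero_eq (by
    rw [sortIdx, card_wordIdx]
    exact (Finset.card_le_univ _).trans (by simp))

theorem exists_represents {ι : Type*} [Fintype ι] (F : ι → localFn n) :
    ∃ r, ∀ i, ∃ f : JetUpTo n r → ℂ, Represents f (F i : Jet n → ℂ) := by
  choose r f hf using fun i => (F i).2
  refine ⟨Finset.univ.sup r, fun i => ⟨_, (hf i).raise (Finset.le_sup (Finset.mem_univ i))⟩⟩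

/-- Symmetric spinor functions, which are sums of a constant and of a curl for fixed indices
`B_p`, `B'_q`, are curls. -/
theorem isCurl_of_components (hn : 1 ≤ n) {p q : ℕ} {T : SpinorFn n 1 1 p q}
    (hsym : ∀ (τ : Equiv.Perm (Fin p)) (τ' : Equiv.Perm (Fin q)) x j A A' B B',
      T x j A A' (B ∘ τ) (B' ∘ τ') = T x j A A' B B')
    (V : Idx p → Idx q → Fin 2 → Fin 2 → ℂ) (S : Idx p → Idx q → Fin 2 → Fin 2 → localFn n)
    (hT : ∀ x j A A' B B', T x j ![A] ![A'] B B' = V B B' A A' + (S B B' A A' : Jet n → ℂ) j)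
    (hS : ∀ B B', IsSpinorCurl (totalDLin hn) (S B B')) : IsCurl T := by
  choose θ ψ hθ hψ h using hS
  obtain ⟨r, hr⟩ := exists_represents fun i : Idx p × Idx q × Fin 2 × Fin 2 =>
    θ i.1 i.2.1 i.2.2.1 i.2.2.2
  choose f hf using hr
  obtain ⟨s, hs⟩ := exists_represents fun i : Idx p × Idx q × Fin 2 × Fin 2 =>
    ψ i.1 i.2.1 i.2.2.1 i.2.2.2
  choose g hg using hs
  -- Potentials are chosen for each B, B' separately and so need not be symmetric in these indices;
  -- evaluating them at the sorted strings makes them so.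
  refine ⟨fun x j _ A' B B' => constPotential (V (sortIdx B) (sortIdx B')) (A' 0) (A' 1) x +
      (θ (sortIdx B) (sortIdx B') (A' 0) (A' 1) : Jet n → ℂ) j,
    fun x j A _ B B' => (ψ (sortIdx B) (sortIdx B') (A 0) (A 1) : Jet n → ℂ) j,
    ⟨r, fun y _ A' B B' => constPotential (V (sortIdx B) (sortIdx B')) (A' 0) (A' 1) y.1 +
      f (sortIdx B, sortIdx B', A' 0, A' 1) y.2, ?_, fun x j => ?_⟩, ?_,
    ⟨s, fun y A _ B B' => g (sortIdx B, sortIdx B', A 0, A 1) y.2, ?_, fun x j => ?_⟩, ?_, ?_⟩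
  · refine contDiff_pi.mpr fun _ => contDiff_pi.mpr fun A' => contDiff_pi.mpr fun B =>
      contDiff_pi.mpr fun B' => ContDiff.add ?_ ((hf _).1.comp contDiff_snd)
    exact (LinearMap.toContinuousLinearMap
      (constPotential (V (sortIdx B) (sortIdx B')) (A' 0) (A' 1))).contDiff.comp contDiff_fst
  · funext _ A' B B'
    exact congrArg _ ((hf (sortIdx B, sortIdx B', A' 0, A' 1)).2 j)
  · intro σ σ' τ τ' x j A A' B B'
    simp only [sortIdx_comp]
    have h3 : (σ' 0 = 0 ∧ σ' 1 = 1) ∨ (σ' 0 = 1 ∧ σ' 1 = 0) := by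
      have h4 : σ' 0 ≠ σ' 1 := fun h => absurd (σ'.injective h) (by decide)
      omega
    rcases h3 with ⟨h4, h5⟩ | ⟨h4, h5⟩
    · simp only [Function.comp_apply, h4, h5]
    · simp only [Function.comp_apply, h4, h5]
      rw [constPotential_symm, hθ]
  · refine contDiff_pi.mpr fun A => contDiff_pi.mpr fun _ => contDiff_pi.mpr fun B =>
      contDiff_pi.mpr fun B' => (hg _).1.comp contDiff_snd
  · funext A _ B B'
    exact (hg (sortIdx B, sortIdx B', A 0, A 1)).2 j
  · intro σ σ' τ τ' x j A A' B B'
    simp only [sortIdx_comp]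
    have h3 : (σ 0 = 0 ∧ σ 1 = 1) ∨ (σ 0 = 1 ∧ σ 1 = 0) := by
      have h4 : σ 0 ≠ σ 1 := fun h => absurd (σ.injective h) (by decide)
      omega
    rcases h3 with ⟨h4, h5⟩ | ⟨h4, h5⟩
    · simp only [Function.comp_apply, h4, h5]
    · simp only [Function.comp_apply, h4, h5]
      rw [hψ]
  · intro x j A A' B B'
    obtain ⟨τ, hτ⟩ := exists_sortIdx_comp B
    obtain ⟨τ', hτ'⟩ := exists_sortIdx_comp B'
    have h1 : T x j ![A] ![A'] B B' = T x j ![A] ![A'] (sortIdx B) (sortIdx B') := by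
      conv_lhs => rw [← hτ, ← hτ']
      exact hsym _ _ _ _ _ _ _ _
    rw [h1, hT, h]
    simp only [Matrix.cons_val_zero, Matrix.cons_val_one, totalDeriv_lin_add hn,
      sum_invSoldering_constPotential, ← totalD_apply hn]
    have h2 : ∀ (c : ℂ) (K : localFn n), ((c • K : localFn n) : Jet n → ℂ) j =
      c * (K : Jet n → ℂ) j := fun _ _ => rfl
    have h3 : ∀ K K' : localFn n, ((K + K' : localFn n) : Jet n → ℂ) j =
      (K : Jet n → ℂ) j + (K' : Jet n → ℂ) j := fun _ _ => rfl
    rw [h3]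
    simp only [coe_finset_sum, h2, totalDLin_apply, mul_add, Finset.sum_add_distrib]
    rw [← add_assoc]
    congr 2
    fin_cases A' <;> simp [eps] <;> ring

end Curls

/-! ### Linear currents -/

section LinearPart

open MvPolynomial

variable {n : ℕ}

theorem exists_mul_of_mul_X_eq {σ : Type*} {a b : MvPolynomial σ ℂ} {s t : σ} (hst : s ≠ t)
    (h : a * X s = b * X t) : ∃ y, a = X t * y ∧ b = X s * y := by
  have h1 : X t ∣ a * X s := ⟨b, by rw [h, mul_comm]⟩
  rw [X_dvd_mul_iff] at h1
  rcases h1 with ⟨y, rfl⟩ | h1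
  · refine ⟨y, rfl, mul_right_cancel₀ (X_ne_zero t) ?_⟩
    rw [← h]
    ring
  · exact absurd (X_dvd_X.mp h1).symm hst

theorem totalMom_one (C C' : Fin 2) :
    totalMom ℂ 1 C C' = X (0, false, C) * X (0, true, C') := by
  rw [totalMom_eq, Fin.sum_univ_one]

/-- The hypotheses say that Z is proportional to π̃ in A' and to π in A. The two components of
either spinor are coprime, so the factors of proportionality are polynomials. -/
theorem exists_eq_mom_mul {Z : Fin 2 → Fin 2 → MvPolynomial (MomVar 1) ℂ}
    (h1 : ∀ A, Z A 0 * X (0, true, 1) = Z A 1 * X (0, true, 0))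
    (h2 : ∀ A', Z 0 A' * X (0, false, 1) = Z 1 A' * X (0, false, 0)) :
    ∃ R, ∀ A A', Z A A' = totalMom ℂ 1 A A' * R := by
  choose y hy0 hy1 using fun A => exists_mul_of_mul_X_eq (by simp) (h1 A)
  have h3 : y 0 * X (0, false, 1) = y 1 * X (0, false, 0) := by
    refine mul_left_cancel₀ (X_ne_zero (R := ℂ) ((0, true, 0) : MomVar 1)) ?_
    have := h2 0
    rw [hy0, hy0] at this
    linear_combination this
  obtain ⟨R, hR0, hR1⟩ := exists_mul_of_mul_X_eq (by simp) h3
  refine ⟨R, fun A A' => ?_⟩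
  rw [totalMom_one]
  fin_cases A <;> fin_cases A' <;> simp [hy0, hy1, hR0, hR1] <;> ring

theorem IsSpinorCurl.mul {m : ℕ} {P : Fin 2 → Fin 2 → MvPolynomial (MomVar m) ℂ}
    (h : IsSpinorCurl (momLin m) P) (f : MvPolynomial (MomVar m) ℂ) :
    IsSpinorCurl (momLin m) fun A A' => f * P A A' :=
  IsSpinorCurl.map (LinearMap.mulLeft ℂ f)
    (fun C C' x => by
      simp only [LinearMap.mulLeft_apply, momLin_apply]
      ring) h

theorem isSpinorCurl_mom_mul_X (v : MomVar 1) :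
    IsSpinorCurl (momLin 1) fun A A' => totalMom ℂ 1 A A' * X v := by
  obtain ⟨i, b, c⟩ := v
  rw [Subsingleton.elim i 0]
  have hsym : ∀ (a b c : MvPolynomial (MomVar 1) ℂ) (A B : Fin 2),
      !![a, b; b, c] A B = !![a, b; b, c] B A := by
    intro a b c A B
    fin_cases A <;> fin_cases B <;> rfl
  have h0 : ∀ A B : Fin 2, (0 : Fin 2 → Fin 2 → MvPolynomial (MomVar 1) ℂ) A B =
      (0 : Fin 2 → Fin 2 → MvPolynomial (MomVar 1) ℂ) B A := fun _ _ => rfl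
  cases b
  · fin_cases c
    · refine ⟨0, !![0, -X (0, false, 0); -X (0, false, 0), -2 * X (0, false, 1)], h0, hsym _ _ _, ?_⟩
      intro A A'
      fin_cases A <;> simp [eps, totalMom_one]; ring
    · refine ⟨0, !![2 * X (0, false, 0), X (0, false, 1); X (0, false, 1), 0], h0, hsym _ _ _, ?_⟩
      intro A A'
      fin_cases A <;> simp [eps, totalMom_one]; ring
  · fin_cases c
    · refine ⟨!![0, -X (0, true, 0); -X (0, true, 0), -2 * X (0, true, 1)], 0, hsym _ _ _, h0, ?_⟩
      intro A A'
      fin_cases A' <;> simp [eps, totalMom_one]; ring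
    · refine ⟨!![2 * X (0, true, 0), X (0, true, 1); X (0, true, 1), 0], 0, hsym _ _ _, h0, ?_⟩
      intro A A'
      fin_cases A' <;> simp [eps, totalMom_one]; ring

theorem IsSpinorCurl.zero {G : Type*} [AddCommGroup G] [Module ℂ G]
    {D : Fin 2 → Fin 2 → G →ₗ[ℂ] G} : IsSpinorCurl D 0 :=
  ⟨0, 0, fun _ _ => rfl, fun _ _ => rfl, fun A A' => by simp⟩

/-- Every nonconstant monomial of R contains a variable, for which a potential is explicit, and the
remaining factor passes through the curl. -/
theorem isSpinorCurl_mom_mul_sub (R : MvPolynomial (MomVar 1) ℂ) :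
    IsSpinorCurl (momLin 1) fun A A' => totalMom ℂ 1 A A' * (R - C (constantCoeff R)) := by
  induction R using MvPolynomial.induction_on with
  | C a =>
    convert IsSpinorCurl.zero (D := momLin 1) using 1
    funext A A'
    simp
  | add p q hp hq =>
    convert hp.add hq using 1
    funext A A'
    simp only [Pi.add_apply, map_add]
    ring
  | mul_X p v hp =>
    convert (isSpinorCurl_mom_mul_X v).mul p using 1
    funext A A'
    simp
    ring

/-- Currents of the form `π_A π̃_{A'} R` are trivial. -/
theorem isSpinorCurl_realizeC_mom_mul (hn : 1 ≤ n) (R : MvPolynomial (MomVar 1) ℂ) :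
    IsSpinorCurl (totalDLin hn) fun A A' => realizeC n 1 (totalMom ℂ 1 A A' * R) := by
  convert (isSpinorCurl_mom_mul_sub R).realizeC hn using 1
  funext A A'
  rw [mul_sub, map_sub]
  -- The constant term would realize as a coordinate with one unprimed and one primed index, which
  -- does not exist for n ≥ 1.
  have h : realizeC n 1 (totalMom ℂ 1 A A' * C (constantCoeff R)) = 0 := by
    rw [mul_comm, ← smul_eq_C_mul, map_smul, totalMom, Fin.sum_univ_one, realizeC_monomial,
      part_momExp]
    have h1 : coordFn n (dirExp A A') = 0 := by
      refine Subtype.ext (funext fun j => jetCoord_eq_zero j ?_ ?_)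
      · rw [JetExp.IsPos, deg_dirExp, deg_dirExp]
        omega
      · rw [JetExp.IsNeg, deg_dirExp, deg_dirExp]
        omega
    simp [h1]
  rw [h, sub_zero]

/-- The currents `π_A ε_{A'b} M`. -/
def epsCurrent (b : Fin 2) (M : MvPolynomial (MomVar 1) ℂ) (A A' : Fin 2) :
    MvPolynomial (MomVar 1) ℂ := C (eps A' b) * (X (0, false, A) * M)

/-- The currents `ε_{Ab} π̃_{A'} M`. -/
def epsCurrent' (b : Fin 2) (M : MvPolynomial (MomVar 1) ℂ) (A A' : Fin 2) :
    MvPolynomial (MomVar 1) ℂ := C (eps A b) * (X (0, true, A') * M)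

/-- The part symmetric in b, b' is the curl of the symmetric product of two ε's; the skew part is
ε_{bb'} times π_A π̃_{A'} M, which is trivial. Hence a current π_A ε_{A'b} M is trivial as soon as M
contains a factor π̃. -/
theorem isSpinorCurl_epsCurrent (hn : 1 ≤ n) (b b' : Fin 2) (M : MvPolynomial (MomVar 1) ℂ) :
    IsSpinorCurl (totalDLin hn) fun A A' =>
      realizeC n 1 (epsCurrent b (X (0, true, b') * M) A A') := by
  have h1 : IsSpinorCurl (momLin 1) fun A A' : Fin 2 =>
      epsCurrent b (X (0, true, b')) A A' + epsCurrent b' (X (0, true, b)) A A' := by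
    refine ⟨fun A' C' => C (eps A' b * eps C' b' + eps A' b' * eps C' b), 0,
      fun A' C' => congrArg C (by ring), fun _ _ => rfl, fun A A' => ?_⟩
    simp only [epsCurrent]
    fin_cases A' <;> fin_cases b <;> fin_cases b' <;> simp [eps, totalMom_one] <;> ring
  have h2 : ∀ A A' : Fin 2, epsCurrent b (X (0, true, b')) A A' -
      epsCurrent b' (X (0, true, b)) A A' = totalMom ℂ 1 A A' * C (-eps b b') := by
    intro A A'
    simp only [epsCurrent, totalMom_one]
    fin_cases A' <;> fin_cases b <;> fin_cases b' <;> simp [eps]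
  convert (((h1.mul M).realizeC hn).add
    (isSpinorCurl_realizeC_mom_mul hn (C (-eps b b') * M))).smul (2 : ℂ)⁻¹ using 1
  funext A A'
  rw [Pi.smul_apply, Pi.smul_apply, Pi.add_apply, Pi.add_apply, ← map_add,
    eq_inv_smul_iff₀ two_ne_zero, ← map_smul, ← mul_assoc, ← h2]
  congr 1
  rw [ofNat_smul_eq_nsmul, nsmul_eq_mul]
  simp only [epsCurrent]
  push_cast
  ring

theorem isSpinorCurl_epsCurrent' (hn : 1 ≤ n) (b b' : Fin 2) (M : MvPolynomial (MomVar 1) ℂ) :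
    IsSpinorCurl (totalDLin hn) fun A A' =>
      realizeC n 1 (epsCurrent' b (X (0, false, b') * M) A A') := by
  have h1 : IsSpinorCurl (momLin 1) fun A A' : Fin 2 =>
      epsCurrent' b (X (0, false, b')) A A' + epsCurrent' b' (X (0, false, b)) A A' := by
    refine ⟨0, fun A E => C (eps A b * eps E b' + eps A b' * eps E b), fun _ _ => rfl,
      fun A E => congrArg C (by ring), fun A A' => ?_⟩
    simp only [epsCurrent']
    fin_cases A <;> fin_cases b <;> fin_cases b' <;> simp [eps, totalMom_one] <;> ring
  have h2 : ∀ A A' : Fin 2, epsCurrent' b (X (0, false, b')) A A' -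
      epsCurrent' b' (X (0, false, b)) A A' = totalMom ℂ 1 A A' * C (-eps b b') := by
    intro A A'
    simp only [epsCurrent', totalMom_one]
    fin_cases A <;> fin_cases b <;> fin_cases b' <;> simp [eps] <;> ring
  convert (((h1.mul M).realizeC hn).add
    (isSpinorCurl_realizeC_mom_mul hn (C (-eps b b') * M))).smul (2 : ℂ)⁻¹ using 1
  funext A A'
  rw [Pi.smul_apply, Pi.smul_apply, Pi.add_apply, Pi.add_apply, ← map_add,
    eq_inv_smul_iff₀ two_ne_zero, ← map_smul, ← mul_assoc, ← h2]
  congr 1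
  rw [ofNat_smul_eq_nsmul, nsmul_eq_mul]
  simp only [epsCurrent']
  push_cast
  ring

end LinearPart

/-! ### Reduction to the basic tensors -/

section Reduction

open MvPolynomial

variable {n m p q : ℕ}

/-- The product of the momenta `π_{iA}`, `A ∈ L`, and `π̃_{iA'}`, `A' ∈ L'`. -/
def listMom (i : Fin m) (L L' : List (Fin 2)) : MvPolynomial (MomVar m) ℂ :=
  (L.map fun c => X (i, false, c)).prod * (L'.map fun c => X (i, true, c)).prod

theorem listMom_eq_monomial (i : Fin m) (L L' : List (Fin 2)) :
    listMom i L L' = monomial (glue (Pi.single i (listExp L L'))) 1 := by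
  have h : ∀ (s : Bool) (L : List (Fin 2)), (L.map fun c => X (R := ℂ) (i, s, c)).prod =
      monomial (glue (Pi.single i (L.map fun c => Finsupp.single (s, c) 1).sum)) 1 := by
    intro s L
    induction L with
    | nil =>
      have : glue (Pi.single i (([] : List (Fin 2)).map fun c => Finsupp.single (s, c) 1).sum) =
          (0 : MomVar m →₀ ℕ) := by
        ext v
        simp [glue]
      rw [this]
      simp
    | cons c L ih =>
      rw [List.map_cons, List.prod_cons, ih, X, monomial_mul, one_mul, List.map_cons,
        List.sum_cons]
      refine congrArg (fun κ => monomial κ (1 : ℂ)) ?_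
      ext ⟨i', v⟩
      by_cases hi : i' = i
      · subst hi
        simp [glue, Finsupp.single_apply]
      · simp [glue, hi]
  rw [listMom, h, h, monomial_mul, one_mul]
  refine congrArg (fun κ => monomial κ (1 : ℂ)) ?_
  ext ⟨i', v⟩
  by_cases hi : i' = i
  · subst hi
    simp [glue, listExp]
  · simp [glue, hi]

theorem strMom_eq_listMom (i : Fin m) {a b : ℕ} (A : Idx a) (A' : Idx b) :
    strMom i A A' = listMom i (List.ofFn A) (List.ofFn A') := by
  simp [strMom, listMom, List.map_ofFn, List.prod_ofFn]

theorem realizeC_listMom (L L' : List (Fin 2)) :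
    realizeC n 1 (listMom 0 L L') = coordFn n (listExp L L') := by
  rw [listMom_eq_monomial, realizeC_monomial, part_glue]
  simp

theorem realizeC_listMom_mul (L L' M M' : List (Fin 2)) :
    realizeC n 2 (listMom 0 L L' * listMom 1 M M') =
      coordFn n (listExp L L') * coordFn n (listExp M M') := by
  rw [listMom_eq_monomial, listMom_eq_monomial, monomial_mul, one_mul, realizeC_monomial,
    part_add, part_glue, part_glue]
  simp [Fin.prod_univ_two]

theorem listExp_perm {L M L' M' : List (Fin 2)} (h : L.Perm M) (h' : L'.Perm M') :
    listExp L L' = listExp M M' := by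
  rw [listExp, listExp, (h.map _).sum_eq, (h'.map _).sum_eq]

theorem ofFn_comp_perm {k : ℕ} (B : Idx k) (τ : Equiv.Perm (Fin k)) :
    (List.ofFn (B ∘ τ)).Perm (List.ofFn B) :=
  Equiv.Perm.ofFn_comp_perm τ B

theorem symmetrize_eq_of_const {f : List (Fin 2) → List (Fin 2) → ℂ} {B : Idx p} {B' : Idx q}
    {c : ℂ} (h : ∀ (τ : Equiv.Perm (Fin p)) (τ' : Equiv.Perm (Fin q)),
      f (List.ofFn (B ∘ τ)) (List.ofFn (B' ∘ τ')) = c) : symmetrize f B B' = c := by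
  simp only [symmetrize, h, Finset.sum_const, Finset.card_univ, Fintype.card_perm,
    Fintype.card_fin, nsmul_eq_mul]
  have h1 : (p ! : ℂ) ≠ 0 := by exact_mod_cast Nat.factorial_ne_zero p
  have h2 : (q ! : ℂ) ≠ 0 := by exact_mod_cast Nat.factorial_ne_zero q
  field_simp

theorem symmetrize_comp (f : List (Fin 2) → List (Fin 2) → ℂ) (B : Idx p) (B' : Idx q)
    (σ : Equiv.Perm (Fin p)) (σ' : Equiv.Perm (Fin q)) :
    symmetrize f (B ∘ σ) (B' ∘ σ') = symmetrize f B B' := by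
  rw [symmetrize, symmetrize]
  congr 1
  conv_rhs => rw [← Equiv.sum_comp (Equiv.mulLeft σ : Equiv.Perm (Equiv.Perm (Fin p)))]
  refine Finset.sum_congr rfl fun τ _ => ?_
  conv_rhs => rw [← Equiv.sum_comp (Equiv.mulLeft σ' : Equiv.Perm (Equiv.Perm (Fin q)))]
  rfl

theorem symm_of_mem_span {G : SpinorFn n 1 1 p q}
    (hG : G ∈ Submodule.span ℂ (basicTensors n p q)) (τ : Equiv.Perm (Fin p))
    (τ' : Equiv.Perm (Fin q)) (x : Minkowski) (j : Jet n) (A A' : Idx 1) (B : Idx p) (B' : Idx q) :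
    G x j A A' (B ∘ τ) (B' ∘ τ') = G x j A A' B B' := by
  have key : ∀ {p q : ℕ} {T : SpinorFn n 1 1 p q}, IsBasicTensor n p q T →
      ∀ (τ : Equiv.Perm (Fin p)) (τ' : Equiv.Perm (Fin q)) (A A' : Idx 1) (B : Idx p) (B' : Idx q),
        T x j A A' (B ∘ τ) (B' ∘ τ') = T x j A A' B B' := by
    intro p q T hT τ τ' A A' B B'
    cases hT <;> exact symmetrize_comp _ _ _ _ _
  induction hG using Submodule.span_induction with
  | mem G hG =>
    rcases hG with hG | ⟨T, hT, rfl⟩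
    · exact key hG _ _ _ _ _ _
    · exact congrArg conj (key hT _ _ _ _ _ _)
  | zero => rfl
  | add G H _ _ hG hH => exact congrArg₂ (· + ·) hG hH
  | smul c G _ hG => exact congrArg (c * ·) hG

/-- The family of currents `W` is equivalent to a linear combination of basic tensors. -/
def ReducesToBasic (hn : 1 ≤ n) (W : Idx p → Idx q → Fin 2 → Fin 2 → localFn n) : Prop :=
  ∃ G ∈ Submodule.span ℂ (basicTensors n p q), ∃ g : Idx p → Idx q → Fin 2 → Fin 2 → localFn n,
    (∀ x j A A' B B', G x j ![A] ![A'] B B' = (g B B' A A' : Jet n → ℂ) j) ∧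
    ∀ B B', IsSpinorCurl (totalDLin hn) (W B B' - g B B')

namespace ReducesToBasic

variable {hn : 1 ≤ n} {W W' : Idx p → Idx q → Fin 2 → Fin 2 → localFn n}

theorem add (h : ReducesToBasic hn W) (h' : ReducesToBasic hn W') :
    ReducesToBasic hn (W + W') := by
  obtain ⟨G, hG, g, h1, h2⟩ := h
  obtain ⟨G', hG', g', h1', h2'⟩ := h'
  refine ⟨G + G', Submodule.add_mem _ hG hG', g + g', fun x j A A' B B' => ?_, fun B B' => ?_⟩
  · exact congrArg₂ (· + ·) (h1 x j A A' B B') (h1' x j A A' B B')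
  · convert (h2 B B').add (h2' B B') using 1
    simp only [Pi.add_apply]
    abel

theorem smul (c : ℂ) (h : ReducesToBasic hn W) : ReducesToBasic hn (c • W) := by
  obtain ⟨G, hG, g, h1, h2⟩ := h
  refine ⟨c • G, Submodule.smul_mem _ _ hG, c • g, fun x j A A' B B' => ?_, fun B B' => ?_⟩
  · exact congrArg (c * ·) (h1 x j A A' B B')
  · convert (h2 B B').smul c using 1
    simp only [Pi.smul_apply, smul_sub]

theorem of_curl (h : ∀ B B', IsSpinorCurl (totalDLin hn) (W B B')) : ReducesToBasic hn W :=
  ⟨0, Submodule.zero_mem _, 0, fun _ _ _ _ _ _ => rfl, fun B B' => by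
    rw [Pi.zero_apply, Pi.zero_apply, sub_zero]
    exact h B B'⟩

theorem of_basic {G : SpinorFn n 1 1 p q} (hG : G ∈ basicTensors n p q)
    (h : ∀ x j A A' B B', G x j ![A] ![A'] B B' = (W B B' A A' : Jet n → ℂ) j) :
    ReducesToBasic hn W :=
  ⟨G, Submodule.subset_span hG, W, h, fun B B' => by
    rw [sub_self]
    exact IsSpinorCurl.zero⟩

end ReducesToBasic

theorem coordFn_eq_zero {μ : JetExp} (h1 : ¬ μ.IsPos n) (h2 : ¬ μ.IsNeg n) : coordFn n μ = 0 :=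
  Subtype.ext (funext fun j => jetCoord_eq_zero j h1 h2)

theorem conj_jetCoord_listExp (hn : 1 ≤ n) (j : Jet n) (L L' : List (Fin 2)) :
    conj (jetCoord j (listExp L L')) = jetCoord j (listExp L' L) := by
  rw [← jetCoord_swap hn, swap_listExp]

theorem eps_conj (A B : Fin 2) : conj (eps A B) = eps A B := by
  fin_cases A <;> fin_cases B <;> simp [eps]

theorem realizeC_epsCurrent (B : Idx p) (A A' b : Fin 2) (L' : List (Fin 2)) :
    realizeC n 1 (epsCurrent b (listMom 0 (List.ofFn B) L') A A') =
      eps A' b • coordFn n (listExp (A :: List.ofFn B) L') := by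
  rw [epsCurrent, ← smul_eq_C_mul, map_smul, ← realizeC_listMom]
  congr 2
  simp [listMom, mul_assoc]

theorem realizeC_epsCurrent' (B' : Idx q) (A A' b : Fin 2) (L : List (Fin 2)) :
    realizeC n 1 (epsCurrent' b (listMom 0 L (List.ofFn B')) A A') =
      eps A b • coordFn n (listExp L (A' :: List.ofFn B')) := by
  rw [epsCurrent', ← smul_eq_C_mul, map_smul, ← realizeC_listMom]
  congr 2
  simp [listMom]
  ring

/-- Supplies a current with the prescribed contraction with π̃ and none with π, to be subtracted
from a given one. With q = 0 there is no index B' for ε to carry, hence the condition on σ. -/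
theorem exists_primed_current (hn : 1 ≤ n) (p q : ℕ) {σ : ℂ} (hσ : q = 0 → σ = 0) :
    ∃ U : Idx p → Idx q → Fin 2 → Fin 2 → MvPolynomial (MomVar 1) ℂ,
      (∀ B B' A, U B B' A 0 * X (0, true, 1) - U B B' A 1 * X (0, true, 0) =
        C σ * (X (0, false, A) * strMom 0 B B')) ∧
      (∀ B B' A', U B B' 0 A' * X (0, false, 1) - U B B' 1 A' * X (0, false, 0) = 0) ∧
      ReducesToBasic hn fun B B' A A' => realizeC n 1 (U B B' A A') := by
  cases q with
  | zero =>
    refine ⟨0, ?_, ?_, ReducesToBasic.of_curl fun B B' => ?_⟩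
    · simp [hσ rfl]
    · simp
    · simp only [Pi.zero_apply, map_zero]
      exact IsSpinorCurl.zero
  | succ q =>
    refine ⟨fun B B' A A' => σ • epsCurrent (B' 0) (listMom 0 (List.ofFn B)
      (List.ofFn fun i : Fin q => B' i.succ)) A A', ?_, ?_, ?_⟩
    · intro B B' A
      rw [strMom_eq_listMom, List.ofFn_succ (f := B')]
      simp only [epsCurrent, smul_eq_C_mul, listMom, List.map_cons, List.prod_cons]
      generalize B' 0 = b
      fin_cases b <;> simp [eps] <;> ring
    · intro B B' A'
      simp only [epsCurrent, smul_eq_C_mul]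
      ring
    · simp only [map_smul]
      refine ReducesToBasic.smul (W := fun B B' A A' => realizeC n 1 (epsCurrent (B' 0)
        (listMom 0 (List.ofFn B) (List.ofFn fun i : Fin q => B' i.succ)) A A')) σ ?_
      -- For q = 1 the current is the elementary tensor if p + 1 = n, and otherwise zero because the
      -- coordinate is missing. For more primed indices it is a curl.
      cases q with
      | zero =>
        by_cases hp : p + 1 = n
        · refine ReducesToBasic.of_basic (.inl (.elementary hp rfl)) fun x j A A' B B' => ?_
          refine symmetrize_eq_of_const fun τ τ' => ?_
          rw [realizeC_epsCurrent, show B' ∘ τ' = B' from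
              funext fun i => congrArg B' (Subsingleton.elim (α := Fin 1) _ _),
            fld_eq_jetCoord j (p := 0) (L' := []) (by simp [hp]) rfl]
          change _ = eps A' (B' 0) * jetCoord j _
          rw [listExp_perm ((ofFn_comp_perm B τ).cons _) (List.Perm.refl _)]
          simp
        · refine ReducesToBasic.of_curl fun B B' => ?_
          simp only [realizeC_epsCurrent]
          have h0 : ∀ A, coordFn n (listExp (A :: List.ofFn B)
              (List.ofFn fun i : Fin 0 => B' i.succ)) = 0 := fun A =>
            coordFn_eq_zero (by simp only [JetExp.IsPos, deg_listExp]; simp; omega)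
              (by simp only [JetExp.IsNeg, deg_listExp]; simp)
          simp only [h0, smul_zero]
          exact IsSpinorCurl.zero
      | succ q =>
        refine ReducesToBasic.of_curl fun B B' => ?_
        convert isSpinorCurl_epsCurrent hn (B' 0) (B' 1) (listMom 0 (List.ofFn B)
          (List.ofFn fun i : Fin q => B' i.succ.succ)) using 5
        simp [listMom, List.ofFn_succ]
        ring

theorem exists_unprimed_current (hn : 1 ≤ n) (p q : ℕ) {σ : ℂ} (hσ : p = 0 → σ = 0) :
    ∃ U : Idx p → Idx q → Fin 2 → Fin 2 → MvPolynomial (MomVar 1) ℂ,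
      (∀ B B' A', U B B' 0 A' * X (0, false, 1) - U B B' 1 A' * X (0, false, 0) =
        C σ * (X (0, true, A') * strMom 0 B B')) ∧
      (∀ B B' A, U B B' A 0 * X (0, true, 1) - U B B' A 1 * X (0, true, 0) = 0) ∧
      ReducesToBasic hn fun B B' A A' => realizeC n 1 (U B B' A A') := by
  cases p with
  | zero =>
    refine ⟨0, ?_, ?_, ReducesToBasic.of_curl fun B B' => ?_⟩
    · simp [hσ rfl]
    · simp
    · simp only [Pi.zero_apply, map_zero]
      exact IsSpinorCurl.zero
  | succ p =>
    refine ⟨fun B B' A A' => σ • epsCurrent' (B 0) (listMom 0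
      (List.ofFn fun i : Fin p => B i.succ) (List.ofFn B')) A A', ?_, ?_, ?_⟩
    · intro B B' A
      rw [strMom_eq_listMom, List.ofFn_succ (f := B)]
      simp only [epsCurrent', smul_eq_C_mul, listMom, List.map_cons, List.prod_cons]
      generalize B 0 = b
      fin_cases b <;> simp [eps] <;> ring
    · intro B B' A'
      simp only [epsCurrent', smul_eq_C_mul]
      ring
    · simp only [map_smul]
      refine ReducesToBasic.smul (W := fun B B' A A' => realizeC n 1 (epsCurrent' (B 0)
        (listMom 0 (List.ofFn fun i : Fin p => B i.succ) (List.ofFn B')) A A')) σ ?_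
      cases p with
      | zero =>
        by_cases hq : q + 1 = n
        · refine ReducesToBasic.of_basic (.inr ⟨_, .elementary hq rfl, rfl⟩)
            fun x j A A' B B' => ?_
          rw [conjTensor, elementaryTensor, symmetrize_eq_of_const
            (c := eps A (B 0) * jetCoord j (listExp (A' :: List.ofFn B') [])) fun τ τ' => ?_]
          · rw [realizeC_epsCurrent', map_mul, eps_conj, conj_jetCoord_listExp hn]
            rfl
          · rw [show B ∘ τ' = B from
              funext fun i => congrArg B (Subsingleton.elim (α := Fin 1) _ _), fld_eq_jetCoord j (p := 0) (L' := []) (by simp [hq]) rfl]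
            rw [listExp_perm ((ofFn_comp_perm B' τ).cons _) (List.Perm.refl _)]
            simp
        · refine ReducesToBasic.of_curl fun B B' => ?_
          simp only [realizeC_epsCurrent']
          have h0 : ∀ A', coordFn n (listExp (List.ofFn fun i : Fin 0 => B i.succ)
              (A' :: List.ofFn B')) = 0 := fun A =>
            coordFn_eq_zero (by simp only [JetExp.IsPos, deg_listExp]; simp)
              (by simp only [JetExp.IsNeg, deg_listExp]; simp; omega)
          simp only [h0, smul_zero]
          exact IsSpinorCurl.zero
      | succ p =>
        refine ReducesToBasic.of_curl fun B B' => ?_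
        convert isSpinorCurl_epsCurrent' hn (B 0) (B 1) (listMom 0
          (List.ofFn fun i : Fin p => B i.succ.succ) (List.ofFn B')) using 5
        simp [listMom, List.ofFn_succ]
        ring

end Reduction

/-! ### Covariant linear currents -/

section LinearCurrents

open MvPolynomial

variable {n p q : ℕ}

theorem sum_idx_one {M : Type*} [AddCommMonoid M] (f : Idx 1 → M) :
    ∑ A, f A = ∑ c : Fin 2, f ![c] := by
  rw [← Equiv.sum_comp (Equiv.funUnique (Fin 1) (Fin 2)).symm]
  refine Finset.sum_congr rfl fun c _ => congrArg f (funext fun i => ?_)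
  rw [Subsingleton.elim i 0]
  rfl

theorem eq_cons_zero (A : Idx 1) : A = ![A 0] :=
  funext fun i => by rw [Subsingleton.elim i 0]; rfl

theorem act_one_one (g : SL2C) (t : Arr 1 1 p q) (A A' : Fin 2) (B : Idx p) (B' : Idx q) :
    Arr.act g t ![A] ![A'] B B' = ∑ c, ∑ c', (g : Matrix (Fin 2) (Fin 2) ℂ) A c *
      conj ((g : Matrix (Fin 2) (Fin 2) ℂ) A' c') *
        ∑ E, ∑ E', coeff g B E * conj (coeff g B' E') * t ![c] ![c'] E E' := by
  rw [Arr.act, sum_idx_one]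
  refine Finset.sum_congr rfl fun c _ => ?_
  rw [sum_idx_one]
  refine Finset.sum_congr rfl fun c' _ => ?_
  simp only [Finset.mul_sum]
  refine Finset.sum_congr rfl fun E _ => Finset.sum_congr rfl fun E' _ => ?_
  simp [coeff]
  ring

theorem act_one_zero (g : SL2C) (t : Arr 1 0 p q) (A : Idx 1) (A' : Idx 0) (B : Idx p)
    (B' : Idx q) : Arr.act g t A A' B B' = ∑ c, (g : Matrix (Fin 2) (Fin 2) ℂ) (A 0) c *
        ∑ E, ∑ E', coeff g B E * conj (coeff g B' E') * t ![c] ![] E E' := by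
  rw [act_zero_right, sum_idx_one]
  refine Finset.sum_congr rfl fun c _ => ?_
  simp only [Finset.mul_sum]
  refine Finset.sum_congr rfl fun E _ => Finset.sum_congr rfl fun E' _ => ?_
  simp [coeff]

theorem act_zero_one (g : SL2C) (t : Arr 0 1 p q) (A : Idx 0) (A' : Idx 1) (B : Idx p)
    (B' : Idx q) : Arr.act g t A A' B B' = ∑ c, conj ((g : Matrix (Fin 2) (Fin 2) ℂ) (A' 0) c) *
        ∑ E, ∑ E', coeff g B E * conj (coeff g B' E') * t ![] ![c] E E' := by
  rw [Arr.act, Fintype.sum_eq_single ![] fun b hb => absurd (Subsingleton.elim _ _) hb, sum_idx_one]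
  refine Finset.sum_congr rfl fun c _ => ?_
  simp only [Finset.mul_sum]
  refine Finset.sum_congr rfl fun E _ => Finset.sum_congr rfl fun E' _ => ?_
  simp [coeff]
  ring

variable {P : Idx 1 → Idx 1 → Idx p → Idx q → MvPolynomial (MomVar 1) ℂ}

/-- The index A' is contracted with π̃. The result is covariant and, since P_{11} vanishes at π = π̃
= (1, 0), has no component there with A = 1; so it is a multiple of the product of momenta. -/
theorem exists_primed_contraction
    (hsym : ∀ (τ : Equiv.Perm (Fin p)) (τ' : Equiv.Perm (Fin q)) A A' B B',
      P A A' (B ∘ τ) (B' ∘ τ') = P A A' B B')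
    (hcov : ∀ (g : SL2C) (o : Fin 2 → ℂ) A A' B B',
      eval (slicePt fun _ => (g : Matrix (Fin 2) (Fin 2) ℂ).mulVec o) (P A A' B B') =
        Arr.act g (fun C C' E E' => eval (slicePt fun _ => o) (P C C' E E')) A A' B B')
    (hvan : ∀ B B', eval (slicePt fun _ => ![1, 0]) (P ![1] ![1] B B') = 0) :
    ∃ σ : ℂ, (q = 0 → σ = 0) ∧ ∀ A B B', P ![A] ![0] B B' * X (0, true, 1) -
      P ![A] ![1] B B' * X (0, true, 0) = C σ * (X (0, false, A) * strMom 0 B B') := by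
  obtain ⟨σ, hσ⟩ := eq_strMom_of_covariant (a := 1) (a' := 0)
    (P := fun A _ B B' => P A ![0] B B' * X (0, true, 1) - P A ![1] B B' * X (0, true, 0))
    (fun τ τ' A A' B B' => by simp only [hsym])
    (fun g o A A' B B' => by
      have h0 := congrArg conj (sum_epsVec_mul g o 0)
      have h1 := congrArg conj (sum_epsVec_mul g o 1)
      rw [eq_cons_zero A, act_one_zero]
      simp only [map_sub, map_mul, hcov, act_one_one, eval_X, slicePt_true, mul_sub,
        Finset.sum_sub_distrib]
      simp only [← mul_assoc, ← Finset.sum_mul]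
      simp only [Fin.sum_univ_two, epsVec, eps, map_add, map_mul] at h0 h1 ⊢
      simp at h0 h1 ⊢
      generalize (∑ E, ∑ E', coeff g B E * (starRingEnd ℂ) (coeff g B' E') *
        eval (slicePt fun _ => o) (P ![0] ![0] E E')) = K00
      generalize (∑ E, ∑ E', coeff g B E * (starRingEnd ℂ) (coeff g B' E') *
        eval (slicePt fun _ => o) (P ![0] ![1] E E')) = K01
      generalize (∑ E, ∑ E', coeff g B E * (starRingEnd ℂ) (coeff g B' E') *
        eval (slicePt fun _ => o) (P ![1] ![0] E E')) = K10
      generalize (∑ E, ∑ E', coeff g B E * (starRingEnd ℂ) (coeff g B' E') *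
        eval (slicePt fun _ => o) (P ![1] ![1] E E')) = K11
      linear_combination (g.1 (A 0) 0 * K00 + g.1 (A 0) 1 * K10) * h0 +
        (g.1 (A 0) 0 * K01 + g.1 (A 0) 1 * K11) * h1)
    (fun A A' B B' h => by
      have hA : A ≠ 0 := h.resolve_right fun h' => h' (Subsingleton.elim _ _)
      have hA' : A = ![1] := by
        rw [eq_cons_zero A] at hA ⊢
        generalize A 0 = a at hA ⊢
        fin_cases a
        · exact absurd (_root_.funext fun i => by rw [Subsingleton.elim i 0]; rfl) hA
        · rfl
      simp [hA', hvan])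
  have h1 : ∀ A B B', P ![A] ![0] B B' * X (0, true, 1) -
      P ![A] ![1] B B' * X (0, true, 0) = C σ * (X (0, false, A) * strMom 0 B B') := by
    intro A B B'
    refine (hσ ![A] ![] B B').trans ?_
    simp [strMom]
  refine ⟨σ, ?_, h1⟩
  rintro rfl
  -- At π̃ = 0 the contraction vanishes, whereas for q = 0 the right side is σ.
  have h2 := congrArg (eval (momPt (fun _ => 1) 0)) (h1 0 0 ![])
  simpa [eval_strMom] using h2.symm

theorem exists_unprimed_contraction
    (hsym : ∀ (τ : Equiv.Perm (Fin p)) (τ' : Equiv.Perm (Fin q)) A A' B B',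
      P A A' (B ∘ τ) (B' ∘ τ') = P A A' B B')
    (hcov : ∀ (g : SL2C) (o : Fin 2 → ℂ) A A' B B',
      eval (slicePt fun _ => (g : Matrix (Fin 2) (Fin 2) ℂ).mulVec o) (P A A' B B') =
        Arr.act g (fun C C' E E' => eval (slicePt fun _ => o) (P C C' E E')) A A' B B')
    (hvan : ∀ B B', eval (slicePt fun _ => ![1, 0]) (P ![1] ![1] B B') = 0) :
    ∃ σ : ℂ, (p = 0 → σ = 0) ∧ ∀ A' B B', P ![0] ![A'] B B' * X (0, false, 1) -
      P ![1] ![A'] B B' * X (0, false, 0) = C σ * (X (0, true, A') * strMom 0 B B') := by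
  obtain ⟨σ, hσ⟩ := eq_strMom_of_covariant (a := 0) (a' := 1)
    (P := fun _ A' B B' => P ![0] A' B B' * X (0, false, 1) - P ![1] A' B B' * X (0, false, 0))
    (fun τ τ' A A' B B' => by simp only [hsym])
    (fun g o A A' B B' => by
      have h0 := sum_epsVec_mul g o 0
      have h1 := sum_epsVec_mul g o 1
      rw [eq_cons_zero A', act_zero_one]
      simp only [map_sub, map_mul, hcov, act_one_one, eval_X, slicePt_false, mul_sub,
        Finset.sum_sub_distrib]
      simp only [← mul_assoc, ← Finset.sum_mul]
      simp only [Fin.sum_univ_two, epsVec, eps] at h0 h1 ⊢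
      simp at h0 h1 ⊢
      generalize (∑ E, ∑ E', coeff g B E * (starRingEnd ℂ) (coeff g B' E') *
        eval (slicePt fun _ => o) (P ![0] ![0] E E')) = K00
      generalize (∑ E, ∑ E', coeff g B E * (starRingEnd ℂ) (coeff g B' E') *
        eval (slicePt fun _ => o) (P ![0] ![1] E E')) = K01
      generalize (∑ E, ∑ E', coeff g B E * (starRingEnd ℂ) (coeff g B' E') *
        eval (slicePt fun _ => o) (P ![1] ![0] E E')) = K10
      generalize (∑ E, ∑ E', coeff g B E * (starRingEnd ℂ) (coeff g B' E') *
        eval (slicePt fun _ => o) (P ![1] ![1] E E')) = K11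
      linear_combination (conj (g.1 (A' 0) 0) * K00 + conj (g.1 (A' 0) 1) * K01) * h0 +
        (conj (g.1 (A' 0) 0) * K10 + conj (g.1 (A' 0) 1) * K11) * h1)
    (fun A A' B B' h => by
      have hA : A' ≠ 0 := h.resolve_left fun h' => h' (Subsingleton.elim _ _)
      have hA' : A' = ![1] := by
        rw [eq_cons_zero A'] at hA ⊢
        generalize A' 0 = a at hA ⊢
        fin_cases a
        · exact absurd (_root_.funext fun i => by rw [Subsingleton.elim i 0]; rfl) hA
        · rfl
      simp [hA', hvan])
  have h1 : ∀ A' B B', P ![0] ![A'] B B' * X (0, false, 1) -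
      P ![1] ![A'] B B' * X (0, false, 0) = C σ * (X (0, true, A') * strMom 0 B B') := by
    intro A' B B'
    refine (hσ ![] ![A'] B B').trans ?_
    simp [strMom]
  refine ⟨σ, ?_, h1⟩
  rintro rfl
  have h2 := congrArg (eval (momPt 0 (fun _ => 1))) (h1 0 ![] 0)
  simpa [eval_strMom] using h2.symm

/-- Conserved covariant linear currents are equivalent to multiples of the elementary tensors. -/
theorem reducesToBasic_linear (hn : 1 ≤ n)
    (hsym : ∀ (τ : Equiv.Perm (Fin p)) (τ' : Equiv.Perm (Fin q)) A A' B B',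
      P A A' (B ∘ τ) (B' ∘ τ') = P A A' B B')
    (hcov : ∀ (g : SL2C) (o : Fin 2 → ℂ) A A' B B',
      eval (slicePt fun _ => (g : Matrix (Fin 2) (Fin 2) ℂ).mulVec o) (P A A' B B') =
        Arr.act g (fun C C' E E' => eval (slicePt fun _ => o) (P C C' E E')) A A' B B')
    (hcons : ∀ B B', ∑ c : Fin 2 × Fin 2, totalMom ℂ 1 c.1 c.2 *
      raise (fun A A' => P ![A] ![A'] B B') c = 0) :
    ReducesToBasic hn fun B B' A A' => realizeC n 1 (P ![A] ![A'] B B') := by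
  -- At this momentum the only nonzero component of K is K₀₀, and it multiplies the component with A
  -- = A' = 1.
  have hvan : ∀ B B', eval (slicePt fun _ => ![1, 0]) (P ![1] ![1] B B') = 0 := by
    intro B B'
    have h := congrArg (eval (slicePt fun _ => ![1, 0])) (hcons B B')
    simpa [Fintype.sum_prod_type, totalMom_one, raise_zero_zero] using h
  obtain ⟨σ, hσ, h1⟩ := exists_primed_contraction hsym hcov hvan
  obtain ⟨ν, hν, h2⟩ := exists_unprimed_contraction hsym hcov hvan
  obtain ⟨U, hU1, hU2, hU⟩ := exists_primed_current hn p q hσ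
  obtain ⟨V, hV1, hV2, hV⟩ := exists_unprimed_current hn p q hν
  -- Once the two model currents are subtracted, both contractions vanish, so the rest is π_A
  -- π̃_{A'} R and trivial.
  have hZ : ∀ B B', ∃ R, ∀ A A', P ![A] ![A'] B B' - U B B' A A' - V B B' A A' =
      totalMom ℂ 1 A A' * R := by
    intro B B'
    refine exists_eq_mom_mul (Z := fun A A' => P ![A] ![A'] B B' - U B B' A A' - V B B' A A')
      (fun A => ?_) fun A' => ?_
    · linear_combination h1 A B B' - hU1 B B' A - hV2 B B' A
    · linear_combination h2 A' B B' - hU2 B B' A' - hV1 B B' A'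
  choose R hR using hZ
  convert (hU.add hV).add (ReducesToBasic.of_curl (hn := hn)
    fun B B' => isSpinorCurl_realizeC_mom_mul hn (R B B')) using 1
  funext B B' A A'
  simp only [Pi.add_apply, ← map_add]
  rw [← hR]
  congr 1
  ring

end LinearCurrents

/-! ### Symbols of the basic quadratic tensors -/

section Models

open MvPolynomial

variable {n p q : ℕ}

/-- The exchange of the two momenta. -/
def exchange : MvPolynomial (MomVar 2) ℂ →ₐ[ℂ] MvPolynomial (MomVar 2) ℂ :=
  rename fun v => (Fin.rev v.1, v.2)

@[simp] theorem exchange_X (i : Fin 2) (b : Bool) (A : Fin 2) :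
    exchange (X (i, b, A)) = X (Fin.rev i, b, A) := rename_X _ _

theorem exchange_listMom (i : Fin 2) (L L' : List (Fin 2)) :
    exchange (listMom i L L') = listMom (Fin.rev i) L L' := by
  simp [listMom, map_list_prod, Function.comp_def]

theorem rev_injective : Function.Injective fun v : MomVar 2 => (Fin.rev v.1, v.2) := by
  rintro ⟨i, v⟩ ⟨i', v'⟩ h
  simp only [Prod.mk.injEq, Fin.rev_inj] at h
  exact Prod.ext h.1 h.2

theorem part_mapDomain_rev (κ : MomVar 2 →₀ ℕ) (i : Fin 2) :
    part (Finsupp.mapDomain (fun v : MomVar 2 => (Fin.rev v.1, v.2)) κ) i =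
      part κ (Fin.rev i) := by
  ext v
  have := Finsupp.mapDomain_apply rev_injective κ (Fin.rev i, v)
  simp only [Fin.rev_rev] at this
  exact this

theorem realizeC_exchange (f : MvPolynomial (MomVar 2) ℂ) :
    realizeC n 2 (exchange f) = realizeC n 2 f := by
  induction f using MvPolynomial.induction_on' with
  | monomial κ a =>
    rw [exchange, rename_monomial, realizeC_monomial, realizeC_monomial, Fin.prod_univ_two,
      Fin.prod_univ_two, mul_comm, part_mapDomain_rev, part_mapDomain_rev]
    rfl
  | add f g hf hg => rw [map_add, map_add, map_add, hf, hg]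

theorem restrictNull_X_zero (a b : ℂ) (s : Bool) (A : Fin 2) :
    restrictNull a b (X (0, s, A)) = C (if s then -b else a) * X (0, s, A) := by
  simp [restrictNull]

theorem restrictNull_X_one (a b : ℂ) (s : Bool) (A : Fin 2) :
    restrictNull a b (X (1, s, A)) = C (if s then a else b) * X (0, s, A) := by
  simp [restrictNull]

theorem restrictNull_listMom_zero (a b : ℂ) (L L' : List (Fin 2)) :
    restrictNull a b (listMom 0 L L') =
      C (a ^ L.length * (-b) ^ L'.length) * listMom 0 L L' := by
  have h : ∀ s (L : List (Fin 2)), restrictNull a b (L.map fun c => X (0, s, c)).prod =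
      C ((if s then -b else a) ^ L.length) * (L.map fun c => X (0, s, c)).prod := by
    intro s L
    induction L with
    | nil => simp
    | cons c L ih =>
      rw [List.map_cons, List.prod_cons, map_mul, ih, restrictNull_X_zero, List.map_cons,
        List.prod_cons, List.length_cons, pow_succ, C_mul]
      ring
  rw [listMom, map_mul, h, h, listMom, C_mul]
  simp only [if_true, Bool.false_eq_true, if_false]
  ring

theorem restrictNull_listMom_one (a b : ℂ) (L L' : List (Fin 2)) :
    restrictNull a b (listMom 1 L L') =
      C (b ^ L.length * a ^ L'.length) * listMom 0 L L' := by
  have h : ∀ s (L : List (Fin 2)), restrictNull a b (L.map fun c => X (1, s, c)).prod =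
      C ((if s then a else b) ^ L.length) * (L.map fun c => X (0, s, c)).prod := by
    intro s L
    induction L with
    | nil => simp
    | cons c L ih =>
      rw [List.map_cons, List.prod_cons, map_mul, ih, restrictNull_X_one, List.map_cons,
        List.prod_cons, List.length_cons, pow_succ, C_mul]
      ring
  rw [listMom, map_mul, h, h, listMom, C_mul]
  simp only [if_true, Bool.false_eq_true, if_false]
  ring

theorem listMom_mul (i : Fin 1) (L L' M M' : List (Fin 2)) :
    listMom i L L' * listMom i M M' = listMom i (L ++ M) (L' ++ M') := by
  simp only [listMom, List.map_append, List.prod_append]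
  ring

theorem listMom_perm {m : ℕ} (i : Fin m) {L M L' M' : List (Fin 2)} (h : L.Perm M)
    (h' : L'.Perm M') : listMom i L L' = listMom i M M' := by
  rw [listMom, listMom, (h.map _).prod_eq, (h'.map _).prod_eq]

/-- The symmetrised product of momenta, with the indices `B` split into `s B` and `t B` and the
indices `B'` into `s' B'` and `t' B'`. -/
def splitMom (s t s' t' : List (Fin 2) → List (Fin 2)) (B : Idx p) (B' : Idx q) :
    MvPolynomial (MomVar 2) ℂ :=
  ((p ! : ℂ) * (q ! : ℂ))⁻¹ • ∑ τ : Equiv.Perm (Fin p), ∑ τ' : Equiv.Perm (Fin q),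
    listMom 0 (s (List.ofFn (B ∘ τ))) (s' (List.ofFn (B' ∘ τ'))) *
      listMom 1 (t (List.ofFn (B ∘ τ))) (t' (List.ofFn (B' ∘ τ')))

/-- The currents `π̃_{1A'} π_{2A} M`. -/
def pairCurrent (M : MvPolynomial (MomVar 2) ℂ) (A A' : Fin 2) : MvPolynomial (MomVar 2) ℂ :=
  X (0, true, A') * X (1, false, A) * M

theorem realizeC_pairCurrent_splitMom (s t s' t' : List (Fin 2) → List (Fin 2)) (B : Idx p)
    (B' : Idx q) (A A' : Fin 2) (j : Jet n) :
    (realizeC n 2 (pairCurrent (splitMom s t s' t' B B') A A') : Jet n → ℂ) j =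
      symmetrize (fun b b' => jetCoord j (listExp (s b) (A' :: s' b')) *
        jetCoord j (listExp (A :: t b) (t' b'))) B B' := by
  rw [pairCurrent, splitMom, mul_smul_comm, map_smul, Finset.mul_sum, map_sum, symmetrize,
    div_eq_inv_mul]
  change _ * ((∑ τ : Equiv.Perm (Fin p), _ : localFn n) : Jet n → ℂ) j = _
  rw [coe_finset_sum]
  congr 1
  refine Finset.sum_congr rfl fun τ _ => ?_
  rw [Finset.mul_sum, map_sum, coe_finset_sum]
  refine Finset.sum_congr rfl fun τ' _ => ?_
  have h : ∀ L L' M M' : List (Fin 2), X (0, true, A') * X (1, false, A) *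
      (listMom (m := 2) 0 L L' * listMom 1 M M') =
        listMom 0 L (A' :: L') * listMom 1 (A :: M) M' := by
    intro L L' M M'
    simp only [listMom, List.map_cons, List.prod_cons]
    ring
  rw [h, realizeC_listMom_mul]
  rfl

/-- The first momentum is killed by contraction of π̃₁ with itself, the second by contraction of π₂
with itself. -/
theorem conserved_pairCurrent (M : MvPolynomial (MomVar 2) ℂ) :
    ∑ c : Fin 2 × Fin 2, totalMom ℂ 2 c.1 c.2 * raise (pairCurrent M) c = 0 := by
  simp only [Fintype.sum_prod_type, Fin.sum_univ_two, raise_zero_zero, raise_zero_one,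
    raise_one_zero, raise_one_one, totalMom_eq, pairCurrent]
  ring

theorem totalMom_exchange (A A' : Fin 2) :
    exchange (totalMom ℂ 2 A A') = totalMom ℂ 2 A A' := by
  simp [totalMom_eq]
  ring

theorem exchange_raise (T : Fin 2 → Fin 2 → MvPolynomial (MomVar 2) ℂ) (c : Fin 2 × Fin 2) :
    exchange (raise T c) = raise (fun A A' => exchange (T A A')) c := by
  simp only [raise, map_sum, map_smul]

/-- At a null configuration both factors are built from the same o and ι, so all permutations give
the same product and only the powers of a and b remember the splitting. -/
theorem restrictNull_splitMom (a b : ℂ) {s t s' t' : List (Fin 2) → List (Fin 2)}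
    {r₁ r₂ r₁' r₂' : ℕ} (hs : ∀ b, b.length = p → (s b ++ t b).Perm b ∧ (s b).length = r₁ ∧
      (t b).length = r₂) (hs' : ∀ b, b.length = q → (s' b ++ t' b).Perm b ∧ (s' b).length = r₁' ∧
      (t' b).length = r₂') (B : Idx p) (B' : Idx q) :
    restrictNull a b (splitMom s t s' t' B B') =
      C (a ^ r₁ * (-b) ^ r₁' * (b ^ r₂ * a ^ r₂')) * strMom 0 B B' ∧
    restrictNull a b (exchange (splitMom s t s' t' B B')) =
      C (b ^ r₁ * a ^ r₁' * (a ^ r₂ * (-b) ^ r₂')) * strMom 0 B B' := by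
  have h1 : (p ! : ℂ) ≠ 0 := by exact_mod_cast Nat.factorial_ne_zero p
  have h2 : (q ! : ℂ) ≠ 0 := by exact_mod_cast Nat.factorial_ne_zero q
  have h3 : ∀ (τ : Equiv.Perm (Fin p)) (τ' : Equiv.Perm (Fin q)),
      listMom (0 : Fin 1) (s (List.ofFn (B ∘ τ))) (s' (List.ofFn (B' ∘ τ'))) *
        listMom 0 (t (List.ofFn (B ∘ τ))) (t' (List.ofFn (B' ∘ τ'))) = strMom 0 B B' := by
    intro τ τ'
    rw [listMom_mul, strMom_eq_listMom]
    exact listMom_perm 0 ((hs _ (by simp)).1.trans (ofFn_comp_perm B τ))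
      ((hs' _ (by simp)).1.trans (ofFn_comp_perm B' τ'))
  have hl : ∀ τ : Equiv.Perm (Fin p), (s (List.ofFn (B ∘ τ))).length = r₁ ∧
    (t (List.ofFn (B ∘ τ))).length = r₂ := fun τ => (hs _ (by simp)).2
  have hl' : ∀ τ : Equiv.Perm (Fin q), (s' (List.ofFn (B' ∘ τ))).length = r₁' ∧
    (t' (List.ofFn (B' ∘ τ))).length = r₂' := fun τ => (hs' _ (by simp)).2
  have h4 : ∀ Z : MvPolynomial (MomVar 1) ℂ, ((p ! : ℂ) * (q ! : ℂ))⁻¹ •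
      ∑ τ : Equiv.Perm (Fin p), ∑ τ' : Equiv.Perm (Fin q), Z = Z := by
    intro Z
    simp only [Finset.sum_const, Finset.card_univ, Fintype.card_perm, Fintype.card_fin]
    rw [← Nat.cast_smul_eq_nsmul ℂ, ← Nat.cast_smul_eq_nsmul ℂ, smul_smul,
      smul_smul, mul_assoc, inv_mul_cancel₀ (mul_ne_zero h1 h2), one_smul]
  constructor
  · rw [splitMom, map_smul, map_sum, ← h4 (C (a ^ r₁ * (-b) ^ r₁' * (b ^ r₂ * a ^ r₂')) * _)]
    congr 1
    refine Finset.sum_congr rfl fun τ _ => ?_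
    rw [map_sum]
    refine Finset.sum_congr rfl fun τ' _ => ?_
    rw [map_mul, restrictNull_listMom_zero, restrictNull_listMom_one, (hl τ).1, (hl τ).2,
      (hl' τ').1, (hl' τ').2, ← h3 τ τ', C_mul (a := a ^ r₁ * (-b) ^ r₁')]
    ring
  · rw [splitMom, map_smul, map_smul, map_sum, map_sum,
      ← h4 (C (b ^ r₁ * a ^ r₁' * (a ^ r₂ * (-b) ^ r₂')) * _)]
    congr 1
    refine Finset.sum_congr rfl fun τ _ => ?_
    rw [map_sum, map_sum]
    refine Finset.sum_congr rfl fun τ' _ => ?_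
    rw [map_mul, map_mul, exchange_listMom, exchange_listMom, Fin.rev_zero,
      show Fin.rev (1 : Fin 2) = 0 from rfl, show Fin.last 1 = 1 from rfl,
      restrictNull_listMom_zero, restrictNull_listMom_one, (hl τ).1, (hl τ).2,
      (hl' τ').1, (hl' τ').2, ← h3 τ τ', C_mul (a := b ^ r₁ * a ^ r₁')]
    ring

/-- There is a conserved family of bilinear symbols, equivalent to basic tensors, which equals
`κ a b` times the product of momenta on the points with vanishing total momentum. -/
def HasModel (hn : 1 ≤ n) (p q : ℕ) (κ : ℂ → ℂ → ℂ) : Prop :=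
  ∃ R : Idx p → Idx q → Fin 2 → Fin 2 → MvPolynomial (MomVar 2) ℂ,
    (∀ B B', ∑ c : Fin 2 × Fin 2, totalMom ℂ 2 c.1 c.2 * raise (R B B') c = 0) ∧
    (∀ a b B B', restrictNull a b (R B B' 0 0) =
      C (κ a b) * (X (0, false, 0) * X (0, true, 0) * strMom 0 B B')) ∧
    ReducesToBasic hn fun B B' A A' => realizeC n 2 (R B B' A A')

variable {hn : 1 ≤ n}

theorem raise_add {G : Type*} [AddCommGroup G] [Module ℂ G] (T T' : Fin 2 → Fin 2 → G)
    (c : Fin 2 × Fin 2) : raise (T + T') c = raise T c + raise T' c := by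
  simp only [raise, Pi.add_apply, smul_add, Finset.sum_add_distrib]

theorem raise_smul {G : Type*} [AddCommGroup G] [Module ℂ G] (z : ℂ) (T : Fin 2 → Fin 2 → G)
    (c : Fin 2 × Fin 2) : raise (z • T) c = z • raise T c := by
  simp only [raise, Pi.smul_apply, Finset.smul_sum, smul_comm z]

theorem HasModel.add {κ κ' : ℂ → ℂ → ℂ} (h : HasModel hn p q κ) (h' : HasModel hn p q κ') :
    HasModel hn p q fun a b => κ a b + κ' a b := by
  obtain ⟨R, h1, h2, h3⟩ := h
  obtain ⟨R', h1', h2', h3'⟩ := h'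
  refine ⟨R + R', fun B B' => ?_, fun a b B B' => ?_, ?_⟩
  · simp only [Pi.add_apply, raise_add, mul_add, Finset.sum_add_distrib, h1, h1', add_zero]
  · simp only [Pi.add_apply, map_add, h2, h2', add_mul]
  · convert h3.add h3' using 1
    funext B B' A A'
    simp only [Pi.add_apply, map_add]

theorem HasModel.smul {κ : ℂ → ℂ → ℂ} (z : ℂ) (h : HasModel hn p q κ) :
    HasModel hn p q fun a b => z * κ a b := by
  obtain ⟨R, h1, h2, h3⟩ := h
  refine ⟨z • R, fun B B' => ?_, fun a b B B' => ?_, ?_⟩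
  · simp only [Pi.smul_apply, raise_smul, mul_smul_comm, ← Finset.smul_sum, h1, smul_zero]
  · simp only [Pi.smul_apply, map_smul, h2]
    rw [smul_eq_C_mul, C_mul]
    ring
  · convert h3.smul z using 1
    funext B B' A A'
    simp only [Pi.smul_apply, map_smul]

theorem HasModel.zero : HasModel hn p q fun _ _ => 0 := by
  refine ⟨0, fun B B' => ?_, fun a b B B' => ?_, ReducesToBasic.of_curl fun B B' => ?_⟩
  · simp [raise]
  · simp
  · simp only [Pi.zero_apply, map_zero]
    exact IsSpinorCurl.zero

/-- Basic tensors that are split products provide models. -/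
theorem hasModel_of_split {s t s' t' : List (Fin 2) → List (Fin 2)}
    {r₁ r₂ r₁' r₂' : ℕ} (hs : ∀ b, b.length = p → (s b ++ t b).Perm b ∧ (s b).length = r₁ ∧
      (t b).length = r₂) (hs' : ∀ b, b.length = q → (s' b ++ t' b).Perm b ∧ (s' b).length = r₁' ∧
      (t' b).length = r₂') {G : SpinorFn n 1 1 p q} (hG : G ∈ basicTensors n p q) {z : ℂ}
    (hz : z ≠ 0) (h : ∀ x j A A' B B', G x j ![A] ![A'] B B' =
      z * symmetrize (fun b b' => jetCoord j (listExp (s b) (A' :: s' b')) *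
        jetCoord j (listExp (A :: t b) (t' b'))) B B') :
    (HasModel hn p q fun a b => a ^ (r₁ + r₂') * b ^ (r₂ + r₁' + 2)) ∧
      HasModel hn p q fun a b => a ^ (r₂ + r₁' + 2) * b ^ (r₁ + r₂') := by
  have hred : ReducesToBasic hn fun (B : Idx p) (B' : Idx q) A A' =>
      realizeC n 2 (pairCurrent (splitMom s t s' t' B B') A A') := by
    have h1 : ReducesToBasic hn fun (B : Idx p) (B' : Idx q) A A' =>
        z • realizeC n 2 (pairCurrent (splitMom s t s' t' B B') A A') :=
      ReducesToBasic.of_basic hG fun x j A A' B B' => by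
        rw [h, ← realizeC_pairCurrent_splitMom]
        rfl
    convert h1.smul z⁻¹ using 1
    funext B B' A A'
    simp only [Pi.smul_apply, smul_smul, inv_mul_cancel₀ hz, one_smul]
  have hsq : ∀ k : ℕ, ((-1 : ℂ) ^ k) * (-1) ^ k = 1 := fun k => by
    rw [← mul_pow]
    simp
  constructor
  -- The additional factor -b² comes from π̃_{1A'} π_{2A}.
  · have h1 : HasModel hn p q fun a b => -(a ^ r₁ * (-b) ^ r₁' * (b ^ r₂ * a ^ r₂') * b ^ 2) := by
      refine ⟨fun B B' => pairCurrent (splitMom s t s' t' B B'),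
        fun B B' => conserved_pairCurrent _, fun a b B B' => ?_, hred⟩
      change restrictNull a b (X (0, true, 0) * X (1, false, 0) * splitMom s t s' t' B B') = _
      rw [map_mul, (restrictNull_splitMom a b hs hs' B B').1, map_mul,
        restrictNull_X_zero, restrictNull_X_one]
      simp only [if_true, Bool.false_eq_true, if_false, C_mul, C_neg, C_pow]
      ring
    convert h1.smul (-(-1) ^ r₁') using 3 with a b
    rw [neg_pow b]
    linear_combination (-(a ^ (r₁ + r₂') * b ^ (r₂ + r₁' + 2))) * hsq r₁'
  -- Exchanging the factors changes the symbol, and swaps the powers of a and b up to sign, but not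
  -- the local function that it realizes.
  · have h1 : HasModel hn p q fun a b => b ^ r₁ * a ^ r₁' * (a ^ r₂ * (-b) ^ r₂') * a ^ 2 := by
      refine ⟨fun B B' A A' => exchange (pairCurrent (splitMom s t s' t' B B') A A'),
        fun B B' => ?_, fun a b B B' => ?_, ?_⟩
      · have h2 := congrArg exchange (conserved_pairCurrent (splitMom s t s' t' B B'))
        rw [map_sum, map_zero] at h2
        rw [← h2]
        refine Finset.sum_congr rfl fun c _ => ?_
        rw [map_mul, totalMom_exchange]
        congr 1
        rw [exchange_raise]
      · change restrictNull a b (exchange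
          (X (0, true, 0) * X (1, false, 0) * splitMom s t s' t' B B')) = _
        rw [map_mul, map_mul, (restrictNull_splitMom a b hs hs' B B').2, map_mul,
          map_mul, exchange_X, exchange_X, Fin.rev_zero, show Fin.rev (1 : Fin 2) = 0 from rfl,
          show Fin.last 1 = 1 from rfl, restrictNull_X_zero, restrictNull_X_one]
        simp only [if_true, Bool.false_eq_true, if_false, C_mul, C_pow]
        ring
      · simp only [realizeC_exchange]
        exact hred
    convert h1.smul ((-1) ^ r₂') using 3 with a b
    rw [neg_pow b]
    linear_combination (-(a ^ (r₂ + r₁' + 2) * b ^ (r₁ + r₂'))) * hsq r₂'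

end Models

/-! ### Null values of the spacetime, zilch and chiral tensors -/

section BasicModels

open MvPolynomial

variable {n p q : ℕ}

theorem symmetrize_congr {f f' : List (Fin 2) → List (Fin 2) → ℂ} {B : Idx p} {B' : Idx q}
    (h : ∀ b b', b.length = p → b'.length = q → f b b' = f' b b') :
    symmetrize f B B' = symmetrize f' B B' := by
  rw [symmetrize, symmetrize]
  congr 1
  exact Finset.sum_congr rfl fun τ _ => Finset.sum_congr rfl fun τ' _ =>
    h _ _ (by simp) (by simp)

theorem mul_symmetrize (z : ℂ) (f : List (Fin 2) → List (Fin 2) → ℂ) (B : Idx p) (B' : Idx q) :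
    symmetrize (fun b b' => z * f b b') B B' = z * symmetrize f B B' := by
  simp only [symmetrize, ← Finset.mul_sum, mul_div_assoc]

theorem conj_symmetrize (f : List (Fin 2) → List (Fin 2) → ℂ) (B : Idx q) (B' : Idx p) :
    conj (symmetrize f B B') = symmetrize (fun b b' => conj (f b' b)) B' B := by
  simp only [symmetrize, map_div₀, map_sum, map_mul, map_natCast]
  rw [Finset.sum_comm, mul_comm (q ! : ℂ)]

theorem take_append_drop_perm {N r s : ℕ} (h : r + s = N) (b : List (Fin 2)) (hb : b.length = N) :
    (b.take r ++ b.drop r).Perm b ∧ (b.take r).length = r ∧ (b.drop r).length = s := by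
  refine ⟨by rw [List.take_append_drop], ?_, ?_⟩
  · rw [List.length_take]
    omega
  · rw [List.length_drop]
    omega

theorem drop_append_take_perm {N r s : ℕ} (h : r + s = N) (b : List (Fin 2)) (hb : b.length = N) :
    (b.drop r ++ b.take r).Perm b ∧ (b.drop r).length = s ∧ (b.take r).length = r := by
  obtain ⟨h1, h2, h3⟩ := take_append_drop_perm h b hb
  exact ⟨List.perm_append_comm.trans h1, h3, h2⟩

/-- The parity of p + 1 - n decides between the spacetime tensor (even) and the zilch tensor (odd);
the two models differ by exchange of the factors. -/
theorem hasModel_spacetime (hn : 1 ≤ n) (h : n ≤ p + 1) :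
    (HasModel hn p p fun a b => a ^ (p + 1 - n) * b ^ (p + 1 + n)) ∧
      HasModel hn p p fun a b => a ^ (p + 1 + n) * b ^ (p + 1 - n) := by
  obtain ⟨k, hk | hk⟩ := Nat.even_or_odd' (p + 1 - n)
  · have h1 := hasModel_of_split (hn := hn) (take_append_drop_perm (r := k) (s := n + k - 1)
      (N := p) (by omega)) (take_append_drop_perm (r := n + k - 1) (s := k) (N := p) (by omega))
      (.inl (.spacetime k (by omega) (by omega))) (one_ne_zero (α := ℂ))
      fun x j A A' B B' => by
        rw [one_mul]
        refine symmetrize_congr fun b b' hb hb' => ?_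
        rw [cfld_eq_jetCoord hn, fld_eq_jetCoord]
        · rfl
        · rw [List.length_cons, List.length_drop]
          omega
        · rw [List.length_drop]
          omega
        · rw [List.length_take]
          omega
        · rw [List.length_cons, List.length_take]
          omega
    have e1 : k + k = p + 1 - n := by omega
    have e2 : n + k - 1 + (n + k - 1) + 2 = p + 1 + n := by omega
    rwa [e1, e2] at h1
  · have h1 := hasModel_of_split (hn := hn) (take_append_drop_perm (r := k + 1) (s := n + k - 1)
      (N := p) (by omega)) (take_append_drop_perm (r := n + k) (s := k) (N := p) (by omega))
      (.inl (.zilch k (by omega) (by omega))) Complex.I_ne_zero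
      fun x j A A' B B' => by
        rw [← mul_symmetrize]
        refine symmetrize_congr fun b b' hb hb' => ?_
        rw [mul_assoc, cfld_eq_jetCoord hn, fld_eq_jetCoord]
        · rfl
        · rw [List.length_cons, List.length_drop]
          omega
        · rw [List.length_drop]
          omega
        · rw [List.length_take]
          omega
        · rw [List.length_cons, List.length_take]
          omega
    have e1 : k + 1 + k = p + 1 - n := by omega
    have e2 : n + k - 1 + (n + k) + 2 = p + 1 + n := by omega
    rwa [e1, e2] at h1

theorem hasModel_chiral (hn : 1 ≤ n) (hp : Odd p) (hq : q = p + 2 * n) :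
    HasModel hn p q fun a b => a ^ (p + 1 + n) * b ^ (p + 1 + n) := by
  obtain ⟨k, hk⟩ := hp
  -- The factor carrying A' is the second one in the chiral tensor, so the dropped parts of the
  -- index strings come first here.
  have h1 := (hasModel_of_split (hn := hn) (drop_append_take_perm (r := k) (s := k + 1)
    (N := p) (by omega)) (drop_append_take_perm (r := n + k + 1) (s := n + k) (N := q) (by omega))
    (.inl (.chiral k (by omega) (by omega))) (one_ne_zero (α := ℂ))
    fun x j A A' B B' => by
      rw [one_mul]
      refine symmetrize_congr fun b b' hb hb' => ?_
      rw [cfld_eq_jetCoord hn, cfld_eq_jetCoord hn, mul_comm]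
      · rfl
      · rw [List.length_drop]
        omega
      · rw [List.length_cons, List.length_drop]
        omega
      · rw [List.length_cons, List.length_take]
        omega
      · rw [List.length_take]
        omega).1
  have e1 : k + 1 + (n + k + 1) = p + 1 + n := by omega
  have e2 : k + (n + k) + 2 = p + 1 + n := by omega
  rwa [e1, e2] at h1

theorem hasModel_conj_chiral (hn : 1 ≤ n) (hq : Odd q) (hp : p = q + 2 * n) :
    HasModel hn p q fun a b => a ^ (q + 1 + n) * b ^ (q + 1 + n) := by
  obtain ⟨k, hk⟩ := hq
  have h1 := (hasModel_of_split (hn := hn) (take_append_drop_perm (r := n + k + 1) (s := n + k)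
    (N := p) (by omega)) (take_append_drop_perm (r := k) (s := k + 1) (N := q) (by omega))
    (.inr ⟨_, .chiral k (by omega) (by omega), rfl⟩) (one_ne_zero (α := ℂ))
    fun x j A A' B B' => by
      rw [one_mul, conjTensor, chiralTensor, conj_symmetrize]
      refine symmetrize_congr fun b b' hb hb' => ?_
      rw [cfld_eq_jetCoord hn, cfld_eq_jetCoord hn, map_mul, conj_jetCoord_listExp hn,
        conj_jetCoord_listExp hn]
      · rfl
      · rw [List.length_drop]
        omega
      · rw [List.length_cons, List.length_drop]
        omega
      · rw [List.length_cons, List.length_take]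
        omega
      · rw [List.length_take]
        omega).1
  have e1 : n + k + 1 + (k + 1) = q + 1 + n := by omega
  have e2 : n + k + k + 2 = q + 1 + n := by omega
  rwa [e1, e2] at h1

end BasicModels

/-! ### Covariant quadratic currents -/

section QuadraticCurrents

open MvPolynomial

variable {n m p q : ℕ}

theorem eval_aeval {σ τ : Type*} (x : τ → ℂ) (f : σ → MvPolynomial τ ℂ) (P : MvPolynomial σ ℂ) :
    eval x (aeval f P) = eval (fun i => eval x (f i)) P := by
  induction P using MvPolynomial.induction_on with
  | C a => simp
  | add p q hp hq => simp only [map_add, hp, hq]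
  | mul_X p v hp => rw [map_mul, map_mul, hp, map_mul]; simp

/-- The action of `SL(2,ℂ)` on points, with independent momenta `π` and `π̃`. -/
def actPt (g : SL2C) (x : MomVar m → ℂ) : MomVar m → ℂ := fun v =>
  ∑ B, (if v.2.1 then conj ((g : Matrix (Fin 2) (Fin 2) ℂ) v.2.2 B)
    else (g : Matrix (Fin 2) (Fin 2) ℂ) v.2.2 B) * x (v.1, v.2.1, B)

theorem actPt_slicePt (g : SL2C) (o : Fin m → Fin 2 → ℂ) : actPt g (slicePt o) =
    slicePt fun i => (g : Matrix (Fin 2) (Fin 2) ℂ).mulVec (o i) := by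
  funext ⟨i, b, A⟩
  cases b <;> fin_cases A <;> simp [actPt]

/-- Covariance extends to all points. -/
theorem eval_actPt {a a' : ℕ} {P : Idx a → Idx a' → Idx p → Idx q → MvPolynomial (MomVar m) ℂ}
    (hcov : ∀ (g : SL2C) (o : Fin m → Fin 2 → ℂ) A A' B B',
      eval (slicePt fun i => (g : Matrix (Fin 2) (Fin 2) ℂ).mulVec (o i)) (P A A' B B') =
        Arr.act g (fun C C' E E' => eval (slicePt o) (P C C' E E')) A A' B B')
    (g : SL2C) (x : MomVar m → ℂ) (A : Idx a) (A' : Idx a') (B : Idx p) (B' : Idx q) :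
    eval (actPt g x) (P A A' B B') =
      Arr.act g (fun C C' E E' => eval x (P C C' E E')) A A' B B' := by
  let f : MomVar m → MvPolynomial (MomVar m) ℂ := fun v =>
    ∑ B, C (if v.2.1 then conj ((g : Matrix (Fin 2) (Fin 2) ℂ) v.2.2 B)
      else (g : Matrix (Fin 2) (Fin 2) ℂ) v.2.2 B) * X (v.1, v.2.1, B)
  have hf : ∀ (x : MomVar m → ℂ) (P : MvPolynomial (MomVar m) ℂ),
      eval x (aeval f P) = eval (actPt g x) P := by
    intro x P
    rw [eval_aeval]
    congr 2
    funext v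
    simp only [f, map_sum, map_mul, eval_C, eval_X]
    rfl
  have h : aeval f (P A A' B B') = ∑ F : Idx a, ∑ F' : Idx a', ∑ E : Idx p, ∑ E' : Idx q,
      C (coeff g A F * conj (coeff g A' F') * coeff g B E * conj (coeff g B' E')) *
        P F F' E E' := by
    -- Both sides are polynomials in the momenta that agree on the slice. The extension off the
    -- slice is needed because nonzero null configurations are never real.
    refine eq_of_slice fun o => ?_
    rw [hf, actPt_slicePt, hcov, Arr.act]
    simp only [map_sum, map_mul, eval_C]
  rw [← hf, h, Arr.act]
  simp only [map_sum, map_mul, eval_C]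

theorem eval_restrictNull_covariant {a a' : ℕ}
    {P : Idx a → Idx a' → Idx p → Idx q → MvPolynomial (MomVar 2) ℂ}
    (hcov : ∀ (g : SL2C) (o : Fin 2 → Fin 2 → ℂ) A A' B B',
      eval (slicePt fun i => (g : Matrix (Fin 2) (Fin 2) ℂ).mulVec (o i)) (P A A' B B') =
        Arr.act g (fun C C' E E' => eval (slicePt o) (P C C' E E')) A A' B B')
    (z w : ℂ) (g : SL2C) (o : Fin 2 → ℂ) (A : Idx a) (A' : Idx a') (B : Idx p) (B' : Idx q) :
    eval (slicePt fun _ => (g : Matrix (Fin 2) (Fin 2) ℂ).mulVec o)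
        (restrictNull z w (P A A' B B')) =
      Arr.act g (fun C C' E E' => eval (slicePt fun _ => o) (restrictNull z w (P C C' E E')))
        A A' B B' := by
  simp only [restrictNull, eval_aeval]
  rw [← eval_actPt hcov]
  congr 2
  funext ⟨i, b, A⟩
  rw [← actPt_slicePt]
  simp only [actPt, map_mul, eval_C, eval_X, Finset.mul_sum]
  exact Finset.sum_congr rfl fun B _ => by ring

theorem pderiv_totalMom_false (D C C' : Fin 2) : pderiv (0, false, D) (totalMom ℂ 2 C C') =
    if C = D then X (0, true, C') else 0 := by
  rw [totalMom_two]
  simp [pderiv_X, Pi.single_apply, Derivation.leibniz]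

theorem pderiv_totalMom_true (D C C' : Fin 2) : pderiv (0, true, D) (totalMom ℂ 2 C C') =
    if C' = D then X (0, false, C) else 0 := by
  rw [totalMom_two]
  simp [pderiv_X, Pi.single_apply, Derivation.leibniz]

/-- The restriction of a conserved bilinear current to the points with vanishing total momentum is
orthogonal to both momenta. -/
theorem restrictNull_contraction {T : Fin 2 × Fin 2 → MvPolynomial (MomVar 2) ℂ}
    (hT : ∑ c, totalMom ℂ 2 c.1 c.2 * T c = 0) (a b : ℂ) (v : MomVar 2) :
    ∑ c : Fin 2 × Fin 2, restrictNull a b (pderiv v (totalMom ℂ 2 c.1 c.2)) *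
      restrictNull a b (T c) = 0 := by
  -- The conservation law is differentiated along π or π̃; the terms with derivatives of T carry a
  -- factor K and vanish.
  have h := congrArg (fun f => restrictNull a b (pderiv v f)) hT
  simp only [map_sum, map_zero, Derivation.leibniz, smul_eq_mul, map_add, map_mul,
    restrictNull_totalMom, zero_mul, zero_add] at h
  rw [← h]
  exact Finset.sum_congr rfl fun c _ => mul_comm _ _

/-- At o = ι = (1, 0) orthogonality to both momenta leaves only the component with A = A' = 0. The
factors a and b have to be divided out, which is why they are nonzero. -/
theorem eval_restrictNull_eq_zero {T : Fin 2 → Fin 2 → MvPolynomial (MomVar 2) ℂ}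
    (hT : ∑ c : Fin 2 × Fin 2, totalMom ℂ 2 c.1 c.2 * raise T c = 0) {a b : ℂ} (ha : a ≠ 0)
    (hb : b ≠ 0) {A A' : Fin 2} (h : A ≠ 0 ∨ A' ≠ 0) :
    eval (slicePt fun _ => ![1, 0]) (restrictNull a b (T A A')) = 0 := by
  have h1 := fun D => congrArg (eval (slicePt fun _ => ![1, 0]))
    (restrictNull_contraction hT a b (0, false, D))
  have h2 := fun D => congrArg (eval (slicePt fun _ => ![1, 0]))
    (restrictNull_contraction hT a b (0, true, D))
  simp only [pderiv_totalMom_false, pderiv_totalMom_true, Fintype.sum_prod_type,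
    Fin.sum_univ_two, raise_zero_zero, raise_zero_one, raise_one_zero, raise_one_one] at h1 h2
  have h00 := h1 0
  have h10 := h1 1
  have h01 := h2 1
  simp [restrictNull_X_zero, ha, hb] at h00 h10 h01
  fin_cases A <;> fin_cases A'
  · simp at h
  · exact h10
  · exact h01
  · exact h00

/-- Covariant conserved bilinear currents are multiples of the product of momenta at the points
with vanishing total momentum. -/
theorem exists_restrictNull_eq {P : Idx 1 → Idx 1 → Idx p → Idx q → MvPolynomial (MomVar 2) ℂ}
    (hsym : ∀ (τ : Equiv.Perm (Fin p)) (τ' : Equiv.Perm (Fin q)) A A' B B',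
      P A A' (B ∘ τ) (B' ∘ τ') = P A A' B B')
    (hcov : ∀ (g : SL2C) (o : Fin 2 → Fin 2 → ℂ) A A' B B',
      eval (slicePt fun i => (g : Matrix (Fin 2) (Fin 2) ℂ).mulVec (o i)) (P A A' B B') =
        Arr.act g (fun C C' E E' => eval (slicePt o) (P C C' E E')) A A' B B')
    (hcons : ∀ B B', ∑ c : Fin 2 × Fin 2, totalMom ℂ 2 c.1 c.2 *
      raise (fun A A' => P ![A] ![A'] B B') c = 0) {a b : ℂ} (ha : a ≠ 0) (hb : b ≠ 0) :
    ∃ κ : ℂ, ∀ A A' B B', restrictNull a b (P A A' B B') =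
      C κ * (strMom 0 A A' * strMom 0 B B') := by
  refine eq_strMom_of_covariant (P := fun A A' B B' => restrictNull a b (P A A' B B'))
    (fun τ τ' A A' B B' => by rw [hsym])
    (fun g o A A' B B' => eval_restrictNull_covariant hcov a b g o A A' B B')
    (fun A A' B B' h => ?_)
  rw [eq_cons_zero A, eq_cons_zero A']
  refine eval_restrictNull_eq_zero (hcons B B') ha hb ?_
  rcases h with h | h
  · refine .inl fun h0 => h ?_
    rw [eq_cons_zero A, h0]
    funext i
    rw [Subsingleton.elim i 0]
    rfl
  · refine .inr fun h0 => h ?_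
    rw [eq_cons_zero A', h0]
    funext i
    rw [Subsingleton.elim i 0]
    rfl

end QuadraticCurrents

/-! ### Reduction of quadratic currents by their null values -/

section QuadraticReduction

open MvPolynomial

variable {n p q : ℕ}

theorem restrictNull_monomial (a b c : ℂ) (κ : MomVar 2 →₀ ℕ) :
    restrictNull a b (monomial κ c) = monomial (glue fun _ => part κ 0 + part κ 1)
      (c * (a ^ (part κ 0).deg false * (-b) ^ (part κ 0).deg true *
        (b ^ (part κ 1).deg false * a ^ (part κ 1).deg true))) := by
  have h : ∀ (k : ℕ) (v : MomVar 1), (X v : MvPolynomial (MomVar 1) ℂ) ^ k =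
    monomial (Finsupp.single v k) 1 := fun k v => X_pow_eq_monomial
  rw [restrictNull, aeval_monomial, Finsupp.prod_fintype _ _ (by simp)]
  rw [Fintype.prod_prod_type, Fin.prod_univ_two]
  simp only [Fintype.prod_prod_type, Fintype.prod_bool, Fin.prod_univ_two, mul_pow, h, algebraMap_eq]
  simp only [← C_pow, C_mul_monomial, monomial_mul]
  simp only [if_true, Bool.false_eq_true, if_false, Fin.isValue, one_ne_zero]
  have e : ∀ κ₁ κ₂ : MomVar 1 →₀ ℕ, ∀ c₁ c₂ : ℂ, κ₁ = κ₂ → c₁ = c₂ →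
    monomial κ₁ c₁ = monomial κ₂ c₂ := fun _ _ _ _ h h' => by rw [h, h']
  refine e _ _ _ _ ?_ ?_
  · ext ⟨i, s, A⟩
    rw [Subsingleton.elim i 0]
    cases s <;> fin_cases A <;> simp [glue]
  · simp only [JetExp.deg, part_apply, pow_add]
    ring

/-- Second partial derivatives commute. -/
theorem exchange_symbZero (hn : 1 ≤ n) (F : localFn n) :
    exchange (symbZero hn 2 F) = symbZero hn 2 F := by
  ext κ
  have h := coeff_rename_mapDomain _ rev_injective (symbZero hn 2 F)
    (Finsupp.mapDomain (fun v : MomVar 2 => (Fin.rev v.1, v.2)) κ)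
  rw [← Finsupp.mapDomain_comp] at h
  have hid : (fun v : MomVar 2 => (Fin.rev v.1, v.2)) ∘ (fun v => (Fin.rev v.1, v.2)) = id := by
    funext v
    simp
  rw [hid, Finsupp.mapDomain_id] at h
  refine h.trans ?_
  rw [coeff_symbZero, coeff_symbZero]
  simp only [iterPd_succ, part_mapDomain_rev]
  rw [pd_comm]
  rfl

theorem helicity_of_coeff_symbZero (hn : 1 ≤ n) {m : ℕ} {F : localFn n} {κ : MomVar m →₀ ℕ}
    (h : (symbZero hn m F).coeff κ ≠ 0) (i : Fin m) :
    (part κ i).IsPos n ∨ (part κ i).IsNeg n := by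
  by_contra! h'
  refine h ?_
  rw [coeff_symbZero, iterPd_eq_zero _ i, map_zero]
  rw [pd_eq_zero h'.1 h'.2]
  rfl

/-- Exchanging the factors turns the null configuration of (a, b, o, ι) into that of (b, a, o, -ι).
-/
theorem restrictNull_exchange (a b : ℂ) (f : MvPolynomial (MomVar 2) ℂ) (o ι : Fin 1 → Fin 2 → ℂ) :
    eval (momPt o ι) (restrictNull a b (exchange f)) =
      eval (momPt o (-ι)) (restrictNull b a f) := by
  rw [restrictNull, restrictNull, exchange, aeval_rename, eval_aeval, eval_aeval]
  congr 2
  funext ⟨i, s, A⟩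
  fin_cases i <;> cases s <;> simp

variable {hn : 1 ≤ n}

theorem HasModel.sum {ι : Type*} (s : Finset ι) {κ : ι → ℂ → ℂ → ℂ}
    (h : ∀ i ∈ s, HasModel hn p q (κ i)) : HasModel hn p q fun a b => ∑ i ∈ s, κ i a b := by
  classical
  induction s using Finset.induction_on with
  | empty => simpa using HasModel.zero
  | insert i s hi ih =>
    simp only [Finset.sum_insert hi]
    exact (h i (Finset.mem_insert_self i s)).add
      (ih fun j hj => h j (Finset.mem_insert_of_mem hj))

/-- The weights that occur in symbols have models, after symmetrisation. -/
theorem hasModel_weight {d₁ d₁' d₂ d₂' : ℕ} (hp : d₁ + d₂ = p + 1) (hq : d₁' + d₂' = q + 1)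
    (h₁ : d₁ = n + d₁' ∨ d₁' = n + d₁) (h₂ : d₂ = n + d₂' ∨ d₂' = n + d₂) :
    HasModel hn p q fun a b => a ^ d₁ * (-b) ^ d₁' * (b ^ d₂ * a ^ d₂') +
      (-1) ^ (q + 1) * (b ^ d₁ * (-a) ^ d₁' * (a ^ d₂ * b ^ d₂')) := by
  have key : ∀ a b : ℂ, a ^ d₁ * (-b) ^ d₁' * (b ^ d₂ * a ^ d₂') +
      (-1) ^ (q + 1) * (b ^ d₁ * (-a) ^ d₁' * (a ^ d₂ * b ^ d₂')) =
      (-1) ^ d₁' * (a ^ (d₁ + d₂') * b ^ (d₁' + d₂)) +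
        (-1) ^ (q + 1) * (-1) ^ d₁' * (a ^ (d₁' + d₂) * b ^ (d₁ + d₂')) := by
    intro a b
    rw [neg_pow b, neg_pow a]
    ring
  simp only [key]
  -- Equal helicities give equal powers of a and b, so the two terms cancel for even q; for odd q a
  -- chiral tensor or its conjugate is available. Opposite helicities force p = q and lead to the
  -- spacetime and zilch tensors.
  have hdiag : ∀ N : ℕ, d₁ + d₂' = N → d₁' + d₂ = N →
      (Odd q → HasModel hn p q fun a b => a ^ N * b ^ N) →
      HasModel hn p q fun a b => (-1) ^ d₁' * (a ^ (d₁ + d₂') * b ^ (d₁' + d₂)) +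
        (-1) ^ (q + 1) * (-1) ^ d₁' * (a ^ (d₁' + d₂) * b ^ (d₁ + d₂')) := by
    intro N h3 h4 h5
    rw [h3, h4]
    rcases Nat.even_or_odd q with he | ho
    · convert HasModel.zero (hn := hn) using 3 with a b
      rw [he.add_one.neg_one_pow]
      ring
    · exact ((h5 ho).smul _).add ((h5 ho).smul _)
  rcases h₁ with h₁ | h₁ <;> rcases h₂ with h₂ | h₂
  · exact hdiag (q + 1 + n) (by omega) (by omega) fun ho =>
      hasModel_conj_chiral hn ho (by omega)
  · obtain rfl : p = q := by omega
    have h := hasModel_spacetime (p := p) hn (by omega)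
    have e1 : d₁ + d₂' = p + 1 + n := by omega
    have e2 : d₁' + d₂ = p + 1 - n := by omega
    rw [e1, e2]
    exact (h.2.smul _).add (h.1.smul _)
  · obtain rfl : p = q := by omega
    have h := hasModel_spacetime (p := p) hn (by omega)
    have e1 : d₁ + d₂' = p + 1 - n := by omega
    have e2 : d₁' + d₂ = p + 1 + n := by omega
    rw [e1, e2]
    exact (h.1.smul _).add (h.2.smul _)
  · exact hdiag (p + 1 + n) (by omega) (by omega) fun ho =>
      hasModel_chiral hn (by rw [Nat.odd_iff] at ho ⊢; omega) (by omega)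

/-- Conserved covariant quadratic currents are equivalent to combinations of the basic tensors. -/
theorem reducesToBasic_quadratic (hn : 1 ≤ n)
    {P : Idx 1 → Idx 1 → Idx p → Idx q → MvPolynomial (MomVar 2) ℂ}
    (hsym : ∀ (τ : Equiv.Perm (Fin p)) (τ' : Equiv.Perm (Fin q)) A A' B B',
      P A A' (B ∘ τ) (B' ∘ τ') = P A A' B B')
    (hcov : ∀ (g : SL2C) (o : Fin 2 → Fin 2 → ℂ) A A' B B',
      eval (slicePt fun i => (g : Matrix (Fin 2) (Fin 2) ℂ).mulVec (o i)) (P A A' B B') =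
        Arr.act g (fun C C' E E' => eval (slicePt o) (P C C' E E')) A A' B B')
    (hcons : ∀ B B', ∑ c : Fin 2 × Fin 2, totalMom ℂ 2 c.1 c.2 *
      raise (fun A A' => P ![A] ![A'] B B') c = 0)
    (hexch : ∀ A A' B B', exchange (P A A' B B') = P A A' B B')
    (hhel : ∀ A A' B B' κ, (P A A' B B').coeff κ ≠ 0 →
      ∀ i, (part κ i).IsPos n ∨ (part κ i).IsNeg n) :
    ReducesToBasic hn fun B B' A A' => realizeC n 2 (P ![A] ![A'] B B') := by
  choose κ hκ using fun (a : {a : ℂ // a ≠ 0}) (b : {b : ℂ // b ≠ 0}) =>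
    exists_restrictNull_eq hsym hcov hcons a.2 b.2
  let P₀ := P ![0] ![0] 0 0
  let w : (MomVar 2 →₀ ℕ) → ℂ → ℂ → ℂ := fun μ a b =>
    a ^ (part μ 0).deg false * (-b) ^ (part μ 0).deg true *
      (b ^ (part μ 1).deg false * a ^ (part μ 1).deg true)
  -- The exponent of the product of momenta with all indices equal to 0; comparing its coefficients
  -- shows that κ is a polynomial in a and b.
  let e : MomVar 1 →₀ ℕ := glue (Pi.single 0 (strExp ![0] ![0])) +
    glue (Pi.single 0 (strExp (0 : Idx p) (0 : Idx q)))
  have he : ∀ s, (part e 0).deg s = if s then q + 1 else p + 1 := by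
    intro s
    rw [part_add, part_glue, part_glue, Pi.add_apply, Pi.single_eq_same, Pi.single_eq_same,
      deg_add]
    cases s
    · rw [deg_strExp_false, deg_strExp_false, add_comm]
      rfl
    · rw [deg_strExp_true, deg_strExp_true, add_comm]
      rfl
  let S := P₀.support.filter fun μ => (glue fun _ => part μ 0 + part μ 1) = e
  have h1 : ∀ a b, κ a b = ∑ μ ∈ S, P₀.coeff μ * w μ a b := by
    intro a b
    have h2 := congrArg (fun f => MvPolynomial.coeff e f) (hκ a b ![0] ![0] 0 0)
    simp only [strMom_eq_monomial, monomial_mul, C_mul_monomial, mul_one] at h2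
    rw [coeff_monomial, if_pos rfl] at h2
    rw [← h2]
    change MvPolynomial.coeff e (restrictNull a b P₀) = _
    conv_lhs => rw [P₀.as_sum]
    rw [map_sum, coeff_sum, Finset.sum_filter]
    refine Finset.sum_congr rfl fun μ _ => ?_
    rw [restrictNull_monomial, coeff_monomial]
  -- The symbol is invariant under exchange, which swaps a and b and reverses ι; the product of
  -- momenta has degree q + 1 in ι.
  have h2 : ∀ a b, κ a b = (-1) ^ (q + 1) * κ b a := by
    intro a b
    have h3 := restrictNull_exchange a b P₀ 1 1
    rw [hexch, hκ a b, hκ b a] at h3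
    simp only [map_mul, eval_C, eval_strMom, momPt_false, momPt_true] at h3
    simp at h3
    rw [h3]
    ring
  -- A single monomial need not have a model, but its average with its exchange does, and by the
  -- symmetry of κ these averages add up to κ.
  have h3 : HasModel hn p q fun a b => ∑ μ ∈ S, ((2 : ℂ)⁻¹ * P₀.coeff μ) *
      (w μ a b + (-1) ^ (q + 1) * w μ b a) := by
    refine HasModel.sum _ fun μ hμ => HasModel.smul _ ?_
    rw [Finset.mem_filter, mem_support_iff] at hμ
    have h4 : ∀ s, (part μ 0).deg s + (part μ 1).deg s = if s then q + 1 else p + 1 := by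
      intro s
      rw [← he, ← hμ.2, part_glue, deg_add]
    have h5 := hhel _ _ _ _ μ hμ.1
    exact hasModel_weight (h4 false) (h4 true) (h5 0) (h5 1)
  obtain ⟨R, hR1, hR2, hR3⟩ := h3
  -- The current and its model agree at the null configurations with a, b ≠ 0, so their difference
  -- is a curl.
  have h4 : ∀ B B', IsSpinorCurl (totalDLin hn) fun A A' =>
      realizeC n 2 (P ![A] ![A'] B B' - R B B' A A') := by
    intro B B'
    refine IsSpinorCurl.realizeC hn ?_
    have hraise : ∀ c, raise (fun A A' => P ![A] ![A'] B B' - R B B' A A') c =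
        raise (fun A A' => P ![A] ![A'] B B') c - raise (R B B') c := by
      intro c
      simp only [raise, smul_sub, Finset.sum_sub_distrib]
    obtain ⟨Θ, hΘ1, hΘ2, hΘ3⟩ := exists_potential_bilinear
      (raise fun A A' => P ![A] ![A'] B B' - R B B' A A')
      (by simp only [hraise, mul_sub, Finset.sum_sub_distrib, hcons, hR1, sub_zero])
      (fun a b ha hb => by
        rw [raise_one_one, map_sub, hR2, hκ ⟨a, ha⟩ ⟨b, hb⟩, sub_eq_zero]
        have h5 : κ ⟨a, ha⟩ ⟨b, hb⟩ = ∑ μ ∈ S, ((2 : ℂ)⁻¹ * P₀.coeff μ) *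
            (w μ a b + (-1) ^ (q + 1) * w μ b a) := by
          have h6 := h2 ⟨a, ha⟩ ⟨b, hb⟩
          have h7 := h1 ⟨b, hb⟩ ⟨a, ha⟩
          have h8 := h1 ⟨a, ha⟩ ⟨b, hb⟩
          have h9 : ∑ μ ∈ S, ((2 : ℂ)⁻¹ * P₀.coeff μ) * (w μ a b + (-1) ^ (q + 1) * w μ b a) =
              (2 : ℂ)⁻¹ * ∑ μ ∈ S, P₀.coeff μ * w μ a b +
                (2 : ℂ)⁻¹ * ((-1) ^ (q + 1) * ∑ μ ∈ S, P₀.coeff μ * w μ b a) := by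
            simp only [Finset.mul_sum, ← Finset.sum_add_distrib]
            exact Finset.sum_congr rfl fun μ _ => by ring
          rw [h9, ← h8, ← h7, ← h6]
          ring
        rw [h5]
        simp [strMom])
    exact isSpinorCurl_of_skew hΘ1 hΘ2 hΘ3
  convert hR3.add (ReducesToBasic.of_curl (hn := hn) h4) using 1
  funext B B' A A'
  simp only [Pi.add_apply, ← map_add]
  congr 1
  ring

end QuadraticReduction

/-! ### Conserved tensors -/

section ConservedTensors

open MvPolynomial

variable {n p q : ℕ}

/-- Covariant conserved tensors are equivalent to linear combinations of the basic ones. -/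
theorem exists_tensorEquiv (hn : 1 ≤ n) {T : SpinorFn n 1 1 p q}
    (hT : IsCovariantConservedTensor T) :
    ∃ G ∈ Submodule.span ℂ (basicTensors n p q), TensorEquiv T G := by
  obtain ⟨F, hTF, hcov⟩ := exists_components hT.isLocal hT.isCovariant
  have hsym : ∀ (τ : Equiv.Perm (Fin p)) (τ' : Equiv.Perm (Fin q)) A A' B B',
      F A A' (B ∘ τ) (B' ∘ τ') = F A A' B B' := by
    intro τ τ' A A' B B'
    refine Subtype.ext (_root_.funext fun j => ?_)
    have h := hT.isSymm 1 1 τ τ' 0 j A A' B B'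
    rw [hTF, hTF] at h
    exact h
  have hdiv : ∀ B B', ∑ c : Fin 2 × Fin 2, totalD hn c.1 c.2
      (raise (fun A A' => F ![A] ![A'] B B') c) = 0 := by
    intro B B'
    refine Subtype.ext (_root_.funext fun j => ?_)
    have h := hT.divergence_eq B B' 0 j
    simp only [hTF, ← totalD_apply hn] at h
    simp [eps] at h
    simp only [Fintype.sum_prod_type, Fin.sum_univ_two, raise_zero_zero, raise_zero_one,
      raise_one_zero, raise_one_one, map_neg]
    change (totalD hn 0 0 (F ![1] ![1] B B') : Jet n → ℂ) j +
      -(totalD hn 0 1 (F ![1] ![0] B B') : Jet n → ℂ) j +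
      (-(totalD hn 1 0 (F ![0] ![1] B B') : Jet n → ℂ) j +
      (totalD hn 1 1 (F ![0] ![0] B B') : Jet n → ℂ) j) = 0
    linear_combination h
  have hcons : ∀ m B B', ∑ c : Fin 2 × Fin 2, totalMom ℂ m c.1 c.2 *
      raise (fun A A' => symbZero hn m (F ![A] ![A'] B B')) c = 0 := by
    intro m B B'
    have h := congrArg (symbZero hn m) (hdiv B B')
    rw [symbZero_sum, symbZero_zero] at h
    rw [← h]
    refine Finset.sum_congr rfl fun c _ => ?_
    rw [symbZero_totalD]
    congr 1
    rcases c with ⟨c, c'⟩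
    have hneg : ∀ K : localFn n, symbZero hn m (-K) = -symbZero hn m K := fun K => by
      rw [← zero_sub, symbZero_sub, symbZero_zero, zero_sub]
    fin_cases c <;> fin_cases c' <;>
      simp only [Fin.mk_zero, Fin.mk_one, Fin.isValue, raise_zero_zero,
        raise_zero_one, raise_one_zero, raise_one_one, hneg]
  have hlin := reducesToBasic_linear hn (P := fun A A' B B' => symbZero hn 1 (F A A' B B'))
    (fun τ τ' A A' B B' => by rw [hsym])
    (fun g o A A' B B' => eval_symbZero_covariant hn hcov g (fun _ => o) A A' B B') (hcons 1)
  have hquad := reducesToBasic_quadratic hn (P := fun A A' B B' => symbZero hn 2 (F A A' B B'))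
    (fun τ τ' A A' B B' => by rw [hsym])
    (fun g o A A' B B' => eval_symbZero_covariant hn hcov g o A A' B B') (hcons 2)
    (fun A A' B B' => exchange_symbZero hn _)
    (fun A A' B B' κ h i => helicity_of_coeff_symbZero hn h i)
  -- The linear, quadratic and remainder terms of Taylor's formula, with the factor 1/2 of the
  -- second order. The constant term is left to the potential linear in x in `isCurl_of_components`.
  obtain ⟨G, hG, g, hGg, hcurl⟩ := (hlin.add (hquad.smul (2 : ℂ)⁻¹)).add
    (ReducesToBasic.of_curl (hn := hn) fun B B' => isSpinorCurl_remainder hn (hdiv B B'))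
  refine ⟨G, hG, isCurl_of_components hn (fun τ τ' x j A A' B B' => ?_)
    (fun B B' A A' => evalZero n (F ![A] ![A'] B B')) _ (fun x j A A' B B' => ?_) hcurl⟩
  · have h1 := symm_of_mem_span hG τ τ' x j A A' B B'
    have h2 : T x j A A' (B ∘ τ) (B' ∘ τ') = T x j A A' B B' := by rw [hTF, hTF, hsym]
    exact congrArg₂ (· - ·) h2 h1
  · change T x j ![A] ![A'] B B' - G x j ![A] ![A'] B B' = _
    rw [hTF, hGg]
    have h := congrArg (fun K : localFn n => (K : Jet n → ℂ) j)
      (taylor_three hn (F ![A] ![A'] B B'))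
    rw [show (F ![A] ![A'] B B' : Jet n → ℂ) j = _ from h]
    have h2 : ∀ (c z z' z'' r : ℂ), c + z + z' + z'' - r = c + (z + z' + z'' - r) := by
      intro c z z' z'' r
      ring
    exact h2 _ _ _ _ _

end ConservedTensors

end MasslessSpin

end

theorem theorem2p3 (n : ℕ) (hn : 1 ≤ n) (p q : ℕ) :
    (∀ X : MasslessSpin.SpinorFn n n 0 p q, MasslessSpin.IsCovariantSymmetryOperator X →
      X ∈ Submodule.span ℂ {Y | MasslessSpin.IsBasicOperator n p q Y}) ∧
    (∀ T : MasslessSpin.SpinorFn n 1 1 p q, MasslessSpin.IsCovariantConservedTensor T →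
      ∃ G ∈ Submodule.span ℂ (MasslessSpin.basicTensors n p q),
        MasslessSpin.TensorEquiv T G) :=
  ⟨fun _ hX => MasslessSpin.mem_span_basicOperators hn hX,
    fun _ hT => MasslessSpin.exists_tensorEquiv hn hT⟩
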